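/- Conventions. A functor between bicategories is a pseudofunctor (its constraints $\varphi_0 : 1_{Fa} \Rightarrow F(1_a)$ and $\varphi_2$ are invertible), a 2-category is a strict bicategory, and a 2-functor is a functor between 2-categories whose constraints are identities. A string $(f_1,\dots,f_n)$ of composable 1-cells is written with the 1-cell applied first on the left. *Strictification.* For a bicategory $B$, the 2-category $\mathrm{st}B$ has the objects of $B$; its 1-cells $a \to b$ are the (possibly empty) strings of composable 1-cells of $B$ from $a$ to $b$, composed by concatenation. Let $e$ be the identity on objects and send the empty string at $a$ to $1_a$, the string $(f)$ to $f$, and $(f_1,\dots,f_n)$ to the composite of $f_1$ followed by $e(f_2,\dots,f_n)$. The 2-cells $p \Rightarrow q$ of $\mathrm{st}B$ are the 2-cells $e(p) \Rightarrow e(q)$ of $B$; they are composed vertically as in $B$, and horizontally as in $B$ after conjugation with the coherence isomorphisms. This makes $e : \mathrm{st}B \to B$ a functor. The functor $f_B : B \to \mathrm{st}B$ is the identity on objects and on 2-cells, sends each 1-cell to the string of length one that it forms, and has coherence isomorphisms as constraints. *Gray tensor product.* For 2-categories $A, B$, the 2-category $A \otimes B$ has objects $a \otimes b$. Its 1-cells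 are generated by $f \otimes 1 : a \otimes b \to a' \otimes b$ for $f : a \to a'$ in $A$ and $1 \otimes g : a \otimes b \to a \otimes b'$ for $g : b \to b'$ in $B$, subject to the relations that $f \mapsto f \otimes 1$ and $g \mapsto 1 \otimes g$ preserve identities and composition. Its 2-cells are generated, under vertical composition and whiskering, by $\alpha \otimes 1$, $1 \otimes \beta$ (for 2-cells $\alpha$ of $A$ and $\beta$ of $B$) and invertible 2-cells $$\Sigma_{f,g} : (f \otimes 1)(1 \otimes g) \Rightarrow (1 \otimes g)(f \otimes 1)$$ (composites read from right to left), subject to the axioms of a 2-category, to the relations that $(-) \otimes 1$ and $1 \otimes (-)$ are 2-functors, and to the relations that $\Sigma_{f,g}$ is natural in $f$ and $g$ and compatible with identities and composition of 1-cells in each variable. The universal cubical functor $c : A \times B \to A \otimes B$ sends $(a,b)$ to $a \otimes b$, sends $(f,g)$ to $(1 \otimes g)(f \otimes 1)$ and $(\alpha,\beta)$ to $(1 \otimes \beta) * (\alpha \otimes 1)$, and its comparison 2-cells are whiskerings of the $\Sigma^{-1}$. *Comparison functor.* For bicategories $X, Y$, the cubical functor $\hat{\mathrm{st}} : \mathrm{st}X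 \times \mathrm{st}Y \to \mathrm{st}(X \times Y)$ is the identity on objects, is given on 1-cells by $$\bigl((f_1,\dots,f_n),(g_1,\dots,g_m)\bigr) \mapsto \bigl((f_1,1),\dots,(f_n,1),(1,g_1),\dots,(1,g_m)\bigr),$$ and on 2-cells and constraints by transport along the coherence isomorphisms between the composite $e_{X\times Y}$ of this string and $(e_X(f_1,\dots,f_n), e_Y(g_1,\dots,g_m))$; these isomorphisms form an invertible icon $e_{X\times Y}\,\hat{\mathrm{st}} \cong e_X \times e_Y$. *Icons.* For functors $F, G : B \to C$ that agree on objects, an icon $\alpha : F \Rightarrow G$ consists of natural transformations $F_{ab} \Rightarrow G_{ab} : B(a,b) \to C(Fa,Fb)$ such that $\alpha_{1_a}\varphi_0 = \psi_0$ and $\alpha_{f*g}\,\varphi_2 = \psi_2\,(\alpha_f * \alpha_g)$, where $\varphi_0,\varphi_2$ and $\psi_0,\psi_2$ are the constraints of $F$ and $G$. The 2-category $\mathbf{Gray}_{icon}$ has 2-categories as objects, 2-functors as 1-cells and icons as 2-cells. A 1-cell $u : a \to b$ of a bicategory is an internal equivalence if it has a pseudo-inverse, that is, a 1-cell $\bar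 u : b \to a$ such that $\bar u u \cong 1_a$ and $u \bar u \cong 1_b$. **Proposition.** Let $X$ and $Y$ be bicategories. There is a unique 2-functor $$\chi = \chi_{XY} : \mathrm{st}X \otimes \mathrm{st}Y \longrightarrow \mathrm{st}(X \times Y)$$ with $\chi\, c = \hat{\mathrm{st}}$, and $\chi$ is an internal equivalence in $\mathbf{Gray}_{icon}$. Moreover there is a 2-functor $\bar\chi : \mathrm{st}(X \times Y) \to \mathrm{st}X \otimes \mathrm{st}Y$ with $$\bar\chi\, f_{X \times Y} = c\,(f_X \times f_Y)$$ which is a pseudo-inverse of $\chi$ in $\mathbf{Gray}_{icon}$: $\bar\chi\chi \cong 1$ and $\chi\bar\chi \cong 1$ by invertible icons. -/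

import Mathlib

open CategoryTheory Bicategory

universe w v u w₁ v₁ u₁ w₂ v₂ u₂ w₃ v₃ u₃ w₄ v₄ u₄

/-- Strings of composable arrows; `cons f p` is the string in which `f` is applied first. -/
inductive Str {B : Type u} [Quiver.{v} B] : B → B → Type (max u v)
  | nil (a : B) : Str a a
  | cons {a b c : B} (f : a ⟶ b) (p : Str b c) : Str a c

namespace Str

section Quiver

variable {B : Type u₁} [Quiver.{v₁} B] {C : Type u₂} [Quiver.{v₂} C]

/-- Concatenation of strings. -/
def append : {a b c : B} → Str a b → Str b c → Str a c
  | _, _, _, nil _, q => q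
  | _, _, _, cons f p, q => cons f (append p q)

theorem append_nil : {a b : B} → (p : Str a b) → p.append (nil b) = p
  | _, _, nil _ => rfl
  | _, _, cons f p => congrArg (cons f) (append_nil p)

theorem append_assoc : {a b c d : B} → (p : Str a b) → (q : Str b c) → (r : Str c d) →
    (p.append q).append r = p.append (q.append r)
  | _, _, _, _, nil _, _, _ => rfl
  | _, _, _, _, cons f p, q, r => congrArg (cons f) (append_assoc p q r)

/-- The action of a morphism of quivers on strings. -/
def map (F : B ⥤q C) : {a b : B} → Str a b → Str (F.obj a) (F.obj b)
  | _, _, nil a => nil (F.obj a)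
  | _, _, cons f p => cons (F.map f) (map F p)

end Quiver

section Eval

variable {B : Type u} [Bicategory.{w, v} B]

/-- The composite of the nonempty string `cons f p`. -/
def evalCons : {a b c : B} → (a ⟶ b) → Str b c → (a ⟶ c)
  | _, _, _, f, nil _ => f
  | _, _, _, f, cons g p => f ≫ evalCons g p

/-- The composite in the bicategory `B` of a string of arrows: the empty string is sent to the
identity, the string of length one consisting of `f` to `f`, and the string consisting of
`f₁, f₂, …, fₙ` to `f₁ ≫ (f₂ ≫ (⋯ ≫ fₙ))`. -/
def eval : {a b : B} → Str a b → (a ⟶ b)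
  | _, _, nil a => 𝟙 a
  | _, _, cons f p => evalCons f p

/-- The coherence isomorphism `f ≫ eval p ≅ eval (cons f p)`. -/
def consIso : {a b c : B} → (f : a ⟶ b) → (p : Str b c) → (f ≫ eval p ≅ eval (cons f p))
  | _, _, _, f, nil _ => ρ_ f
  | _, _, _, f, cons g p => Iso.refl (f ≫ evalCons g p)

/-- The coherence isomorphism `eval p ≫ eval q ≅ eval (p.append q)`. -/
def appendIso : {a b c : B} → (p : Str a b) → (q : Str b c) →
    (eval p ≫ eval q ≅ eval (p.append q))
  | _, _, _, nil _, q => λ_ (eval q)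
  | _, _, _, cons f p, q =>
      whiskerRightIso (consIso f p).symm (eval q) ≪≫ α_ f (eval p) (eval q) ≪≫
        whiskerLeftIso f (appendIso p q) ≪≫ consIso f (p.append q)

theorem consIso_hom_eqToHom {a b c : B} (f : a ⟶ b) {p p' : Str b c} (h : p = p') :
    (consIso f p).hom ≫ eqToHom (congrArg (fun s => eval (cons f s)) h) =
      f ◁ eqToHom (congrArg eval h) ≫ (consIso f p').hom := by
  subst h; simp

theorem assoc_aux {a b c d e : B} (f : a ⟶ b) {P : b ⟶ c} {Q : c ⟶ d} {R : d ⟶ e}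
    {PQ : b ⟶ d} {QR : c ⟶ e} {X X' : b ⟶ e} {FP : a ⟶ c} {FPQ : a ⟶ d} {FX FX' : a ⟶ e}
    (kP : f ≫ P ≅ FP) (kPQ : f ≫ PQ ≅ FPQ) (k : f ≫ X ≅ FX) (k' : f ≫ X' ≅ FX')
    (A : P ≫ Q ≅ PQ) (A' : PQ ≫ R ≅ X') (Aqr : Q ≫ R ≅ QR) (A'' : P ≫ QR ≅ X)
    (t : X ⟶ X') (t' : FX ⟶ FX') (h : k.hom ≫ t' = f ◁ t ≫ k'.hom)
    (ih : A.hom ▷ R ≫ A'.hom = (α_ P Q R).hom ≫ P ◁ Aqr.hom ≫ A''.hom ≫ t) :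
    (whiskerRightIso kP.symm Q ≪≫ α_ f P Q ≪≫ whiskerLeftIso f A ≪≫ kPQ).hom ▷ R ≫
        (whiskerRightIso kPQ.symm R ≪≫ α_ f PQ R ≪≫ whiskerLeftIso f A' ≪≫ k').hom =
      (α_ FP Q R).hom ≫ FP ◁ Aqr.hom ≫
        (whiskerRightIso kP.symm QR ≪≫ α_ f P QR ≪≫ whiskerLeftIso f A'' ≪≫ k).hom ≫ t' := by
  have ih' := congrArg (fun η => f ◁ η) ih
  simp only [Bicategory.whiskerLeft_comp] at ih'
  simp only [Iso.trans_hom, whiskerRightIso_hom, whiskerLeftIso_hom, Iso.symm_hom,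
    comp_whiskerRight, Category.assoc, hom_inv_whiskerRight_assoc, h, whisker_assoc,
    Iso.inv_hom_id_assoc]
  rw [reassoc_of% ih']
  simp [whisker_exchange_assoc]

theorem appendIso_nil : {a b : B} → (p : Str a b) →
    (appendIso p (nil b)).hom =
      (ρ_ (eval p)).hom ≫ eqToHom (congrArg eval (append_nil p).symm)
  | _, _, nil a => by
      simp [appendIso, append, eval, unitors_equal]
  | _, _, cons (b := b) f p => by
      have key : ∀ {a b c : B} (f : a ⟶ b) {P X : b ⟶ c} {FP FX : a ⟶ c}
        (kP : f ≫ P ≅ FP) (k : f ≫ X ≅ FX) (A : P ≫ 𝟙 c ≅ X) (t : P ⟶ X) (t' : FP ⟶ FX)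
        (_ : kP.hom ≫ t' = f ◁ t ≫ k.hom) (_ : A.hom = (ρ_ P).hom ≫ t),
        (whiskerRightIso kP.symm (𝟙 c) ≪≫ α_ f P (𝟙 c) ≪≫ whiskerLeftIso f A ≪≫ k).hom =
          (ρ_ FP).hom ≫ t' := by
        intro a b c f P X FP FX kP k A t t' h ih
        simp [ih, ← h]
      exact key f _ _ _ _ _ (consIso_hom_eqToHom f (append_nil p).symm) (appendIso_nil p)

theorem appendIso_assoc : {a b c d : B} → (p : Str a b) → (q : Str b c) → (r : Str c d) →
    (appendIso p q).hom ▷ eval r ≫ (appendIso (p.append q) r).hom =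
      (α_ (eval p) (eval q) (eval r)).hom ≫ eval p ◁ (appendIso q r).hom ≫
        (appendIso p (q.append r)).hom ≫ eqToHom (congrArg eval (append_assoc p q r).symm)
  | _, _, _, _, nil a, q, r => by
      simp [appendIso, append, eval]
  | _, _, _, _, cons f p, q, r =>
      assoc_aux f _ _ _ _ _ _ _ _ _ _ (consIso_hom_eqToHom f (append_assoc p q r).symm)
        (appendIso_assoc p q r)

end Eval
end Str

/-- The strictification `st B`: the objects are those of `B`. -/
structure St (B : Type u) : Type u where
  /-- the underlying object of `B` -/
  as : B

namespace St

variable {B : Type u} [Bicategory.{w, v} B]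

/-- The 1-cells of `st B` are strings of composable 1-cells of `B`, composed by concatenation. -/
instance : CategoryStruct.{max u v} (St B) where
  Hom a b := Str a.as b.as
  id a := Str.nil a.as
  comp p q := Str.append p q

/-- The composite in `B` of a 1-cell of `st B`. -/
def ev {a b : St B} (p : a ⟶ b) : a.as ⟶ b.as := Str.eval p

/-- The 2-cells of `st B` from `p` to `q` are the 2-cells in `B` between their composites. -/
structure Cell {a b : St B} (p q : a ⟶ b) : Type w where
  /-- the representing 2-cell of `B` -/
  val : ev p ⟶ ev q

/-- Vertical composition of 2-cells is as in `B`. -/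
instance homCat (a b : St B) : Category.{w} (a ⟶ b) where
  Hom p q := Cell p q
  id p := ⟨𝟙 (ev p)⟩
  comp η θ := ⟨η.val ≫ θ.val⟩

theorem cell_ext {a b : St B} {p q : a ⟶ b} {η θ : p ⟶ q} (h : Cell.val η = Cell.val θ) :
    η = θ := by
  have key : ∀ x y : Cell p q, x.val = y.val → x = y := by
    rintro ⟨x⟩ ⟨y⟩ h; cases h; rfl
  exact key η θ h

@[simp]
theorem id_val {a b : St B} (p : a ⟶ b) : Cell.val (𝟙 p) = 𝟙 (ev p) := rfl

@[simp]
theorem comp_val {a b : St B} {p q r : a ⟶ b} (η : p ⟶ q) (θ : q ⟶ r) :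
    Cell.val (η ≫ θ) = Cell.val η ≫ Cell.val θ := rfl

@[simp]
theorem eqToHom_val {a b : St B} {p q : a ⟶ b} (h : p = q) :
    Cell.val (eqToHom h) = eqToHom (congrArg ev h) := by
  subst h; rfl

/-- An invertible 2-cell of `B` between composites is an invertible 2-cell of `st B`. -/
def isoMk {a b : St B} {p q : a ⟶ b} (e : ev p ≅ ev q) : p ≅ q where
  hom := ⟨e.hom⟩
  inv := ⟨e.inv⟩
  hom_inv_id := cell_ext e.hom_inv_id
  inv_hom_id := cell_ext e.inv_hom_id

@[simp]
theorem isoMk_hom_val {a b : St B} {p q : a ⟶ b} (e : ev p ≅ ev q) :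
    Cell.val (isoMk e).hom = e.hom := rfl

@[simp]
theorem isoMk_inv_val {a b : St B} {p q : a ⟶ b} (e : ev p ≅ ev q) :
    Cell.val (isoMk e).inv = e.inv := rfl

/-- The coherence isomorphism `ev p ≫ ev q ≅ ev (p ≫ q)`. -/
def φ {a b c : St B} (p : a ⟶ b) (q : b ⟶ c) : ev p ≫ ev q ≅ ev (p ≫ q) :=
  Str.appendIso p q

theorem id_comp' {a b : St B} (p : a ⟶ b) : 𝟙 a ≫ p = p := rfl

theorem comp_id' {a b : St B} (p : a ⟶ b) : p ≫ 𝟙 b = p := Str.append_nil p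

theorem assoc' {a b c d : St B} (p : a ⟶ b) (q : b ⟶ c) (r : c ⟶ d) :
    (p ≫ q) ≫ r = p ≫ q ≫ r := Str.append_assoc p q r

theorem φ_assoc {a b c d : St B} (p : a ⟶ b) (q : b ⟶ c) (r : c ⟶ d) :
    (φ p q).hom ▷ ev r ≫ (φ (p ≫ q) r).hom =
      (α_ (ev p) (ev q) (ev r)).hom ≫ ev p ◁ (φ q r).hom ≫ (φ p (q ≫ r)).hom ≫
        eqToHom (congrArg ev (assoc' p q r).symm) :=
  Str.appendIso_assoc p q r

theorem ev_id (a : St B) : ev (𝟙 a) = 𝟙 a.as := rfl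

theorem φ_id_left {a b : St B} (p : a ⟶ b) :
    φ (𝟙 a) p = whiskerRightIso (eqToIso (ev_id a)) (ev p) ≪≫ λ_ (ev p) ≪≫
      eqToIso (congrArg ev (id_comp' p).symm) := by
  ext
  simp only [Iso.trans_hom, whiskerRightIso_hom, eqToIso.hom, eqToHom_whiskerRight]
  exact ((Category.id_comp _).trans (Category.comp_id _)).symm

theorem φ_id_right {a b : St B} (p : a ⟶ b) :
    φ p (𝟙 b) = whiskerLeftIso (ev p) (eqToIso (ev_id b)) ≪≫ ρ_ (ev p) ≪≫
      eqToIso (congrArg ev (comp_id' p).symm) := by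
  ext
  simp only [Iso.trans_hom, whiskerLeftIso_hom, eqToIso.hom, whiskerLeft_eqToHom]
  exact (Str.appendIso_nil p).trans (Category.id_comp _).symm

theorem φ_comp_left {a b c d : St B} (p : a ⟶ b) (q : b ⟶ c) (r : c ⟶ d) :
    φ (p ≫ q) r = whiskerRightIso (φ p q).symm (ev r) ≪≫ α_ (ev p) (ev q) (ev r) ≪≫
      whiskerLeftIso (ev p) (φ q r) ≪≫ φ p (q ≫ r) ≪≫
        eqToIso (congrArg ev (assoc' p q r).symm) := by
  ext
  simp [← φ_assoc]

theorem φ_comp_right {a b c d : St B} (p : a ⟶ b) (q : b ⟶ c) (r : c ⟶ d) :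
    φ p (q ≫ r) = whiskerLeftIso (ev p) (φ q r).symm ≪≫ (α_ (ev p) (ev q) (ev r)).symm ≪≫
      whiskerRightIso (φ p q) (ev r) ≪≫ φ (p ≫ q) r ≪≫
        eqToIso (congrArg ev (assoc' p q r)) := by
  ext
  simp [φ_comp_left]

/-- Left whiskering in `st B`: that of `B` conjugated by coherence isomorphisms. -/
def wL {a b c : St B} (p : a ⟶ b) {q q' : b ⟶ c} (η : q ⟶ q') : p ≫ q ⟶ p ≫ q' :=
  Cell.mk ((φ p q).inv ≫ ev p ◁ Cell.val η ≫ (φ p q').hom)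

/-- Right whiskering in `st B`: that of `B` conjugated by coherence isomorphisms. -/
def wR {a b c : St B} {p p' : a ⟶ b} (η : p ⟶ p') (q : b ⟶ c) : p ≫ q ⟶ p' ≫ q :=
  Cell.mk ((φ p q).inv ≫ Cell.val η ▷ ev q ≫ (φ p' q).hom)

@[simp]
theorem wL_val {a b c : St B} (p : a ⟶ b) {q q' : b ⟶ c} (η : q ⟶ q') :
    Cell.val (wL p η) = (φ p q).inv ≫ ev p ◁ Cell.val η ≫ (φ p q').hom := rfl

@[simp]
theorem wR_val {a b c : St B} {p p' : a ⟶ b} (η : p ⟶ p') (q : b ⟶ c) :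
    Cell.val (wR η q) = (φ p q).inv ≫ Cell.val η ▷ ev q ≫ (φ p' q).hom := rfl

theorem wL_eqToHom {a b c : St B} (p : a ⟶ b) {q q' : b ⟶ c} (h : q = q') :
    wL p (eqToHom h) = eqToHom (congrArg (fun s => p ≫ s) h) := by
  subst h; exact cell_ext (by simp)

theorem wR_eqToHom {a b c : St B} {p p' : a ⟶ b} (h : p = p') (q : b ⟶ c) :
    wR (eqToHom h) q = eqToHom (congrArg (fun s => s ≫ q) h) := by
  subst h; exact cell_ext (by simp)

theorem eqToHom_wL {a b c : St B} {p p' : a ⟶ b} (h : p = p') {q q' : b ⟶ c} (η : q ⟶ q') :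
    wL p η ≫ eqToHom (congrArg (fun s => s ≫ q') h) =
      eqToHom (congrArg (fun s => s ≫ q) h) ≫ wL p' η := by
  subst h; simp

/-- The 2-category `st B`. Horizontal composition is that of `B` conjugated by the coherence
isomorphisms `φ`; composition of 1-cells is strictly associative and unital. -/
instance bicategory : Bicategory.{w, max u v} (St B) where
  homCategory := homCat
  whiskerLeft p _ _ η := wL p η
  whiskerRight η q := wR η q
  associator p q r := eqToIso (assoc' p q r)
  leftUnitor p := eqToIso (id_comp' p)
  rightUnitor p := eqToIso (comp_id' p)
  whiskerLeft_id p q := cell_ext (by simp)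
  whiskerLeft_comp p _ _ _ η θ := cell_ext (by simp)
  id_whiskerLeft {a b f g} η := cell_ext (by
    simp [φ_id_left, congr_whiskerLeft (ev_id a)])
  comp_whiskerLeft p q _ _ η := cell_ext (by
    simp [φ_comp_left, whisker_exchange_assoc])
  id_whiskerRight p q := cell_ext (by simp)
  comp_whiskerRight η θ q := cell_ext (by simp)
  whiskerRight_id {a b f g} η := cell_ext (by
    simp [φ_id_right, whiskerRight_congr (ev_id b)])
  whiskerRight_comp η q r := cell_ext (by
    simp [φ_comp_right, ← whisker_exchange_assoc])
  whisker_assoc p _ _ η q := cell_ext (by simp [φ_comp_left])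
  whisker_exchange η θ := cell_ext (by simp [whisker_exchange_assoc])
  pentagon p q r s := by simp [wL_eqToHom, wR_eqToHom]
  triangle p q := by simp [wL_eqToHom, wR_eqToHom]

instance : Bicategory.Strict (St B) where
  id_comp := id_comp'
  comp_id := comp_id'
  assoc := assoc'

end St

namespace St

section

variable {B : Type u} [Bicategory.{w, v} B]

@[simp]
theorem whiskerLeft_val {a b c : St B} (p : a ⟶ b) {q q' : b ⟶ c} (η : q ⟶ q') :
    Cell.val (p ◁ η) = (φ p q).inv ≫ ev p ◁ Cell.val η ≫ (φ p q').hom := rfl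

@[simp]
theorem whiskerRight_val {a b c : St B} {p p' : a ⟶ b} (η : p ⟶ p') (q : b ⟶ c) :
    Cell.val (η ▷ q) = (φ p q).inv ≫ Cell.val η ▷ ev q ≫ (φ p' q).hom := rfl

@[simp]
theorem associator_eq {a b c d : St B} (p : a ⟶ b) (q : b ⟶ c) (r : c ⟶ d) :
    α_ p q r = eqToIso (assoc' p q r) := rfl

@[simp]
theorem leftUnitor_eq {a b : St B} (p : a ⟶ b) : λ_ p = eqToIso (id_comp' p) := rfl

@[simp]
theorem rightUnitor_eq {a b : St B} (p : a ⟶ b) : ρ_ p = eqToIso (comp_id' p) := rfl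

/-- The canonical functor `e : st B → B`, sending a string to its composite. -/
def e (B : Type u) [Bicategory.{w, v} B] : St B ⥤ᵖ B where
  obj a := a.as
  map p := ev p
  map₂ η := Cell.val η
  mapId a := eqToIso (ev_id a)
  mapComp p q := (φ p q).symm
  map₂_associator p q r := by simp [φ_comp_left]
  map₂_left_unitor p := by simp [φ_id_left]
  map₂_right_unitor p := by simp [φ_id_right]

variable {A : Type u₁} [Bicategory.{w₁, v₁} A]

/-- Given a functor `H : A → B`, a string `m f` for every 1-cell `f` of `A`, and invertible 2-cells
`ζ f` from the composite of `m f` to `H f`, this is the unique functor `A → st B` which agrees with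
`H` on objects, is given by `m` on 1-cells, and for which `ζ` is an invertible icon between its
composite with `e : st B → B` and `H`. -/
def lift (H : A ⥤ᵖ B) (m : ∀ {a b : A}, (a ⟶ b) → (St.mk (H.obj a) ⟶ St.mk (H.obj b)))
    (ζ : ∀ {a b : A} (f : a ⟶ b), ev (m f) ≅ H.map f) : A ⥤ᵖ St B where
  obj a := ⟨H.obj a⟩
  map f := m f
  map₂ {_ _ f g} η := Cell.mk ((ζ f).hom ≫ H.map₂ η ≫ (ζ g).inv)
  map₂_id f := cell_ext (by simp)
  map₂_comp η θ := cell_ext (by simp)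
  mapId a := isoMk (ζ (𝟙 a) ≪≫ H.mapId a ≪≫ eqToIso (ev_id ⟨H.obj a⟩).symm)
  mapComp f g := isoMk (ζ (f ≫ g) ≪≫ H.mapComp f g ≪≫
    whiskerRightIso (ζ f).symm (H.map g) ≪≫ whiskerLeftIso (ev (m f)) (ζ g).symm ≪≫ φ (m f) (m g))
  map₂_whisker_left f _ _ η := cell_ext (by
    simp [whisker_exchange_assoc])
  map₂_whisker_right η h := cell_ext (by
    simp [← whisker_exchange_assoc])
  map₂_associator f g h := cell_ext (by
    have e := whisker_exchange ((ζ f).inv ▷ H.map g) (ζ h).hom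
    simp only [comp_whiskerLeft, Category.assoc] at e
    simp [φ_comp_left, whisker_exchange_assoc, ← reassoc_of% e])
  map₂_left_unitor f := cell_ext (by
    simp [φ_id_left, whisker_exchange_assoc])
  map₂_right_unitor f := cell_ext (by
    simp [φ_id_right, ← whisker_exchange_assoc])

end

end St

/-- The product `F × G : B × D → C × E` of two functors of bicategories. -/
def prodMap {B D : Type u₁} [Bicategory.{w₁, v₁} B] [Bicategory.{w₁, v₁} D]
    {C E : Type u₂} [Bicategory.{w₂, v₂} C] [Bicategory.{w₂, v₂} E]
    (F : B ⥤ᵖ C) (G : D ⥤ᵖ E) : (B × D) ⥤ᵖ (C × E) where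
  obj x := (F.obj x.1, G.obj x.2)
  map f := (F.map f.1, G.map f.2)
  map₂ η := (F.map₂ η.1, G.map₂ η.2)
  map₂_id f := Prod.ext (F.map₂_id f.1) (G.map₂_id f.2)
  map₂_comp η θ := Prod.ext (F.map₂_comp η.1 θ.1) (G.map₂_comp η.2 θ.2)
  mapId x := Iso.prod (F.mapId x.1) (G.mapId x.2)
  mapComp f g := Iso.prod (F.mapComp f.1 g.1) (G.mapComp f.2 g.2)
  map₂_whisker_left f _ _ η :=
    Prod.ext (F.map₂_whisker_left f.1 η.1) (G.map₂_whisker_left f.2 η.2)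
  map₂_whisker_right η h :=
    Prod.ext (F.map₂_whisker_right η.1 h.1) (G.map₂_whisker_right η.2 h.2)
  map₂_associator f g h :=
    Prod.ext (F.map₂_associator f.1 g.1 h.1) (G.map₂_associator f.2 g.2 h.2)
  map₂_left_unitor f := Prod.ext (F.map₂_left_unitor f.1) (G.map₂_left_unitor f.2)
  map₂_right_unitor f := Prod.ext (F.map₂_right_unitor f.1) (G.map₂_right_unitor f.2)

namespace St

/-- The canonical functor `f : B → st B`, which is the identity on objects, sends a 1-cell to the
string of length one which it forms, and is the identity on 2-cells. -/
def f (B : Type u) [Bicategory.{w, v} B] : B ⥤ᵖ St B :=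
  lift (Pseudofunctor.id B) (fun g => Str.cons g (Str.nil _)) (fun g => Iso.refl g)

section Comparison

variable {X Y : Type u} [Bicategory.{w, v} X] [Bicategory.{w, v} Y]

/-- The morphism of quivers `X → X × Y` with `g ↦ (g, 1_y)`. -/
def inX (y : Y) : X ⥤q (X × Y) where
  obj x := (x, y)
  map g := (g, 𝟙 y)

/-- The morphism of quivers `Y → X × Y` with `h ↦ (1_x, h)`. -/
def inY (x : X) : Y ⥤q (X × Y) where
  obj y := (x, y)
  map h := (𝟙 x, h)

/-- The coherence isomorphism between the composite of `(f₁, 1), …, (fₙ, 1)` and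
`(f₁ ≫ ⋯ ≫ fₙ, 1)`. -/
def inXIso (y : Y) : {x x' : X} → (p : Str x x') →
    (Str.eval (Str.map (inX y) p) ≅ ((Str.eval p, 𝟙 y) : (x, y) ⟶ (x', y)))
  | _, _, Str.nil _ => Iso.refl _
  | _, _, Str.cons g p =>
      (Str.consIso ((inX y).map g) (Str.map (inX y) p)).symm ≪≫
        whiskerLeftIso ((inX y).map g) (inXIso y p) ≪≫
        Iso.prod (Str.consIso g p) (λ_ (𝟙 y))

/-- The coherence isomorphism between the composite of `(1, g₁), …, (1, gₘ)` and
`(1, g₁ ≫ ⋯ ≫ gₘ)`. -/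
def inYIso (x : X) : {y y' : Y} → (q : Str y y') →
    (Str.eval (Str.map (inY x) q) ≅ ((𝟙 x, Str.eval q) : (x, y) ⟶ (x, y')))
  | _, _, Str.nil _ => Iso.refl _
  | _, _, Str.cons h q =>
      (Str.consIso ((inY x).map h) (Str.map (inY x) q)).symm ≪≫
        whiskerLeftIso ((inY x).map h) (inYIso x q) ≪≫
        Iso.prod (λ_ (𝟙 x)) (Str.consIso h q)

variable (X Y) in
/-- The functor `e × e : st X × st Y → X × Y`. -/
abbrev eProd : (St X × St Y) ⥤ᵖ (X × Y) := prodMap (e X) (e Y)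

/-- The string `(f₁, 1), …, (fₙ, 1), (1, g₁), …, (1, gₘ)` associated to the strings
`f₁, …, fₙ` and `g₁, …, gₘ`. -/
def hatMap {a b : St X × St Y} (p : a ⟶ b) :
    St.mk ((eProd X Y).obj a) ⟶ St.mk ((eProd X Y).obj b) :=
  Str.append (Str.map (inX a.2.as) p.1) (Str.map (inY b.1.as) p.2)

/-- The coherence isomorphism between the composite of
`(f₁, 1), …, (fₙ, 1), (1, g₁), …, (1, gₘ)` and `(f₁ ≫ ⋯ ≫ fₙ, g₁ ≫ ⋯ ≫ gₘ)`. -/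
def hatIso {a b : St X × St Y} (p : a ⟶ b) : ev (hatMap p) ≅ (eProd X Y).map p :=
  (Str.appendIso (Str.map (inX a.2.as) p.1) (Str.map (inY b.1.as) p.2)).symm ≪≫
    whiskerRightIso (inXIso a.2.as p.1) _ ≪≫ whiskerLeftIso _ (inYIso b.1.as p.2) ≪≫
    Iso.prod (ρ_ (ev p.1)) (λ_ (ev p.2))

variable (X Y) in
/-- The comparison functor `ŝt : st X × st Y → st (X × Y)`: it is the identity on objects, sends
the pair of the strings `f₁, …, fₙ` and `g₁, …, gₘ` to the string
`(f₁, 1), …, (fₙ, 1), (1, g₁), …, (1, gₘ)`, and is defined on 2-cells, together with its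
constraints, by conjugation with the coherence isomorphisms `hatIso`. -/
def hat : (St X × St Y) ⥤ᵖ St (X × Y) :=
  lift (eProd X Y) hatMap hatIso

end Comparison

end St

namespace Gray

/-- The pairs `a ⊗ b`. -/
structure Vert (A B : Type u) : Type u where
  /-- the first component -/
  fst : A
  /-- the second component -/
  snd : B

section

variable (A B : Type u) [Bicategory.{w, v} A] [Bicategory.{w, v} B]

/-- The generating 1-cells `f ⊗ 1` and `1 ⊗ g`. -/
inductive Gen : Vert A B → Vert A B → Type (max u v)
  | left {a a' : A} (f : a ⟶ a') (b : B) : Gen ⟨a, b⟩ ⟨a', b⟩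
  | right (a : A) {b b' : B} (g : b ⟶ b') : Gen ⟨a, b⟩ ⟨a, b'⟩

instance : Quiver.{max u v} (Vert A B) where
  Hom := Gen A B

/-- The string of length one formed by `f ⊗ 1`. -/
def wordL {a a' : A} (f : a ⟶ a') (b : B) : Quiver.Path (Vert.mk a b) (Vert.mk a' b) :=
  Quiver.Hom.toPath (Gen.left f b)

/-- The string of length one formed by `1 ⊗ g`. -/
def wordR (a : A) {b b' : B} (g : b ⟶ b') : Quiver.Path (Vert.mk a b) (Vert.mk a b') :=
  Quiver.Hom.toPath (Gen.right a g)

/-- The relations between 1-cells: `f ↦ f ⊗ 1` and `g ↦ 1 ⊗ g` preserve identities and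
composition. -/
inductive Rel₁ : HomRel (Paths (Vert A B))
  | left_id (a : A) (b : B) : Rel₁ (wordL A B (𝟙 a) b) Quiver.Path.nil
  | left_comp {a a' a'' : A} (f : a ⟶ a') (f' : a' ⟶ a'') (b : B) :
      Rel₁ (wordL A B (f ≫ f') b) ((wordL A B f b).comp (wordL A B f' b))
  | right_id (a : A) (b : B) : Rel₁ (wordR A B a (𝟙 b)) Quiver.Path.nil
  | right_comp (a : A) {b b' b'' : B} (g : b ⟶ b') (g' : b' ⟶ b'') :
      Rel₁ (wordR A B a (g ≫ g')) ((wordR A B a g).comp (wordR A B a g'))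

/-- The category of objects and 1-cells of `A ⊗ B`: the free category on the generating 1-cells,
modulo the congruence generated by the relations above. -/
abbrev Cat₁ : Type u := CategoryTheory.Quotient (Rel₁ A B)

end

variable {A B : Type u} [Bicategory.{w, v} A] [Bicategory.{w, v} B]

/-- The object `a ⊗ b`. -/
def tens (a : A) (b : B) : Cat₁ A B := ⟨⟨a, b⟩⟩

/-- The 1-cell `f ⊗ 1 : a ⊗ b → a' ⊗ b`. -/
def inl {a a' : A} (f : a ⟶ a') (b : B) : tens a b ⟶ tens a' b :=
  (Quotient.functor (Rel₁ A B)).map (wordL A B f b)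

/-- The 1-cell `1 ⊗ g : a ⊗ b → a ⊗ b'`. -/
def inr (a : A) {b b' : B} (g : b ⟶ b') : tens a b ⟶ tens a b' :=
  (Quotient.functor (Rel₁ A B)).map (wordR A B a g)

theorem inl_id (a : A) (b : B) : inl (𝟙 a) b = 𝟙 (tens a b) :=
  CategoryTheory.Quotient.sound _ (Rel₁.left_id a b)

theorem inl_comp {a a' a'' : A} (f : a ⟶ a') (f' : a' ⟶ a'') (b : B) :
    inl (f ≫ f') b = inl f b ≫ inl f' b :=
  CategoryTheory.Quotient.sound _ (Rel₁.left_comp f f' b)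

theorem inr_id (a : A) (b : B) : inr a (𝟙 b) = 𝟙 (tens a b) :=
  CategoryTheory.Quotient.sound _ (Rel₁.right_id a b)

theorem inr_comp (a : A) {b b' b'' : B} (g : b ⟶ b') (g' : b' ⟶ b'') :
    inr a (g ≫ g') = inr a g ≫ inr a g' :=
  CategoryTheory.Quotient.sound _ (Rel₁.right_comp a g g')

/-- Formal expressions for 2-cells of `A ⊗ B`: they are built from the generators `α ⊗ 1`,
`1 ⊗ β`, `Σ_{f,g}` and a formal inverse of `Σ_{f,g}` by identities, vertical composition and
whiskering. -/
inductive Pre : {x y : Cat₁ A B} → (x ⟶ y) → (x ⟶ y) → Type (max u v w)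
  | id {x y : Cat₁ A B} (p : x ⟶ y) : Pre p p
  | comp {x y : Cat₁ A B} {p q r : x ⟶ y} (η : Pre p q) (θ : Pre q r) : Pre p r
  | wL {x y z : Cat₁ A B} (p : x ⟶ y) {q q' : y ⟶ z} (η : Pre q q') : Pre (p ≫ q) (p ≫ q')
  | wR {x y z : Cat₁ A B} {p p' : x ⟶ y} (η : Pre p p') (q : y ⟶ z) : Pre (p ≫ q) (p' ≫ q)
  | left {a a' : A} {f f' : a ⟶ a'} (α : f ⟶ f') (b : B) : Pre (inl f b) (inl f' b)
  | right (a : A) {b b' : B} {g g' : b ⟶ b'} (β : g ⟶ g') : Pre (inr a g) (inr a g')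
  | sig {a a' : A} {b b' : B} (f : a ⟶ a') (g : b ⟶ b') :
      Pre (inr a g ≫ inl f b') (inl f b ≫ inr a' g)
  | sigInv {a a' : A} {b b' : B} (f : a ⟶ a') (g : b ⟶ b') :
      Pre (inl f b ≫ inr a' g) (inr a g ≫ inl f b')

/-- The formal identity 2-cell between equal 1-cells. -/
def Pre.ofEq {x y : Cat₁ A B} {p q : x ⟶ y} (h : p = q) : Pre p q :=
  h ▸ Pre.id p

open Pre in
/-- The relations between 2-cells of `A ⊗ B`. -/
inductive Rel₂ : {x y : Cat₁ A B} → {p q : x ⟶ y} → Pre p q → Pre p q → Prop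
  -- congruence
  | comp_left {x y : Cat₁ A B} {p q r : x ⟶ y} {η η' : Pre p q} (θ : Pre q r) :
      Rel₂ η η' → Rel₂ (comp η θ) (comp η' θ)
  | comp_right {x y : Cat₁ A B} {p q r : x ⟶ y} (η : Pre p q) {θ θ' : Pre q r} :
      Rel₂ θ θ' → Rel₂ (comp η θ) (comp η θ')
  | wL {x y z : Cat₁ A B} (p : x ⟶ y) {q q' : y ⟶ z} {η η' : Pre q q'} :
      Rel₂ η η' → Rel₂ (wL p η) (wL p η')
  | wR {x y z : Cat₁ A B} {p p' : x ⟶ y} {η η' : Pre p p'} (q : y ⟶ z) :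
      Rel₂ η η' → Rel₂ (wR η q) (wR η' q)
  -- the axioms of a 2-category
  | id_comp {x y : Cat₁ A B} {p q : x ⟶ y} (η : Pre p q) : Rel₂ (comp (Pre.id p) η) η
  | comp_id {x y : Cat₁ A B} {p q : x ⟶ y} (η : Pre p q) : Rel₂ (comp η (Pre.id q)) η
  | assoc {x y : Cat₁ A B} {p q r s : x ⟶ y} (η : Pre p q) (θ : Pre q r) (κ : Pre r s) :
      Rel₂ (comp (comp η θ) κ) (comp η (comp θ κ))
  | wL_id {x y z : Cat₁ A B} (p : x ⟶ y) (q : y ⟶ z) : Rel₂ (wL p (Pre.id q)) (Pre.id (p ≫ q))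
  | wL_comp {x y z : Cat₁ A B} (p : x ⟶ y) {q q' q'' : y ⟶ z} (η : Pre q q') (θ : Pre q' q'') :
      Rel₂ (wL p (comp η θ)) (comp (wL p η) (wL p θ))
  | id_wR {x y z : Cat₁ A B} (p : x ⟶ y) (q : y ⟶ z) : Rel₂ (wR (Pre.id p) q) (Pre.id (p ≫ q))
  | comp_wR {x y z : Cat₁ A B} {p p' p'' : x ⟶ y} (η : Pre p p') (θ : Pre p' p'') (q : y ⟶ z) :
      Rel₂ (wR (comp η θ) q) (comp (wR η q) (wR θ q))
  | id_wL {x y : Cat₁ A B} {p q : x ⟶ y} (η : Pre p q) :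
      Rel₂ (wL (𝟙 x) η)
        (comp (ofEq (Category.id_comp p)) (comp η (ofEq (Category.id_comp q).symm)))
  | wR_id {x y : Cat₁ A B} {p q : x ⟶ y} (η : Pre p q) :
      Rel₂ (wR η (𝟙 y))
        (comp (ofEq (Category.comp_id p)) (comp η (ofEq (Category.comp_id q).symm)))
  | wL_wL {x y z t : Cat₁ A B} (p : x ⟶ y) (q : y ⟶ z) {r r' : z ⟶ t} (η : Pre r r') :
      Rel₂ (wL (p ≫ q) η) (comp (ofEq (Category.assoc p q r))
        (comp (wL p (wL q η)) (ofEq (Category.assoc p q r').symm)))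
  | wR_wR {x y z t : Cat₁ A B} {p p' : x ⟶ y} (η : Pre p p') (q : y ⟶ z) (r : z ⟶ t) :
      Rel₂ (wR η (q ≫ r)) (comp (ofEq (Category.assoc p q r).symm)
        (comp (wR (wR η q) r) (ofEq (Category.assoc p' q r))))
  | wL_wR {x y z t : Cat₁ A B} (p : x ⟶ y) {q q' : y ⟶ z} (η : Pre q q') (r : z ⟶ t) :
      Rel₂ (wR (wL p η) r) (comp (ofEq (Category.assoc p q r))
        (comp (wL p (wR η r)) (ofEq (Category.assoc p q' r).symm)))
  | exchange {x y z : Cat₁ A B} {p p' : x ⟶ y} {q q' : y ⟶ z} (η : Pre p p') (θ : Pre q q') :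
      Rel₂ (comp (wL p θ) (wR η q')) (comp (wR η q) (wL p' θ))
  -- `α ↦ α ⊗ 1` is a 2-functor
  | left_id {a a' : A} (f : a ⟶ a') (b : B) : Rel₂ (left (𝟙 f) b) (Pre.id (inl f b))
  | left_comp {a a' : A} {f f' f'' : a ⟶ a'} (α : f ⟶ f') (α' : f' ⟶ f'') (b : B) :
      Rel₂ (left (α ≫ α') b) (comp (left α b) (left α' b))
  | left_wL {a a' a'' : A} (f : a ⟶ a') {h h' : a' ⟶ a''} (α : h ⟶ h') (b : B) :
      Rel₂ (left (f ◁ α) b) (comp (ofEq (inl_comp f h b))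
        (comp (wL (inl f b) (left α b)) (ofEq (inl_comp f h' b).symm)))
  | left_wR {a a' a'' : A} {f f' : a ⟶ a'} (α : f ⟶ f') (h : a' ⟶ a'') (b : B) :
      Rel₂ (left (α ▷ h) b) (comp (ofEq (inl_comp f h b))
        (comp (wR (left α b) (inl h b)) (ofEq (inl_comp f' h b).symm)))
  -- `β ↦ 1 ⊗ β` is a 2-functor
  | right_id (a : A) {b b' : B} (g : b ⟶ b') : Rel₂ (right a (𝟙 g)) (Pre.id (inr a g))
  | right_comp (a : A) {b b' : B} {g g' g'' : b ⟶ b'} (β : g ⟶ g') (β' : g' ⟶ g'') :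
      Rel₂ (right a (β ≫ β')) (comp (right a β) (right a β'))
  | right_wL (a : A) {b b' b'' : B} (g : b ⟶ b') {h h' : b' ⟶ b''} (β : h ⟶ h') :
      Rel₂ (right a (g ◁ β)) (comp (ofEq (inr_comp a g h))
        (comp (wL (inr a g) (right a β)) (ofEq (inr_comp a g h').symm)))
  | right_wR (a : A) {b b' b'' : B} {g g' : b ⟶ b'} (β : g ⟶ g') (h : b' ⟶ b'') :
      Rel₂ (right a (β ▷ h)) (comp (ofEq (inr_comp a g h))
        (comp (wR (right a β) (inr a h)) (ofEq (inr_comp a g' h).symm)))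
  -- `Σ_{f,g}` is invertible
  | sig_inv {a a' : A} {b b' : B} (f : a ⟶ a') (g : b ⟶ b') :
      Rel₂ (comp (sig f g) (sigInv f g)) (Pre.id (inr a g ≫ inl f b'))
  | inv_sig {a a' : A} {b b' : B} (f : a ⟶ a') (g : b ⟶ b') :
      Rel₂ (comp (sigInv f g) (sig f g)) (Pre.id (inl f b ≫ inr a' g))
  -- `Σ_{f,g}` is natural in `f` and `g`
  | sig_left {a a' : A} {b b' : B} {f f' : a ⟶ a'} (α : f ⟶ f') (g : b ⟶ b') :
      Rel₂ (comp (wL (inr a g) (left α b')) (sig f' g))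
        (comp (sig f g) (wR (left α b) (inr a' g)))
  | sig_right {a a' : A} {b b' : B} (f : a ⟶ a') {g g' : b ⟶ b'} (β : g ⟶ g') :
      Rel₂ (comp (wR (right a β) (inl f b')) (sig f g'))
        (comp (sig f g) (wL (inl f b) (right a' β)))
  -- `Σ_{f,g}` is compatible with identities and composition of 1-cells
  | sig_id_left (a : A) {b b' : B} (g : b ⟶ b') :
      Rel₂ (sig (𝟙 a) g)
        (ofEq (by rw [inl_id, inl_id, Category.id_comp, Category.comp_id]))
  | sig_id_right {a a' : A} (f : a ⟶ a') (b : B) :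
      Rel₂ (sig f (𝟙 b))
        (ofEq (by rw [inr_id, inr_id, Category.id_comp, Category.comp_id]))
  | sig_comp_left {a a' a'' : A} {b b' : B} (f : a ⟶ a') (f' : a' ⟶ a'') (g : b ⟶ b') :
      Rel₂ (sig (f ≫ f') g)
        (comp (ofEq (by rw [inl_comp, Category.assoc]))
        (comp (wR (sig f g) (inl f' b'))
        (comp (ofEq (Category.assoc _ _ _))
        (comp (wL (inl f b) (sig f' g))
        (ofEq (by rw [inl_comp, Category.assoc]))))))
  | sig_comp_right {a a' : A} {b b' b'' : B} (f : a ⟶ a') (g : b ⟶ b') (g' : b' ⟶ b'') :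
      Rel₂ (sig f (g ≫ g'))
        (comp (ofEq (by rw [inr_comp, Category.assoc]))
        (comp (wL (inr a g) (sig f g'))
        (comp (ofEq (Category.assoc _ _ _).symm)
        (comp (wR (sig f g) (inr a' g'))
        (ofEq (by rw [inr_comp, Category.assoc]))))))

end Gray

/-- The objects `a ⊗ b` of the Gray tensor product `A ⊗ B` of the 2-categories `A` and `B`. -/
structure GrayTensor (A B : Type u) : Type u where
  /-- the first component -/
  fst : A
  /-- the second component -/
  snd : B

namespace GrayTensor

open Gray

variable {A B : Type u} [Bicategory.{w, v} A] [Bicategory.{w, v} B]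

/-- The 1-cells of `A ⊗ B`. -/
instance : CategoryStruct.{max u v} (GrayTensor A B) where
  Hom x y := tens x.fst x.snd ⟶ tens y.fst y.snd
  id x := 𝟙 (tens x.fst x.snd)
  comp {x y z} p q := CategoryStruct.comp (X := tens x.fst x.snd) (Y := tens y.fst y.snd)
    (Z := tens z.fst z.snd) p q

/-- The 2-cells of `A ⊗ B`: formal expressions modulo the congruence generated by the relations. -/
instance homCat (x y : GrayTensor A B) : Category.{max u v w} (x ⟶ y) where
  Hom p q := Quot (Rel₂ (A := A) (B := B) (p := p) (q := q))
  id p := Quot.mk _ (Pre.id p)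
  comp := Quot.map₂ Pre.comp (fun η _ _ h => Rel₂.comp_right η h) (fun _ _ θ h => Rel₂.comp_left θ h)
  id_comp := by rintro _ _ ⟨η⟩; exact Quot.sound (Rel₂.id_comp η)
  comp_id := by rintro _ _ ⟨η⟩; exact Quot.sound (Rel₂.comp_id η)
  assoc := by rintro _ _ _ _ ⟨η⟩ ⟨θ⟩ ⟨κ⟩; exact Quot.sound (Rel₂.assoc η θ κ)

/-- The 2-cell represented by a formal expression. -/
def cell {x y : GrayTensor A B} {p q : x ⟶ y} (η : Pre (A := A) (B := B) p q) : p ⟶ q := Quot.mk _ η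

theorem sound {x y : GrayTensor A B} {p q : x ⟶ y} {η θ : Pre (A := A) (B := B) p q}
    (h : Rel₂ η θ) : (cell η : p ⟶ q) = cell θ := Quot.sound h

theorem cell_comp {x y : GrayTensor A B} {p q r : x ⟶ y} (η : Pre (A := A) (B := B) p q)
    (θ : Pre (A := A) (B := B) q r) : (cell (Pre.comp η θ) : p ⟶ r) = cell η ≫ cell θ := rfl

theorem cell_ofEq {x y : GrayTensor A B} {p q : x ⟶ y} (h : p = q) :
    (cell (Pre.ofEq h) : p ⟶ q) = eqToHom h := by
  subst h; rfl

theorem sound₁ {x y : GrayTensor A B} {p q : x ⟶ y} (h : p = q) {θ : Pre (A := A) (B := B) p q}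
    (hr : Rel₂ θ (Pre.ofEq h)) : (cell θ : p ⟶ q) = eqToHom h :=
  (sound hr).trans (cell_ofEq h)

theorem sound₃ {x y : GrayTensor A B} {p q r s : x ⟶ y} (h : p = q)
    {η : Pre (A := A) (B := B) q r} (h' : r = s) {θ : Pre (A := A) (B := B) p s}
    (hr : Rel₂ θ (Pre.comp (Pre.ofEq h) (Pre.comp η (Pre.ofEq h')))) :
    (cell θ : p ⟶ s) = eqToHom h ≫ cell η ≫ eqToHom h' :=
  (sound hr).trans (by rw [cell_comp, cell_comp, cell_ofEq, cell_ofEq])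

theorem sound₅ {x y : GrayTensor A B} {p₀ p₁ p₂ p₃ p₄ p₅ : x ⟶ y} (h : p₀ = p₁)
    {η : Pre (A := A) (B := B) p₁ p₂} (h' : p₂ = p₃) {κ : Pre (A := A) (B := B) p₃ p₄}
    (h'' : p₄ = p₅) {θ : Pre (A := A) (B := B) p₀ p₅}
    (hr : Rel₂ θ (Pre.comp (Pre.ofEq h) (Pre.comp η (Pre.comp (Pre.ofEq h')
      (Pre.comp κ (Pre.ofEq h'')))))) :
    (cell θ : p₀ ⟶ p₅) = eqToHom h ≫ cell η ≫ eqToHom h' ≫ cell κ ≫ eqToHom h'' :=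
  (sound hr).trans (by
    rw [cell_comp, cell_comp, cell_comp, cell_comp, cell_ofEq, cell_ofEq, cell_ofEq])

theorem id_comp' {x y : GrayTensor A B} (p : x ⟶ y) : 𝟙 x ≫ p = p :=
  Category.id_comp (X := tens x.fst x.snd) (Y := tens y.fst y.snd) p

theorem comp_id' {x y : GrayTensor A B} (p : x ⟶ y) : p ≫ 𝟙 y = p :=
  Category.comp_id (X := tens x.fst x.snd) (Y := tens y.fst y.snd) p

theorem assoc' {x y z t : GrayTensor A B} (p : x ⟶ y) (q : y ⟶ z) (r : z ⟶ t) :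
    (p ≫ q) ≫ r = p ≫ q ≫ r :=
  Category.assoc (W := tens x.fst x.snd) (X := tens y.fst y.snd) (Y := tens z.fst z.snd)
    (Z := tens t.fst t.snd) p q r

/-- Left whiskering in `A ⊗ B`. -/
def wL {x y z : GrayTensor A B} (p : x ⟶ y) {q q' : y ⟶ z} : (q ⟶ q') → (p ≫ q ⟶ p ≫ q') :=
  Quot.map (Pre.wL p) (fun _ _ h => Rel₂.wL p h)

/-- Right whiskering in `A ⊗ B`. -/
def wR {x y z : GrayTensor A B} {p p' : x ⟶ y} (η : p ⟶ p') (q : y ⟶ z) : p ≫ q ⟶ p' ≫ q :=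
  Quot.map (fun κ => Pre.wR κ q) (fun _ _ h => Rel₂.wR q h) η

theorem wL_eqToHom {x y z : GrayTensor A B} (p : x ⟶ y) {q q' : y ⟶ z} (h : q = q') :
    wL p (eqToHom h) = eqToHom (congrArg (fun s => p ≫ s) h) := by
  subst h; exact sound (Rel₂.wL_id p q)

theorem wR_eqToHom {x y z : GrayTensor A B} {p p' : x ⟶ y} (h : p = p') (q : y ⟶ z) :
    wR (eqToHom h) q = eqToHom (congrArg (fun s => s ≫ q) h) := by
  subst h; exact sound (Rel₂.id_wR p q)

/-- The Gray tensor product `A ⊗ B` of the 2-categories `A` and `B`. -/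
instance bicategory : Bicategory.{max u v w, max u v} (GrayTensor A B) where
  homCategory := homCat
  whiskerLeft p _ _ η := wL p η
  whiskerRight η q := wR η q
  associator p q r := eqToIso (assoc' p q r)
  leftUnitor p := eqToIso (id_comp' p)
  rightUnitor p := eqToIso (comp_id' p)
  whiskerLeft_id p q := sound (Rel₂.wL_id p q)
  whiskerLeft_comp := by rintro _ _ _ p _ _ _ ⟨η⟩ ⟨θ⟩; exact sound (Rel₂.wL_comp p η θ)
  id_whiskerLeft := by
    rintro _ _ _ _ ⟨η⟩; exact (sound (Rel₂.id_wL η)).trans (by simp only [cell_comp, cell_ofEq]; rfl)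
  comp_whiskerLeft := by
    rintro _ _ _ _ p q _ _ ⟨η⟩
    exact (sound (Rel₂.wL_wL p q η)).trans (by simp only [cell_comp, cell_ofEq]; rfl)
  id_whiskerRight p q := sound (Rel₂.id_wR p q)
  comp_whiskerRight := by rintro _ _ _ _ _ _ ⟨η⟩ ⟨θ⟩ q; exact sound (Rel₂.comp_wR η θ q)
  whiskerRight_id := by
    rintro _ _ _ _ ⟨η⟩; exact (sound (Rel₂.wR_id η)).trans (by simp only [cell_comp, cell_ofEq]; rfl)
  whiskerRight_comp := by
    rintro _ _ _ _ _ _ ⟨η⟩ q r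
    exact (sound (Rel₂.wR_wR η q r)).trans (by simp only [cell_comp, cell_ofEq]; rfl)
  whisker_assoc := by
    rintro _ _ _ _ p _ _ ⟨η⟩ r
    exact (sound (Rel₂.wL_wR p η r)).trans (by simp only [cell_comp, cell_ofEq]; rfl)
  whisker_exchange := by rintro _ _ _ _ _ _ _ ⟨η⟩ ⟨θ⟩; exact sound (Rel₂.exchange η θ)
  pentagon p q r s := by simp [wL_eqToHom, wR_eqToHom]
  triangle p q := by simp [wL_eqToHom, wR_eqToHom]

instance : Bicategory.Strict (GrayTensor A B) where
  id_comp := id_comp'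
  comp_id := comp_id'
  assoc := assoc'

end GrayTensor

namespace GrayTensor

open Gray

variable {A B : Type u} [Bicategory.{w, v} A] [Bicategory.{w, v} B]

/-- The 1-cell `f ⊗ 1` of `A ⊗ B`. -/
def L {a a' : A} (f : a ⟶ a') (b : B) : GrayTensor.mk a b ⟶ GrayTensor.mk a' b := inl f b

/-- The 1-cell `1 ⊗ g` of `A ⊗ B`. -/
def R (a : A) {b b' : B} (g : b ⟶ b') : GrayTensor.mk a b ⟶ GrayTensor.mk a b' := inr a g

/-- The 2-cell `α ⊗ 1` of `A ⊗ B`. -/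
def L₂ {a a' : A} {f f' : a ⟶ a'} (α : f ⟶ f') (b : B) : L f b ⟶ L f' b := cell (Pre.left α b)

/-- The 2-cell `1 ⊗ β` of `A ⊗ B`. -/
def R₂ (a : A) {b b' : B} {g g' : b ⟶ b'} (β : g ⟶ g') : R a g ⟶ R a g' := cell (Pre.right a β)

/-- The invertible 2-cell `Σ_{f,g}` of `A ⊗ B`. -/
def S {a a' : A} {b b' : B} (f : a ⟶ a') (g : b ⟶ b') : R a g ≫ L f b' ≅ L f b ≫ R a' g where
  hom := cell (Pre.sig f g)
  inv := cell (Pre.sigInv f g)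
  hom_inv_id := sound (Rel₂.sig_inv f g)
  inv_hom_id := sound (Rel₂.inv_sig f g)

theorem L_id (a : A) (b : B) : L (𝟙 a) b = 𝟙 (GrayTensor.mk a b) := inl_id a b

theorem R_id (a : A) (b : B) : R a (𝟙 b) = 𝟙 (GrayTensor.mk a b) := inr_id a b

theorem L_comp {a a' a'' : A} (f : a ⟶ a') (f' : a' ⟶ a'') (b : B) :
    L (f ≫ f') b = L f b ≫ L f' b := inl_comp f f' b

theorem R_comp (a : A) {b b' b'' : B} (g : b ⟶ b') (g' : b' ⟶ b'') :
    R a (g ≫ g') = R a g ≫ R a g' := inr_comp a g g'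

/-- The equality `1 ⊗ 1 = 1`. -/
def Lid (a : A) (b : B) : L (𝟙 a) b ≅ 𝟙 (GrayTensor.mk a b) := eqToIso (L_id a b)

/-- The equality `1 ⊗ 1 = 1`. -/
def Rid (a : A) (b : B) : R a (𝟙 b) ≅ 𝟙 (GrayTensor.mk a b) := eqToIso (R_id a b)

/-- The equality between `f f' ⊗ 1` and the composite of `f ⊗ 1` and `f' ⊗ 1`. -/
def Lcomp {a a' a'' : A} (f : a ⟶ a') (f' : a' ⟶ a'') (b : B) :
    L (f ≫ f') b ≅ L f b ≫ L f' b := eqToIso (L_comp f f' b)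

/-- The equality between `1 ⊗ g g'` and the composite of `1 ⊗ g` and `1 ⊗ g'`. -/
def Rcomp (a : A) {b b' b'' : B} (g : b ⟶ b') (g' : b' ⟶ b'') :
    R a (g ≫ g') ≅ R a g ≫ R a g' := eqToIso (R_comp a g g')

@[simp]
theorem L₂_id {a a' : A} (f : a ⟶ a') (b : B) : L₂ (𝟙 f) b = 𝟙 (L f b) :=
  sound (Rel₂.left_id f b)

@[simp]
theorem R₂_id (a : A) {b b' : B} (g : b ⟶ b') : R₂ a (𝟙 g) = 𝟙 (R a g) :=
  sound (Rel₂.right_id a g)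

@[simp]
theorem L₂_comp {a a' : A} {f f' f'' : a ⟶ a'} (α : f ⟶ f') (α' : f' ⟶ f'') (b : B) :
    L₂ (α ≫ α') b = L₂ α b ≫ L₂ α' b :=
  sound (Rel₂.left_comp α α' b)

@[simp]
theorem R₂_comp (a : A) {b b' : B} {g g' g'' : b ⟶ b'} (β : g ⟶ g') (β' : g' ⟶ g'') :
    R₂ a (β ≫ β') = R₂ a β ≫ R₂ a β' :=
  sound (Rel₂.right_comp a β β')

theorem L₂_whiskerLeft {a a' a'' : A} (f : a ⟶ a') {h h' : a' ⟶ a''} (α : h ⟶ h') (b : B) :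
    L₂ (f ◁ α) b = (Lcomp f h b).hom ≫ L f b ◁ L₂ α b ≫ (Lcomp f h' b).inv :=
  sound₃ (inl_comp f h b) (inl_comp f h' b).symm (Rel₂.left_wL f α b)

theorem L₂_whiskerRight {a a' a'' : A} {f f' : a ⟶ a'} (α : f ⟶ f') (h : a' ⟶ a'') (b : B) :
    L₂ (α ▷ h) b = (Lcomp f h b).hom ≫ L₂ α b ▷ L h b ≫ (Lcomp f' h b).inv :=
  sound₃ (inl_comp f h b) (inl_comp f' h b).symm (Rel₂.left_wR α h b)

theorem R₂_whiskerLeft (a : A) {b b' b'' : B} (g : b ⟶ b') {h h' : b' ⟶ b''} (β : h ⟶ h') :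
    R₂ a (g ◁ β) = (Rcomp a g h).hom ≫ R a g ◁ R₂ a β ≫ (Rcomp a g h').inv :=
  sound₃ (inr_comp a g h) (inr_comp a g h').symm (Rel₂.right_wL a g β)

theorem R₂_whiskerRight (a : A) {b b' b'' : B} {g g' : b ⟶ b'} (β : g ⟶ g') (h : b' ⟶ b'') :
    R₂ a (β ▷ h) = (Rcomp a g h).hom ≫ R₂ a β ▷ R a h ≫ (Rcomp a g' h).inv :=
  sound₃ (inr_comp a g h) (inr_comp a g' h).symm (Rel₂.right_wR a β h)

theorem S_left {a a' : A} {b b' : B} {f f' : a ⟶ a'} (α : f ⟶ f') (g : b ⟶ b') :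
    R a g ◁ L₂ α b' ≫ (S f' g).hom = (S f g).hom ≫ L₂ α b ▷ R a' g :=
  sound (Rel₂.sig_left α g)

theorem S_right {a a' : A} {b b' : B} (f : a ⟶ a') {g g' : b ⟶ b'} (β : g ⟶ g') :
    R₂ a β ▷ L f b' ≫ (S f g').hom = (S f g).hom ≫ L f b ◁ R₂ a' β :=
  sound (Rel₂.sig_right f β)

theorem S_left_inv {a a' : A} {b b' : B} {f f' : a ⟶ a'} (α : f ⟶ f') (g : b ⟶ b') :
    (S f g).inv ≫ R a g ◁ L₂ α b' = L₂ α b ▷ R a' g ≫ (S f' g).inv := by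
  rw [Iso.inv_comp_eq, ← Category.assoc, Iso.eq_comp_inv]; exact S_left α g

theorem S_right_inv {a a' : A} {b b' : B} (f : a ⟶ a') {g g' : b ⟶ b'} (β : g ⟶ g') :
    (S f g).inv ≫ R₂ a β ▷ L f b' = L f b ◁ R₂ a' β ≫ (S f g').inv := by
  rw [Iso.inv_comp_eq, ← Category.assoc, Iso.eq_comp_inv]; exact S_right f β

theorem S_id_left (a : A) {b b' : B} (g : b ⟶ b') :
    S (𝟙 a) g = whiskerLeftIso (R a g) (Lid a b') ≪≫ ρ_ (R a g) ≪≫ (λ_ (R a g)).symm ≪≫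
      whiskerRightIso (Lid a b).symm (R a g) := by
  ext
  refine (sound₁ (p := R a g ≫ L (𝟙 a) b') (q := L (𝟙 a) b ≫ R a g) _
    (Rel₂.sig_id_left a g)).trans ?_
  simp [Lid, Strict.leftUnitor_eqToIso, Strict.rightUnitor_eqToIso]

theorem S_id_right {a a' : A} (f : a ⟶ a') (b : B) :
    S f (𝟙 b) = whiskerRightIso (Rid a b) (L f b) ≪≫ λ_ (L f b) ≪≫ (ρ_ (L f b)).symm ≪≫
      whiskerLeftIso (L f b) (Rid a' b).symm := by
  ext
  refine (sound₁ (p := R a (𝟙 b) ≫ L f b) (q := L f b ≫ R a' (𝟙 b)) _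
    (Rel₂.sig_id_right f b)).trans ?_
  simp [Rid, Strict.leftUnitor_eqToIso, Strict.rightUnitor_eqToIso]

theorem S_comp_left {a a' a'' : A} {b b' : B} (f : a ⟶ a') (f' : a' ⟶ a'') (g : b ⟶ b') :
    S (f ≫ f') g = whiskerLeftIso (R a g) (Lcomp f f' b') ≪≫ (α_ _ _ _).symm ≪≫
      whiskerRightIso (S f g) (L f' b') ≪≫ α_ _ _ _ ≪≫ whiskerLeftIso (L f b) (S f' g) ≪≫
      (α_ _ _ _).symm ≪≫ whiskerRightIso (Lcomp f f' b).symm (R a'' g) := by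
  ext
  have h : (S (f ≫ f') g).hom = eqToHom (by rw [L_comp, Strict.assoc]) ≫
      (S f g).hom ▷ L f' b' ≫ eqToHom (Strict.assoc _ _ _) ≫ L f b ◁ (S f' g).hom ≫
        eqToHom (by rw [L_comp, Strict.assoc]) :=
    sound₅ _ _ _ (Rel₂.sig_comp_left f f' g)
  simp [h, Lcomp, Strict.associator_eqToIso]

theorem S_comp_right {a a' : A} {b b' b'' : B} (f : a ⟶ a') (g : b ⟶ b') (g' : b' ⟶ b'') :
    S f (g ≫ g') = whiskerRightIso (Rcomp a g g') (L f b'') ≪≫ α_ _ _ _ ≪≫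
      whiskerLeftIso (R a g) (S f g') ≪≫ (α_ _ _ _).symm ≪≫ whiskerRightIso (S f g) (R a' g') ≪≫
      α_ _ _ _ ≪≫ whiskerLeftIso (L f b) (Rcomp a' g g').symm := by
  ext
  have h : (S f (g ≫ g')).hom = eqToHom (by rw [R_comp, Strict.assoc]) ≫
      R a g ◁ (S f g').hom ≫ eqToHom (Strict.assoc _ _ _).symm ≫ (S f g).hom ▷ R a' g' ≫
        eqToHom (by rw [R_comp, Strict.assoc]) :=
    sound₅ _ _ _ (Rel₂.sig_comp_right f g g')
  simp [h, Rcomp, Strict.associator_eqToIso]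

end GrayTensor

namespace GrayTensor

section Universal

variable {A B : Type u} [Bicategory.{w, v} A] [Bicategory.{w, v} B]

theorem L₂_eqToHom {a a' : A} {f f' : a ⟶ a'} (h : f = f') (b : B) :
    L₂ (eqToHom h) b = eqToHom (congrArg (fun k => L k b) h) := by
  subst h; simp

theorem R₂_eqToHom (a : A) {b b' : B} {g g' : b ⟶ b'} (h : g = g') :
    R₂ a (eqToHom h) = eqToHom (congrArg (fun k => R a k) h) := by
  subst h; simp

/-- The 2-cell `Σ_{f,g}⁻¹` whiskered by `1 ⊗ g'`. -/
def T {a a' : A} {b b' b'' : B} (f : a ⟶ a') (g : b ⟶ b') (g' : b' ⟶ b'') :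
    L f b ≫ R a' (g ≫ g') ≅ R a g ≫ L f b' ≫ R a' g' :=
  whiskerLeftIso (L f b) (Rcomp a' g g') ≪≫ (α_ _ _ _).symm ≪≫
    whiskerRightIso (S f g).symm (R a' g') ≪≫ α_ _ _ _

theorem T_whiskerLeft {a a' : A} {b b' b'' : B} {f f' : a ⟶ a'} (α : f ⟶ f') (g : b ⟶ b')
    {h h' : b' ⟶ b''} (β : h ⟶ h') :
    L₂ α b ▷ R a' (g ≫ h) ≫ L f' b ◁ R₂ a' (g ◁ β) ≫ (T f' g h').hom =
      (T f g h).hom ≫ R a g ◁ L₂ α b' ▷ R a' h ≫ R a g ◁ L f' b' ◁ R₂ a' β := by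
  have e₁ := congrArg (fun t => t ▷ R a' h) (S_left_inv α g)
  have e₂ := whisker_exchange (S f' g).inv (R₂ a' β)
  have e₁' : (S f g).inv ▷ R a' h ≫ (α_ (R a g) (L f b') (R a' h)).hom ≫
      R a g ◁ L₂ α b' ▷ R a' h = L₂ α b ▷ R a' g ▷ R a' h ≫ (S f' g).inv ▷ R a' h ≫
        (α_ (R a g) (L f' b') (R a' h)).hom := by
    rw [← cancel_mono (α_ (R a g) (L f' b') (R a' h)).inv]
    simpa using e₁
  have e₂' : (S f' g).inv ▷ R a' h ≫ (α_ (R a g) (L f' b') (R a' h)).hom ≫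
      R a g ◁ L f' b' ◁ R₂ a' β = (α_ (L f' b) (R a' g) (R a' h)).hom ≫
        L f' b ◁ R a' g ◁ R₂ a' β ≫ (α_ (L f' b) (R a' g) (R a' h')).inv ≫
          (S f' g).inv ▷ R a' h' ≫ (α_ (R a g) (L f' b') (R a' h')).hom := by
    rw [← cancel_mono (α_ (R a g) (L f' b') (R a' h')).inv]
    simpa using e₂.symm
  dsimp [T]
  simp [R₂_whiskerLeft, reassoc_of% e₁', e₂', ← whisker_exchange_assoc]

theorem T_whiskerRight {a a' : A} {b b' b'' : B} (f : a ⟶ a') {g g' : b ⟶ b'} (β : g ⟶ g')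
    (h : b' ⟶ b'') :
    L f b ◁ R₂ a' (β ▷ h) ≫ (T f g' h).hom = (T f g h).hom ≫ R₂ a β ▷ (L f b' ≫ R a' h) := by
  have e₁ := congrArg (fun t => t ▷ R a' h) (S_right_inv f β)
  simp only [comp_whiskerRight, whisker_assoc, Category.assoc] at e₁
  dsimp [T]
  simp [R₂_whiskerRight, reassoc_of% e₁]

/-- The comparison 2-cell of the universal cubical functor: it is `Σ⁻¹`, suitably whiskered. -/
def cComp {x y z : A × B} (p : x ⟶ y) (q : y ⟶ z) :
    L (p.1 ≫ q.1) x.2 ≫ R z.1 (p.2 ≫ q.2) ≅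
      (L p.1 x.2 ≫ R y.1 p.2) ≫ (L q.1 y.2 ≫ R z.1 q.2) :=
  whiskerRightIso (Lcomp p.1 q.1 x.2) (R z.1 (p.2 ≫ q.2)) ≪≫ α_ _ _ _ ≪≫
    whiskerLeftIso (L p.1 x.2) (T q.1 p.2 q.2) ≪≫ (α_ _ _ _).symm

/-- The universal cubical functor `c : A × B → A ⊗ B`: it sends `(a, b)` to `a ⊗ b`, the 1-cell
`(f, g)` to `f ⊗ 1` followed by `1 ⊗ g`, similarly for 2-cells, and its comparison 2-cells are
whiskerings of `Σ⁻¹`. -/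
def c (A B : Type u) [Bicategory.{w, v} A] [Bicategory.{w, v} B] [Strict A] [Strict B] :
    (A × B) ⥤ᵖ GrayTensor A B where
  obj x := ⟨x.1, x.2⟩
  map {x y} p := L p.1 x.2 ≫ R y.1 p.2
  map₂ {x y p q} η := L₂ η.1 x.2 ▷ R y.1 p.2 ≫ L q.1 x.2 ◁ R₂ y.1 η.2
  map₂_id p := by simp
  map₂_comp η θ := by simp [whisker_exchange_assoc]
  mapId x := whiskerRightIso (Lid x.1 x.2) _ ≪≫ λ_ _ ≪≫ Rid x.1 x.2
  mapComp p q := cComp p q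
  map₂_whisker_left {x y z} p q q' η := by
    have e := congrArg (fun t => L p.1 x.2 ◁ t) (T_whiskerLeft η.1 p.2 η.2)
    simp only [Bicategory.whiskerLeft_comp] at e
    dsimp [cComp]
    simp only [L₂_whiskerLeft, comp_whiskerRight, Category.assoc, Bicategory.whiskerLeft_comp,
      ← whisker_exchange (Lcomp p.1 q'.1 x.2).inv]
    simp [← reassoc_of% e]
  map₂_whisker_right {x y z} p p' η h := by
    have e := congrArg (fun t => L p'.1 x.2 ◁ t) (T_whiskerRight h.1 η.2 h.2)
    simp only [Bicategory.whiskerLeft_comp] at e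
    dsimp [cComp]
    have e₂ : (α_ (L p.1 x.2) (R y.1 p.2) (L h.1 y.2 ≫ R z.1 h.2)).inv ≫
        L₂ η.1 x.2 ▷ R y.1 p.2 ▷ (L h.1 y.2 ≫ R z.1 h.2) ≫
        (L p'.1 x.2 ◁ R₂ y.1 η.2) ▷ (L h.1 y.2 ≫ R z.1 h.2) ≫
        (α_ (L p'.1 x.2) (R y.1 p'.2) (L h.1 y.2 ≫ R z.1 h.2)).hom =
        L₂ η.1 x.2 ▷ (R y.1 p.2 ≫ L h.1 y.2 ≫ R z.1 h.2) ≫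
          L p'.1 x.2 ◁ R₂ y.1 η.2 ▷ (L h.1 y.2 ≫ R z.1 h.2) := by simp
    simp only [L₂_whiskerRight, comp_whiskerRight, Category.assoc, whiskerLeftIso_hom,
      whiskerLeftIso_inv, whiskerRightIso_hom, whiskerRightIso_inv,
      ← whisker_exchange (Lcomp p'.1 h.1 x.2).inv]
    rw [reassoc_of% e₂, whisker_exchange_assoc, ← reassoc_of% e]
    simp
  map₂_associator {a b c d} p q r := by
    have e := congrArg (fun t => L p.1 a.2 ◁ t) (whisker_exchange (S q.1 p.2).inv
      ((S r.1 q.2).inv ▷ R d.1 r.2))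
    simp only [comp_whiskerLeft, whiskerRight_comp, Bicategory.whiskerLeft_comp,
      comp_whiskerRight, Category.assoc, Strict.associator_eqToIso, eqToIso.hom, eqToIso.inv,
      whiskerLeft_eqToHom, eqToHom_whiskerRight, eqToHom_trans, eqToHom_trans_assoc] at e
    simp only [← Category.assoc] at e
    rw [comp_eqToHom_iff] at e
    simp only [Category.assoc] at e
    rw [eqToHom_comp_iff] at e
    simp only [eqToHom_trans, eqToHom_trans_assoc] at e
    dsimp [cComp, T]
    simp [S_comp_left, S_comp_right, L₂_eqToHom, R₂_eqToHom, Lcomp, Rcomp,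
      Strict.associator_eqToIso, congr_whiskerLeft (L_comp p.1 q.1 a.2),
      whiskerRight_congr (R_comp d.1 q.2 r.2)]
    simp [reassoc_of% e]
  map₂_left_unitor p := by
    dsimp [cComp, T]
    simp [L₂_eqToHom, R₂_eqToHom, S_id_right, Lcomp, Rcomp, Lid, Rid,
      Strict.leftUnitor_eqToIso, Strict.rightUnitor_eqToIso, Strict.associator_eqToIso]
  map₂_right_unitor p := by
    dsimp [cComp, T]
    simp [L₂_eqToHom, R₂_eqToHom, S_id_left, Lcomp, Rcomp, Lid, Rid,
      Strict.leftUnitor_eqToIso, Strict.rightUnitor_eqToIso, Strict.associator_eqToIso]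

end Universal

end GrayTensor

section HCell

variable {C : Type u₂} [Bicategory.{w₂, v₂} C]

/-- 2-cells `f ⟶ g` between 1-cells `f : a ⟶ b` and `g : a' ⟶ b'`, where `a = a'` and `b = b'`:
the 1-cell `f` is regarded as a 1-cell `a' ⟶ b'`. -/
def HCell {a a' b b' : C} (ha : a = a') (hb : b = b') (f : a ⟶ b) (g : a' ⟶ b') : Type w₂ :=
  f.cast ha hb ⟶ g

namespace HCell

/-- An ordinary 2-cell. -/
def ofHom {a b : C} {f g : a ⟶ b} (η : f ⟶ g) : HCell rfl rfl f g := η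

/-- The identity 2-cell between the identity 1-cells of two equal objects. -/
def unit {a a' : C} (ha : a = a') : HCell ha ha (𝟙 a) (𝟙 a') := by
  subst ha; exact 𝟙 (𝟙 a)

/-- Vertical composition of 2-cells. -/
def vcomp {a a' a'' b b' b'' : C} {ha : a = a'} {hb : b = b'} {ha' : a' = a''} {hb' : b' = b''}
    {f : a ⟶ b} {g : a' ⟶ b'} {h : a'' ⟶ b''} (η : HCell ha hb f g) (θ : HCell ha' hb' g h) :
    HCell (ha.trans ha') (hb.trans hb') f h := by
  subst ha hb ha' hb'
  exact CategoryStruct.comp (obj := a ⟶ b) η θ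

/-- Horizontal composition of 2-cells. -/
def hcomp {a a' b b' c c' : C} {ha : a = a'} {hb : b = b'} {hc : c = c'}
    {f : a ⟶ b} {g : a' ⟶ b'} {h : b ⟶ c} {k : b' ⟶ c'} (η : HCell ha hb f g)
    (θ : HCell hb hc h k) : HCell ha hc (f ≫ h) (g ≫ k) := by
  subst ha hb hc
  exact Bicategory.whiskerRight (B := C) (f := f) (g := g) η h ≫
    Bicategory.whiskerLeft (B := C) (g := h) (h := k) g θ

/-- The image of a 2-cell under a functor. -/
def map {D : Type u₃} [Bicategory.{w₃, v₃} D] (K : C ⥤ᵖ D) {a a' b b' : C} {ha : a = a'}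
    {hb : b = b'} {f : a ⟶ b} {g : a' ⟶ b'} (η : HCell ha hb f g) :
    HCell (congrArg K.obj ha) (congrArg K.obj hb) (K.map f) (K.map g) := by
  subst ha hb
  exact K.map₂ (f := f) (g := g) η

/-- The identity 2-cell between equal 1-cells. -/
def ofHEq {a a' b b' : C} {f : a ⟶ b} {g : a' ⟶ b'} (ha : a = a') (hb : b = b') (h : HEq f g) :
    HCell ha hb f g := by
  subst ha hb
  exact eqToHom (X := f) (eq_of_heq h)

theorem vcomp_assoc {a a' a'' a₃ b b' b'' b₃ : C} {ha : a = a'} {hb : b = b'} {ha' : a' = a''}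
    {hb' : b' = b''} {ha₃ : a'' = a₃} {hb₃ : b'' = b₃}
    {f : a ⟶ b} {g : a' ⟶ b'} {h : a'' ⟶ b''} {k : a₃ ⟶ b₃}
    (η : HCell ha hb f g) (θ : HCell ha' hb' g h) (κ : HCell ha₃ hb₃ h k) :
    (η.vcomp θ).vcomp κ = η.vcomp (θ.vcomp κ) := by
  subst ha hb ha' hb' ha₃ hb₃
  exact Category.assoc (obj := a ⟶ b) _ _ _

theorem id_vcomp {a a' b b' : C} {ha : a = a'} {hb : b = b'} {f : a ⟶ b} {g : a' ⟶ b'}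
    (η : HCell ha hb f g) : (ofHom (𝟙 f)).vcomp η = η := by
  subst ha hb
  exact Category.id_comp (obj := a ⟶ b) _

theorem vcomp_id {a a' b b' : C} {ha : a = a'} {hb : b = b'} {f : a ⟶ b} {g : a' ⟶ b'}
    (η : HCell ha hb f g) : η.vcomp (ofHom (𝟙 g)) = η := by
  subst ha hb
  exact Category.comp_id (obj := a ⟶ b) _

theorem ofHom_vcomp {a b : C} {f g h : a ⟶ b} (η : f ⟶ g) (θ : g ⟶ h) :
    (ofHom η).vcomp (ofHom θ) = ofHom (η ≫ θ) := rfl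

theorem unit_vcomp {a a' a'' : C} (ha : a = a') (ha' : a' = a'') :
    (unit ha).vcomp (unit ha') = unit (ha.trans ha') := by
  subst ha ha'
  exact Category.id_comp (obj := a ⟶ a) _

theorem unit_refl (a : C) : unit (rfl : a = a) = ofHom (𝟙 (𝟙 a)) := rfl

theorem hcomp_vcomp {a a' a'' b b' b'' c c' c'' : C} {ha : a = a'} {hb : b = b'} {hc : c = c'}
    {ha' : a' = a''} {hb' : b' = b''} {hc' : c' = c''} {f : a ⟶ b} {g : a' ⟶ b'} {h : a'' ⟶ b''}
    {f₁ : b ⟶ c} {g₁ : b' ⟶ c'} {h₁ : b'' ⟶ c''}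
    (η : HCell ha hb f g) (η₁ : HCell hb hc f₁ g₁) (θ : HCell ha' hb' g h)
    (θ₁ : HCell hb' hc' g₁ h₁) :
    (η.hcomp η₁).vcomp (θ.hcomp θ₁) = (η.vcomp θ).hcomp (η₁.vcomp θ₁) := by
  subst ha hb hc ha' hb' hc'
  change (f ⟶ g) at η
  change (f₁ ⟶ g₁) at η₁
  change (g ⟶ h) at θ
  change (g₁ ⟶ h₁) at θ₁
  change (η ▷ f₁ ≫ g ◁ η₁) ≫ θ ▷ g₁ ≫ h ◁ θ₁ = (η ≫ θ) ▷ f₁ ≫ h ◁ (η₁ ≫ θ₁)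
  simp [whisker_exchange_assoc]

theorem hcomp_ofHom_id {a b c : C} (f : a ⟶ b) (g : b ⟶ c) :
    (ofHom (𝟙 f)).hcomp (ofHom (𝟙 g)) = ofHom (𝟙 (f ≫ g)) := by
  change 𝟙 f ▷ g ≫ f ◁ 𝟙 g = 𝟙 (f ≫ g)
  simp

section Map

variable {D : Type u₃} [Bicategory.{w₃, v₃} D] (K : C ⥤ᵖ D)

theorem map_ofHom {a b : C} {f g : a ⟶ b} (η : f ⟶ g) :
    (ofHom η).map K = ofHom (K.map₂ η) := rfl

theorem map_vcomp {a a' a'' b b' b'' : C} {ha : a = a'} {hb : b = b'} {ha' : a' = a''}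
    {hb' : b' = b''} {f : a ⟶ b} {g : a' ⟶ b'} {h : a'' ⟶ b''} (η : HCell ha hb f g)
    (θ : HCell ha' hb' g h) : (η.vcomp θ).map K = (η.map K).vcomp (θ.map K) := by
  subst ha hb ha' hb'
  exact K.map₂_comp (f := f) (g := g) (h := h) η θ

theorem map_unit {a a' : C} (ha : a = a') :
    (ofHom (K.mapId a).inv).vcomp ((unit ha).map K) =
      (unit (congrArg K.obj ha)).vcomp (ofHom (K.mapId a').inv) := by
  subst ha
  change (K.mapId a).inv ≫ K.map₂ (𝟙 (𝟙 a)) = 𝟙 _ ≫ (K.mapId a).inv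
  simp

theorem map_hcomp {a a' b b' c c' : C} {ha : a = a'} {hb : b = b'} {hc : c = c'}
    {f : a ⟶ b} {g : a' ⟶ b'} {h : b ⟶ c} {k : b' ⟶ c'} (η : HCell ha hb f g)
    (θ : HCell hb hc h k) :
    (ofHom (K.mapComp f h).inv).vcomp ((η.hcomp θ).map K) =
      ((η.map K).hcomp (θ.map K)).vcomp (ofHom (K.mapComp g k).inv) := by
  subst ha hb hc
  change (f ⟶ g) at η
  change (h ⟶ k) at θ
  change (K.mapComp f h).inv ≫ K.map₂ (η ▷ h ≫ g ◁ θ) =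
    (K.map₂ η ▷ K.map h ≫ K.map g ◁ K.map₂ θ) ≫ (K.mapComp g k).inv
  simp

theorem map_id' {a a' b b' : C} {ha : a = a'} {hb : b = b'} {f : a ⟶ b} {g : a' ⟶ b'}
    (η : HCell ha hb f g) : η.map (Pseudofunctor.id C) = η := by
  subst ha hb
  rfl

theorem map_map {E : Type u₄} [Bicategory.{w₄, v₄} E] (L : D ⥤ᵖ E) {a a' b b' : C} {ha : a = a'}
    {hb : b = b'} {f : a ⟶ b} {g : a' ⟶ b'} (η : HCell ha hb f g) :
    (η.map K).map L = η.map (K.comp L) := by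
  subst ha hb
  rfl

end Map

end HCell

end HCell

/-- An icon `F ⇒ G` between functors of bicategories that agree on objects: natural
transformations `F_{ab} ⇒ G_{ab} : B(a, b) → C(F a, F b)` which are compatible with the unit and
composition constraints of `F` and `G`. -/
structure Icon {B : Type u₁} [Bicategory.{w₁, v₁} B] {C : Type u₂} [Bicategory.{w₂, v₂} C]
    (F G : B ⥤ᵖ C) where
  /-- `F` and `G` agree on objects -/
  obj_eq (a : B) : F.obj a = G.obj a
  /-- the component at a 1-cell -/
  app {a b : B} (f : a ⟶ b) : HCell (obj_eq a) (obj_eq b) (F.map f) (G.map f)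
  naturality {a b : B} {f g : a ⟶ b} (η : f ⟶ g) :
    (HCell.ofHom (F.map₂ η)).vcomp (app g) = (app f).vcomp (HCell.ofHom (G.map₂ η))
  app_id (a : B) : (HCell.ofHom (F.mapId a).inv).vcomp (app (𝟙 a)) =
    (HCell.unit (obj_eq a)).vcomp (HCell.ofHom (G.mapId a).inv)
  app_comp {a b c : B} (f : a ⟶ b) (g : b ⟶ c) :
    (HCell.ofHom (F.mapComp f g).inv).vcomp (app (f ≫ g)) =
      ((app f).hcomp (app g)).vcomp (HCell.ofHom (G.mapComp f g).inv)

namespace Icon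

variable {B : Type u₁} [Bicategory.{w₁, v₁} B] {C : Type u₂} [Bicategory.{w₂, v₂} C]
  {D : Type u₃} [Bicategory.{w₃, v₃} D]

theorem ext' {F G : B ⥤ᵖ C} {α β : Icon F G}
    (h : ∀ {a b : B} (f : a ⟶ b), α.app f = β.app f) : α = β := by
  obtain ⟨o, p, _, _, _⟩ := α
  obtain ⟨o', p', _, _, _⟩ := β
  have : @p = @p' := by
    funext a b f
    exact h f
  subst this
  rfl

theorem naturality_cell {F G : B ⥤ᵖ C} (α : Icon F G) {a a' b b' : B} {ha : a = a'} {hb : b = b'}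
    {f : a ⟶ b} {g : a' ⟶ b'} (η : HCell ha hb f g) :
    (η.map F).vcomp (α.app g) = (α.app f).vcomp (η.map G) := by
  subst ha hb
  exact α.naturality (f := f) (g := g) η

/-- The identity icon. -/
def id (F : B ⥤ᵖ C) : Icon F F where
  obj_eq _ := rfl
  app f := HCell.ofHom (𝟙 (F.map f))
  naturality η := by simp [HCell.ofHom_vcomp]
  app_id a := by simp [HCell.ofHom_vcomp, HCell.unit_refl]
  app_comp f g := by simp [HCell.ofHom_vcomp, HCell.hcomp_ofHom_id]

/-- Vertical composition of icons. -/
def comp {F G H : B ⥤ᵖ C} (α : Icon F G) (β : Icon G H) : Icon F H where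
  obj_eq a := (α.obj_eq a).trans (β.obj_eq a)
  app f := (α.app f).vcomp (β.app f)
  naturality η := by
    rw [← HCell.vcomp_assoc, α.naturality, HCell.vcomp_assoc, β.naturality, HCell.vcomp_assoc]
  app_id a := by
    rw [← HCell.vcomp_assoc, α.app_id, HCell.vcomp_assoc, β.app_id, ← HCell.vcomp_assoc,
      HCell.unit_vcomp]
  app_comp f g := by
    rw [← HCell.vcomp_assoc, α.app_comp, HCell.vcomp_assoc, β.app_comp, ← HCell.vcomp_assoc,
      HCell.hcomp_vcomp]

/-- Precomposition of an icon with a functor. -/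
def whiskerLeft (H : B ⥤ᵖ C) {F G : C ⥤ᵖ D} (α : Icon F G) : Icon (H.comp F) (H.comp G) where
  obj_eq a := α.obj_eq (H.obj a)
  app f := α.app (H.map f)
  naturality η := α.naturality (H.map₂ η)
  app_id a := by
    change (HCell.ofHom ((F.mapId _).inv ≫ F.map₂ (H.mapId a).inv)).vcomp _ =
      HCell.vcomp _ (HCell.ofHom ((G.mapId _).inv ≫ G.map₂ (H.mapId a).inv))
    rw [← HCell.ofHom_vcomp, ← HCell.ofHom_vcomp, HCell.vcomp_assoc, α.naturality,
      ← HCell.vcomp_assoc, α.app_id, HCell.vcomp_assoc]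
    rfl
  app_comp f g := by
    change (HCell.ofHom ((F.mapComp _ _).inv ≫ F.map₂ (H.mapComp f g).inv)).vcomp _ =
      HCell.vcomp _ (HCell.ofHom ((G.mapComp _ _).inv ≫ G.map₂ (H.mapComp f g).inv))
    rw [← HCell.ofHom_vcomp, ← HCell.ofHom_vcomp, HCell.vcomp_assoc, α.naturality,
      ← HCell.vcomp_assoc, α.app_comp, HCell.vcomp_assoc]
    rfl

/-- Postcomposition of an icon with a functor. -/
def whiskerRight {F G : B ⥤ᵖ C} (α : Icon F G) (K : C ⥤ᵖ D) : Icon (F.comp K) (G.comp K) where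
  obj_eq a := congrArg K.obj (α.obj_eq a)
  app f := (α.app f).map K
  naturality η := by
    have e := congrArg (HCell.map K) (α.naturality η)
    rw [HCell.map_vcomp, HCell.map_vcomp] at e
    exact e
  app_id a := by
    have e := congrArg (HCell.map K) (α.app_id a)
    rw [HCell.map_vcomp, HCell.map_vcomp, HCell.map_ofHom, HCell.map_ofHom] at e
    change (HCell.ofHom ((K.mapId _).inv ≫ K.map₂ (F.mapId a).inv)).vcomp _ =
      HCell.vcomp _ (HCell.ofHom ((K.mapId _).inv ≫ K.map₂ (G.mapId a).inv))
    rw [← HCell.ofHom_vcomp, ← HCell.ofHom_vcomp, HCell.vcomp_assoc]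
    refine (congrArg (HCell.vcomp _) e).trans ?_
    rw [← HCell.vcomp_assoc, HCell.map_unit, HCell.vcomp_assoc]
    rfl
  app_comp f g := by
    have e := congrArg (HCell.map K) (α.app_comp f g)
    rw [HCell.map_vcomp, HCell.map_vcomp, HCell.map_ofHom, HCell.map_ofHom] at e
    change (HCell.ofHom ((K.mapComp _ _).inv ≫ K.map₂ (F.mapComp f g).inv)).vcomp _ =
      HCell.vcomp _ (HCell.ofHom ((K.mapComp _ _).inv ≫ K.map₂ (G.mapComp f g).inv))
    rw [← HCell.ofHom_vcomp, ← HCell.ofHom_vcomp, HCell.vcomp_assoc]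
    refine (congrArg (HCell.vcomp _) e).trans ?_
    rw [← HCell.vcomp_assoc, HCell.map_hcomp, HCell.vcomp_assoc]
    rfl

end Icon

/-- A 2-functor is determined by its effect on cells. -/
theorem strictPseudofunctor_ext {B : Type u₁} [Bicategory.{w₁, v₁} B] {C : Type u₂}
    [Bicategory.{w₂, v₂} C] {F G : StrictPseudofunctor B C}
    (h : F.toPrelaxFunctor = G.toPrelaxFunctor) : F = G := by
  obtain ⟨⟨⟨P, i, c, _, _, _, _, _⟩, mi, hi⟩, mc, hc⟩ := F
  obtain ⟨⟨⟨P', i', c', _, _, _, _, _⟩, mi', hi'⟩, mc', hc'⟩ := G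
  obtain rfl : P = P' := h
  obtain rfl : i = i' := by funext x; exact (hi x).trans (hi' x).symm
  obtain rfl : @c = @c' := by funext x y z f g; exact (hc f g).trans (hc' f g).symm
  rfl

/-- An object of the 2-category of 2-categories, 2-functors and icons: a 2-category, that is, a
strict bicategory. -/
structure GrayIcon : Type (max (u + 1) (v + 1) (w + 1)) where
  /-- the underlying type of objects -/
  carrier : Type u
  /-- the bicategory structure -/
  [bicategory : Bicategory.{w, v} carrier]
  /-- the bicategory is a 2-category -/
  [strict : Strict carrier]

namespace GrayIcon

attribute [instance] GrayIcon.bicategory GrayIcon.strict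

/-- Bundle a 2-category. -/
abbrev of (A : Type u) [Bicategory.{w, v} A] [Strict A] : GrayIcon.{w, v, u} := ⟨A⟩

/-- The 1-cells are the 2-functors. -/
instance : CategoryStruct GrayIcon.{w, v, u} where
  Hom A B := StrictPseudofunctor A.carrier B.carrier
  id A := StrictPseudofunctor.id A.carrier
  comp F G := StrictPseudofunctor.comp F G

/-- The functor of bicategories underlying a 2-functor. -/
abbrev toPseudo {A B : GrayIcon.{w, v, u}} (F : A ⟶ B) : A.carrier ⥤ᵖ B.carrier :=
  (StrictPseudofunctor.toStrictlyUnitaryPseudofunctor F).toPseudofunctor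

/-- The 2-cells are the icons. -/
instance homCat (A B : GrayIcon.{w, v, u}) : Category (A ⟶ B) where
  Hom F G := Icon (toPseudo F) (toPseudo G)
  id F := Icon.id (toPseudo F)
  comp α β := Icon.comp α β
  id_comp α := Icon.ext' fun f => HCell.id_vcomp (α.app f)
  comp_id α := Icon.ext' fun f => HCell.vcomp_id (α.app f)
  assoc α β γ := Icon.ext' fun f => HCell.vcomp_assoc (α.app f) (β.app f) (γ.app f)

theorem assoc_eq {A B C D : GrayIcon.{w, v, u}} (F : A ⟶ B) (G : B ⟶ C) (H : C ⟶ D) :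
    (F ≫ G) ≫ H = F ≫ G ≫ H :=
  strictPseudofunctor_ext rfl

theorem id_comp_eq {A B : GrayIcon.{w, v, u}} (F : A ⟶ B) : 𝟙 A ≫ F = F :=
  strictPseudofunctor_ext rfl

theorem comp_id_eq {A B : GrayIcon.{w, v, u}} (F : A ⟶ B) : F ≫ 𝟙 B = F :=
  strictPseudofunctor_ext rfl

theorem conj_app {A B : GrayIcon.{w, v, u}} {F F' G' G : A ⟶ B} (h : F = F') (α : F' ⟶ G')
    (h' : G' = G) {a b : A.carrier} (f : a ⟶ b) :
    Icon.app (eqToHom h ≫ α ≫ eqToHom h') f =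
      (HCell.ofHEq (by rw [h]) (by rw [h]) (by rw [h])).vcomp
        ((Icon.app α f).vcomp (HCell.ofHEq (by rw [h']) (by rw [h']) (by rw [h']))) := by
  subst h h'
  rfl

theorem whiskerLeft_id {A B C : GrayIcon.{w, v, u}} (F : A ⟶ B) (G : B ⟶ C) :
    Icon.whiskerLeft (toPseudo F) (𝟙 G : G ⟶ G) = (𝟙 (F ≫ G) : F ≫ G ⟶ F ≫ G) :=
  Icon.ext' fun _ => rfl

theorem id_whiskerRight {A B C : GrayIcon.{w, v, u}} (F : A ⟶ B) (G : B ⟶ C) :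
    Icon.whiskerRight (𝟙 F : F ⟶ F) (toPseudo G) = (𝟙 (F ≫ G) : F ≫ G ⟶ F ≫ G) :=
  Icon.ext' fun f => (toPseudo G).map₂_id ((toPseudo F).map f)

theorem whiskerLeft_eqToHom {A B C : GrayIcon.{w, v, u}} (F : A ⟶ B) {G H : B ⟶ C} (h : G = H) :
    Icon.whiskerLeft (toPseudo F) (eqToHom h) = eqToHom (congrArg (fun K => F ≫ K) h) := by
  subst h
  exact whiskerLeft_id F G

theorem eqToHom_whiskerRight {A B C : GrayIcon.{w, v, u}} {F G : A ⟶ B} (h : F = G) (H : B ⟶ C) :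
    Icon.whiskerRight (eqToHom h) (toPseudo H) = eqToHom (congrArg (fun K => K ≫ H) h) := by
  subst h
  exact id_whiskerRight F H

/-- The 2-category of 2-categories, 2-functors and icons. -/
instance : Bicategory GrayIcon.{w, v, u} where
  whiskerLeft H _ _ α := Icon.whiskerLeft (toPseudo H) α
  whiskerRight α K := Icon.whiskerRight α (toPseudo K)
  associator F G H := eqToIso (assoc_eq F G H)
  leftUnitor F := eqToIso (id_comp_eq F)
  rightUnitor F := eqToIso (comp_id_eq F)
  whiskerLeft_id F G := whiskerLeft_id F G
  whiskerLeft_comp _ _ _ _ _ _ := Icon.ext' fun _ => rfl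
  id_whiskerRight F G := id_whiskerRight F G
  comp_whiskerRight α β K := Icon.ext' fun f =>
    HCell.map_vcomp (toPseudo K) (Icon.app α f) (Icon.app β f)
  id_whiskerLeft {A B F G} α := Icon.ext' fun f =>
    ((conj_app (id_comp_eq F) α (id_comp_eq G).symm f).trans
      ((HCell.id_vcomp _).trans (HCell.vcomp_id _))).symm
  comp_whiskerLeft {A B C D} F G {H K} α := Icon.ext' fun f =>
    ((conj_app (assoc_eq F G H)
      (Icon.whiskerLeft (toPseudo F) (Icon.whiskerLeft (toPseudo G) α) : F ≫ G ≫ H ⟶ F ≫ G ≫ K)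
      (assoc_eq F G K).symm f).trans
      ((HCell.id_vcomp _).trans (HCell.vcomp_id _))).symm
  whiskerRight_id {A B F G} α := Icon.ext' fun f =>
    ((conj_app (comp_id_eq F) α (comp_id_eq G).symm f).trans
      ((HCell.id_vcomp _).trans ((HCell.vcomp_id _).trans (HCell.map_id' _).symm))).symm
  whiskerRight_comp {A B C D F F'} α G H := Icon.ext' fun f =>
    ((conj_app (assoc_eq F G H).symm
      (Icon.whiskerRight (Icon.whiskerRight α (toPseudo G)) (toPseudo H) :
        (F ≫ G) ≫ H ⟶ (F' ≫ G) ≫ H) (assoc_eq F' G H) f).trans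
      ((HCell.id_vcomp _).trans ((HCell.vcomp_id _).trans (HCell.map_map _ _ _)))).symm
  whisker_assoc {A B C D} F {G G'} α H := Icon.ext' fun f =>
    ((conj_app (assoc_eq F G H)
      (Icon.whiskerLeft (toPseudo F) (Icon.whiskerRight α (toPseudo H)) :
        F ≫ G ≫ H ⟶ F ≫ G' ≫ H) (assoc_eq F G' H).symm f).trans
      ((HCell.id_vcomp _).trans (HCell.vcomp_id _))).symm
  whisker_exchange {A B C F G H K} α β := Icon.ext' fun f => (Icon.naturality_cell β (Icon.app α f)).symm
  pentagon F G H K := by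
    simp only [eqToIso.hom, whiskerLeft_eqToHom, eqToHom_whiskerRight, eqToHom_trans]
  triangle F G := by
    simp only [eqToIso.hom, whiskerLeft_eqToHom, eqToHom_whiskerRight, eqToHom_trans]

instance : Strict GrayIcon.{w, v, u} where
  id_comp F := id_comp_eq F
  comp_id F := comp_id_eq F
  assoc F G H := assoc_eq F G H
  leftUnitor_eqToIso _ := rfl
  rightUnitor_eqToIso _ := rfl
  associator_eqToIso _ _ _ := rfl

end GrayIcon

section InternalEquivalence

variable {K : Type u₁} [Bicategory.{w₁, v₁} K]

/-- `f` and `g` are pseudo-inverse to each other. -/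
def IsPseudoInverse {a b : K} (f : a ⟶ b) (g : b ⟶ a) : Prop :=
  Nonempty (f ≫ g ≅ 𝟙 a) ∧ Nonempty (g ≫ f ≅ 𝟙 b)

/-- Internal equivalences in a bicategory: the 1-cells which have a pseudo-inverse. -/
def IsInternalEquivalence {a b : K} (f : a ⟶ b) : Prop :=
  ∃ g : b ⟶ a, IsPseudoInverse f g

end InternalEquivalence

/-!
The proof rests on one observation: to define a 2-functor between 2-categories which is isomorphic,
by an invertible icon, to a given functor `H`, only a strictly functorial choice of 1-cells
isomorphic to the values of `H` is needed, with isomorphisms compatible with the constraints of `H`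
(a `StrictModel` of `H`). Conjugation by these isomorphisms defines the effect on 2-cells, and the
axioms hold because they hold for `H`.

Let `c : A × B → A ⊗ B` be the universal cubical functor. There is a projection 2-functor
`A ⊗ B → A × B` which sends the 2-cells `Σ` to identities. The composite `A × B → A ⊗ B → A × B` is
isomorphic to the identity by an icon with identity components (`iconCProj`), and the composite
`A ⊗ B → A × B → A ⊗ B` is isomorphic to the identity by an invertible icon (`iconIso_projC`),
because the identity 2-functor of `A ⊗ B` comes from a strict model of it. Also the unit
`f : B → st B` and the counit `e : st B → B` are inverse to each other up to invertible icons
(`iconFE`, `iconEF`).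

* The 2-functor `χ` is given by a strict model of the composite
  `st X ⊗ st Y → st X × st Y → X × Y → st (X × Y)` of the projection, `e × e` and `f`. Since the
  1-cells of the Gray tensor product are generated by the `p ⊗ 1` and the `1 ⊗ q`, subject only to
  functoriality in each variable, a strict model is determined by its values on these
  (`GenModel.strictModel`), here the strings `(f₁, 1), …, (fₙ, 1)` and `(1, g₁), …, (1, gₘ)`.
* The 2-functor `χ̄` is given by a strict model of the composite
  `st (X × Y) → X × Y → st X ⊗ st Y` of `e` and `c (f × f)`, which sends a string to the composite
  of the values of `c (f × f)` on its terms.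

Up to invertible icons, `χ` and `χ̄` are therefore composites of functors which are invertible up to
invertible icons, and they are mutually pseudo-inverse by cancellation. Both strict equations hold
because the evident icons, from `χ c` to the comparison functor and from `χ̄ f` to `c (f × f)`, have
identity 2-cells as components (`Icon.eq_of_app`). Finally `χ` is determined by `χ c` because the
generators of `A ⊗ B` are in the image of `c`, with the `Σ⁻¹` among its comparison 2-cells
(`eq_of_c_comp_eq`).
-/


/-! ### Invertible icons -/

namespace HCell

variable {C : Type u₂} [Bicategory.{w₂, v₂} C]

/-- A 2-cell between 1-cells with propositionally equal endpoints is invertible if it has a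
two-sided inverse for vertical composition. -/
def IsInv {a a' b b' : C} {ha : a = a'} {hb : b = b'} {f : a ⟶ b} {g : a' ⟶ b'}
    (η : HCell ha hb f g) : Prop :=
  ∃ θ : HCell ha.symm hb.symm g f, η.vcomp θ = ofHom (𝟙 f) ∧ θ.vcomp η = ofHom (𝟙 g)

theorem isInv_ofIso {a b : C} {f g : a ⟶ b} (e : f ≅ g) : (ofHom e.hom).IsInv :=
  ⟨ofHom e.inv, e.hom_inv_id, e.inv_hom_id⟩

theorem IsInv.vcomp {a a' a'' b b' b'' : C} {ha : a = a'} {hb : b = b'} {ha' : a' = a''}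
    {hb' : b' = b''} {f : a ⟶ b} {g : a' ⟶ b'} {h : a'' ⟶ b''} {η : HCell ha hb f g}
    {θ : HCell ha' hb' g h} (hη : η.IsInv) (hθ : θ.IsInv) : (η.vcomp θ).IsInv := by
  obtain ⟨η', h₁, h₂⟩ := hη
  obtain ⟨θ', h₃, h₄⟩ := hθ
  refine ⟨θ'.vcomp η', ?_, ?_⟩
  · rw [vcomp_assoc, ← vcomp_assoc θ, h₃, id_vcomp, h₁]
  · rw [vcomp_assoc, ← vcomp_assoc η', h₂, id_vcomp, h₄]

theorem IsInv.map {D : Type u₃} [Bicategory.{w₃, v₃} D] (K : C ⥤ᵖ D) {a a' b b' : C}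
    {ha : a = a'} {hb : b = b'} {f : a ⟶ b} {g : a' ⟶ b'} {η : HCell ha hb f g} (hη : η.IsInv) :
    (η.map K).IsInv := by
  obtain ⟨θ, h₁, h₂⟩ := hη
  refine ⟨θ.map K, ?_, ?_⟩
  · rw [← map_vcomp, h₁, map_ofHom, K.map₂_id]
  · rw [← map_vcomp, h₂, map_ofHom, K.map₂_id]

theorem IsInv.cancel_left {a a' a'' b b' b'' : C} {ha : a = a'} {hb : b = b'} {ha' : a' = a''}
    {hb' : b' = b''} {f : a ⟶ b} {g : a' ⟶ b'} {h : a'' ⟶ b''} {η : HCell ha hb f g}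
    (hη : η.IsInv) {θ κ : HCell ha' hb' g h} (e : η.vcomp θ = η.vcomp κ) : θ = κ := by
  obtain ⟨η', _, h₂⟩ := hη
  have := congrArg (HCell.vcomp η') e
  rwa [← vcomp_assoc, ← vcomp_assoc, h₂, id_vcomp, id_vcomp] at this

end HCell

namespace Icon

variable {B : Type u₁} [Bicategory.{w₁, v₁} B] {C : Type u₂} [Bicategory.{w₂, v₂} C]
  {D : Type u₃} [Bicategory.{w₃, v₃} D] {E : Type u₄} [Bicategory.{w₄, v₄} E]

/-- An icon is invertible if all its components are. -/
def IsInv {F G : B ⥤ᵖ C} (α : Icon F G) : Prop :=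
  ∀ {a b : B} (f : a ⟶ b), (α.app f).IsInv

theorem IsInv.comp {F G H : B ⥤ᵖ C} {α : Icon F G} {β : Icon G H} (hα : α.IsInv) (hβ : β.IsInv) :
    (α.comp β).IsInv := fun f => (hα f).vcomp (hβ f)

theorem IsInv.whiskerLeft (H : B ⥤ᵖ C) {F G : C ⥤ᵖ D} {α : Icon F G} (hα : α.IsInv) :
    (α.whiskerLeft H).IsInv := fun f => hα (H.map f)

theorem IsInv.whiskerRight {F G : B ⥤ᵖ C} {α : Icon F G} (hα : α.IsInv) (K : C ⥤ᵖ D) :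
    (α.whiskerRight K).IsInv := fun f => (hα f).map K

/-- The inverses of the components of an invertible icon form an icon. Compatibility with horizontal
composition follows by cancelling the invertible 2-cell `α_f * α_g`. -/
theorem IsInv.exists_inverse {F G : B ⥤ᵖ C} {α : Icon F G} (hα : α.IsInv) :
    ∃ β : Icon G F, α.comp β = Icon.id F ∧ β.comp α = Icon.id G := by
  have hα' : ∀ (a b : B) (f : a ⟶ b), (α.app f).IsInv := fun _ _ f => hα f
  choose β' h₁' h₂' using hα'
  let β {a b : B} (f : a ⟶ b) := β' a b f
  have h₁ {a b : B} (f : a ⟶ b) : (α.app f).vcomp (β f) = HCell.ofHom (𝟙 (F.map f)) := h₁' a b f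
  have h₂ {a b : B} (f : a ⟶ b) : (β f).vcomp (α.app f) = HCell.ofHom (𝟙 (G.map f)) := h₂' a b f
  have ho : ∀ a, G.obj a = F.obj a := fun a => (α.obj_eq a).symm
  refine ⟨⟨ho, fun f => β f, ?_, ?_, ?_⟩, Icon.ext' fun f => h₁ f, Icon.ext' fun f => h₂ f⟩
  · intro a b f g η
    apply (hα f).cancel_left
    rw [← HCell.vcomp_assoc, ← α.naturality, HCell.vcomp_assoc, h₁, HCell.vcomp_id,
      ← HCell.vcomp_assoc, h₁, HCell.id_vcomp]
  · intro a
    have hu : (HCell.unit (α.obj_eq a)).IsInv :=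
      ⟨HCell.unit (ho a), by rw [HCell.unit_vcomp]; rfl, by rw [HCell.unit_vcomp]; rfl⟩
    apply hu.cancel_left
    rw [← HCell.vcomp_assoc, ← α.app_id, HCell.vcomp_assoc, h₁, HCell.vcomp_id,
      ← HCell.vcomp_assoc, HCell.unit_vcomp]
    exact (HCell.id_vcomp _).symm
  · intro a b c f g
    have hc : ((α.app f).hcomp (α.app g)).IsInv :=
      ⟨(β f).hcomp (β g), by rw [HCell.hcomp_vcomp, h₁, h₁, HCell.hcomp_ofHom_id],
        by rw [HCell.hcomp_vcomp, h₂, h₂, HCell.hcomp_ofHom_id]⟩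
    apply hc.cancel_left
    rw [← HCell.vcomp_assoc, ← α.app_comp, HCell.vcomp_assoc, h₁, HCell.vcomp_id,
      ← HCell.vcomp_assoc, HCell.hcomp_vcomp, h₁, h₁, HCell.hcomp_ofHom_id]
    exact (HCell.id_vcomp _).symm

/-- The identity icon between the two bracketings of a composite of three functors: these agree on
cells, and their constraints agree up to associativity of vertical composition. -/
def assoc (F : B ⥤ᵖ C) (G : C ⥤ᵖ D) (H : D ⥤ᵖ E) :
    Icon ((F.comp G).comp H) (F.comp (G.comp H)) where
  obj_eq _ := rfl
  app f := HCell.ofHom (𝟙 (H.map (G.map (F.map f))))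
  naturality η := by
    change H.map₂ (G.map₂ (F.map₂ η)) ≫ 𝟙 _ = 𝟙 _ ≫ H.map₂ (G.map₂ (F.map₂ η))
    simp
  app_id a := by
    change ((H.mapId (G.obj (F.obj a))).inv ≫
      H.map₂ ((G.mapId (F.obj a)).inv ≫ G.map₂ (F.mapId a).inv)) ≫ 𝟙 _ =
      𝟙 _ ≫ (((H.mapId (G.obj (F.obj a))).inv ≫ H.map₂ (G.mapId (F.obj a)).inv) ≫
        H.map₂ (G.map₂ (F.mapId a).inv))
    simp
  app_comp f g := by
    change ((H.mapComp (G.map (F.map f)) (G.map (F.map g))).inv ≫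
      H.map₂ ((G.mapComp (F.map f) (F.map g)).inv ≫ G.map₂ (F.mapComp f g).inv)) ≫ 𝟙 _ =
      (𝟙 (H.map (G.map (F.map f))) ▷ H.map (G.map (F.map g)) ≫
        H.map (G.map (F.map f)) ◁ 𝟙 (H.map (G.map (F.map g)))) ≫
      (((H.mapComp (G.map (F.map f)) (G.map (F.map g))).inv ≫
      H.map₂ (G.mapComp (F.map f) (F.map g)).inv) ≫ H.map₂ (G.map₂ (F.mapComp f g).inv))
    simp

theorem isInv_assoc (F : B ⥤ᵖ C) (G : C ⥤ᵖ D) (H : D ⥤ᵖ E) : (assoc F G H).IsInv :=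
  fun f => HCell.isInv_ofIso (Iso.refl (H.map (G.map (F.map f))))

/-- The inverse of `Icon.assoc`. -/
def assocInv (F : B ⥤ᵖ C) (G : C ⥤ᵖ D) (H : D ⥤ᵖ E) :
    Icon (F.comp (G.comp H)) ((F.comp G).comp H) where
  obj_eq _ := rfl
  app f := HCell.ofHom (𝟙 (H.map (G.map (F.map f))))
  naturality η := by
    change H.map₂ (G.map₂ (F.map₂ η)) ≫ 𝟙 _ = 𝟙 _ ≫ H.map₂ (G.map₂ (F.map₂ η))
    simp
  app_id a := by
    change (((H.mapId (G.obj (F.obj a))).inv ≫ H.map₂ (G.mapId (F.obj a)).inv) ≫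
      H.map₂ (G.map₂ (F.mapId a).inv)) ≫ 𝟙 _ =
      𝟙 _ ≫ ((H.mapId (G.obj (F.obj a))).inv ≫
        H.map₂ ((G.mapId (F.obj a)).inv ≫ G.map₂ (F.mapId a).inv))
    simp
  app_comp f g := by
    change (((H.mapComp (G.map (F.map f)) (G.map (F.map g))).inv ≫
      H.map₂ (G.mapComp (F.map f) (F.map g)).inv) ≫ H.map₂ (G.map₂ (F.mapComp f g).inv)) ≫ 𝟙 _ =
      (𝟙 (H.map (G.map (F.map f))) ▷ H.map (G.map (F.map g)) ≫
        H.map (G.map (F.map f)) ◁ 𝟙 (H.map (G.map (F.map g)))) ≫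
      ((H.mapComp (G.map (F.map f)) (G.map (F.map g))).inv ≫
      H.map₂ ((G.mapComp (F.map f) (F.map g)).inv ≫ G.map₂ (F.mapComp f g).inv))
    simp

/-- Two functors are equal if they agree on objects and 1-cells, and the identities are the
components of an icon between them. -/
theorem eq_of_app {F G : B ⥤ᵖ C} (α : Icon F G) (hm : ∀ {a b : B} (f : a ⟶ b),
    HEq (F.map f) (G.map f)) (h : ∀ {a b : B} (f : a ⟶ b),
    α.app f = HCell.ofHEq (α.obj_eq a) (α.obj_eq b) (hm f)) : F = G := by
  obtain ⟨⟨⟨⟨o, m⟩, m₂⟩, _, _⟩, i, c, _, _, _, _, _⟩ := F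
  obtain ⟨⟨⟨⟨o', m'⟩, m₂'⟩, _, _⟩, i', c', _, _, _, _, _⟩ := G
  obtain ⟨ho, p, hn, hi, hc⟩ := α
  obtain rfl : o = o' := funext ho
  obtain rfl : @m = @m' := by
    funext a b f
    exact eq_of_heq (hm f)
  obtain rfl : @p = fun a b f => HCell.ofHom (𝟙 (m f)) := by
    funext a b f
    exact h f
  obtain rfl : @m₂ = @m₂' := by
    funext a b f g η
    have := hn η
    rw [HCell.vcomp_id, HCell.id_vcomp] at this
    exact this
  obtain rfl : i = i' := by
    funext a
    have := hi a
    rw [HCell.vcomp_id, HCell.unit_refl, HCell.id_vcomp] at this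
    exact Iso.symm_eq_iff.mp (Iso.ext this)
  obtain rfl : @c = @c' := by
    funext a b d f g
    have := hc f g
    rw [HCell.vcomp_id, HCell.hcomp_ofHom_id, HCell.id_vcomp] at this
    exact Iso.symm_eq_iff.mp (Iso.ext this)
  rfl

end Icon

/-! ### Functors related by an invertible icon -/

section IconIso

variable {B : Type u₁} [Bicategory.{w₁, v₁} B] {C : Type u₂} [Bicategory.{w₂, v₂} C]
  {D : Type u₃} [Bicategory.{w₃, v₃} D] {E : Type u₄} [Bicategory.{w₄, v₄} E]

/-- There is an invertible icon from `F` to `G`. -/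
def IconIso (F G : B ⥤ᵖ C) : Prop := ∃ α : Icon F G, α.IsInv

namespace IconIso

theorem symm {F G : B ⥤ᵖ C} (h : IconIso F G) : IconIso G F := by
  obtain ⟨α, hα⟩ := h
  obtain ⟨β, h₁, h₂⟩ := hα.exists_inverse
  refine ⟨β, fun f => ?_⟩
  have e₁ : (α.comp β).app f = (Icon.id F).app f := by rw [h₁]
  have e₂ : (β.comp α).app f = (Icon.id G).app f := by rw [h₂]
  exact ⟨α.app f, e₂, e₁⟩

theorem trans {F G H : B ⥤ᵖ C} (h₁ : IconIso F G) (h₂ : IconIso G H) : IconIso F H := by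
  obtain ⟨α, hα⟩ := h₁
  obtain ⟨β, hβ⟩ := h₂
  exact ⟨α.comp β, hα.comp hβ⟩

theorem comp_left (H : B ⥤ᵖ C) {F G : C ⥤ᵖ D} (h : IconIso F G) :
    IconIso (H.comp F) (H.comp G) := by
  obtain ⟨α, hα⟩ := h
  exact ⟨α.whiskerLeft H, hα.whiskerLeft H⟩

theorem comp_right {F G : B ⥤ᵖ C} (h : IconIso F G) (K : C ⥤ᵖ D) :
    IconIso (F.comp K) (G.comp K) := by
  obtain ⟨α, hα⟩ := h
  exact ⟨α.whiskerRight K, hα.whiskerRight K⟩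

theorem assoc (F : B ⥤ᵖ C) (G : C ⥤ᵖ D) (H : D ⥤ᵖ E) :
    IconIso ((F.comp G).comp H) (F.comp (G.comp H)) :=
  ⟨Icon.assoc F G H, Icon.isInv_assoc F G H⟩

end IconIso

/-- The identity icon `1 F ⇒ F`. -/
def Icon.leftUnitor (F : B ⥤ᵖ C) : Icon ((Pseudofunctor.id B).comp F) F where
  obj_eq _ := rfl
  app f := HCell.ofHom (𝟙 (F.map f))
  naturality η := by
    change F.map₂ η ≫ 𝟙 _ = 𝟙 _ ≫ F.map₂ η
    simp
  app_id a := by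
    change ((F.mapId a).inv ≫ F.map₂ (𝟙 (𝟙 a))) ≫ 𝟙 _ = 𝟙 _ ≫ (F.mapId a).inv
    simp
  app_comp f g := by
    change ((F.mapComp f g).inv ≫ F.map₂ (𝟙 (f ≫ g))) ≫ 𝟙 _ =
      (𝟙 (F.map f) ▷ F.map g ≫ F.map f ◁ 𝟙 (F.map g)) ≫ (F.mapComp f g).inv
    simp

theorem IconIso.id_comp (F : B ⥤ᵖ C) : IconIso ((Pseudofunctor.id B).comp F) F :=
  ⟨Icon.leftUnitor F, fun f => HCell.isInv_ofIso (Iso.refl (F.map f))⟩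

theorem GrayIcon.nonempty_iso {A B : GrayIcon.{w, v, u}} {F G : A ⟶ B}
    (h : IconIso (GrayIcon.toPseudo F) (GrayIcon.toPseudo G)) : Nonempty (F ≅ G) := by
  obtain ⟨α, hα⟩ := h
  obtain ⟨β, h₁, h₂⟩ := hα.exists_inverse
  exact ⟨⟨α, β, h₁, h₂⟩⟩

end IconIso

/-! ### Strict models -/

/-- A strict approximation of a functor `H` from a 2-category to a 2-category: a strictly functorial
assignment on 1-cells, with invertible 2-cells to the values of `H` which are compatible with the
constraints of `H`. -/
structure StrictModel {B : Type u₁} [Bicategory.{w₁, v₁} B] {C : Type u₂} [Bicategory.{w₂, v₂} C]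
    (H : B ⥤ᵖ C) where
  /-- the effect on 1-cells -/
  map {a b : B} (f : a ⟶ b) : H.obj a ⟶ H.obj b
  map_id (a : B) : map (𝟙 a) = 𝟙 (H.obj a)
  map_comp {a b c : B} (f : a ⟶ b) (g : b ⟶ c) : map (f ≫ g) = map f ≫ map g
  /-- the comparison with `H` -/
  iso {a b : B} (f : a ⟶ b) : map f ≅ H.map f
  iso_id (a : B) : (iso (𝟙 a)).hom = eqToHom (map_id a) ≫ (H.mapId a).inv
  iso_comp {a b c : B} (f : a ⟶ b) (g : b ⟶ c) : (iso (f ≫ g)).hom = eqToHom (map_comp f g) ≫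
    (iso f).hom ▷ map g ≫ H.map f ◁ (iso g).hom ≫ (H.mapComp f g).inv

namespace StrictModel

variable {B : Type u₁} [Bicategory.{w₁, v₁} B] {C : Type u₂} [Bicategory.{w₂, v₂} C]
  {H : B ⥤ᵖ C}

theorem iso_comp_inv (M : StrictModel H) {a b c : B} (f : a ⟶ b) (g : b ⟶ c) :
    (M.iso (f ≫ g)).inv = (H.mapComp f g).hom ≫ H.map f ◁ (M.iso g).inv ≫
      (M.iso f).inv ▷ M.map g ≫ eqToHom (M.map_comp f g).symm := by
  rw [Iso.inv_eq_inv _ (eqToIso (M.map_comp f g) ≪≫ whiskerRightIso (M.iso f) (M.map g) ≪≫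
    whiskerLeftIso (H.map f) (M.iso g) ≪≫ (H.mapComp f g).symm) |>.mpr]
  · simp
  · simp [M.iso_comp]

/-- The 2-functor whose effect on 1-cells is that of the strict model, and whose effect on 2-cells
is that of `H` up to conjugation. -/
def functor [Strict B] [Strict C] (M : StrictModel H) : StrictPseudofunctor B C :=
  StrictPseudofunctor.mk''
    { obj := H.obj
      map := M.map
      map₂ := fun {_ _ f g} η => (M.iso f).hom ≫ H.map₂ η ≫ (M.iso g).inv
      map₂_id := fun f => by simp
      map₂_comp := fun η θ => by simp
      map_id := M.map_id
      map_comp := M.map_comp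
      map₂_whisker_left := fun f g g' η => by
        simp [M.iso_comp, M.iso_comp_inv, ← whisker_exchange_assoc]
      map₂_whisker_right := fun η h => by
        simp [M.iso_comp, M.iso_comp_inv, whisker_exchange_assoc] }

/-- The icon from the 2-functor of a strict model of `H` to `H`. -/
def icon [Strict B] [Strict C] (M : StrictModel H) : Icon M.functor.toPseudofunctor H where
  obj_eq _ := rfl
  app f := HCell.ofHom (M.iso f).hom
  naturality {a b f g} η := by
    change ((M.iso f).hom ≫ H.map₂ η ≫ (M.iso g).inv) ≫ (M.iso g).hom = (M.iso f).hom ≫ H.map₂ η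
    simp
  app_id a := by
    change (eqToIso (M.map_id a)).inv ≫ (M.iso (𝟙 a)).hom = 𝟙 _ ≫ (H.mapId a).inv
    simp [M.iso_id]
  app_comp f g := by
    change (eqToIso (M.map_comp f g)).inv ≫ (M.iso (f ≫ g)).hom =
      ((M.iso f).hom ▷ M.map g ≫ H.map f ◁ (M.iso g).hom) ≫ (H.mapComp f g).inv
    simp [M.iso_comp]

theorem isInv_icon [Strict B] [Strict C] (M : StrictModel H) : M.icon.IsInv :=
  fun f => HCell.isInv_ofIso (M.iso f)

end StrictModel

/-! ### 1-cells of the Gray tensor product, and equality of 2-functors out of it -/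

namespace Gray

variable {A B : Type u} [Bicategory.{w, v} A] [Bicategory.{w, v} B]

section OneCells

variable {T : Type u₁} [Category.{v₁} T]

/-- The value on the generating 1-cells of a functor out of the category of 1-cells of `A ⊗ B`. -/
def genMap (obj : Cat₁ A B → T)
    (l : ∀ {a a' : A}, (a ⟶ a') → ∀ b : B, (obj (tens a b) ⟶ obj (tens a' b)))
    (r : ∀ (a : A) {b b' : B}, (b ⟶ b') → (obj (tens a b) ⟶ obj (tens a b'))) :
    {x y : Vert A B} → Gen A B x y → (obj ⟨x⟩ ⟶ obj ⟨y⟩)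
  | _, _, Gen.left f b => l f b
  | _, _, Gen.right a g => r a g

/-- The functor out of the category of objects and 1-cells of `A ⊗ B` determined by its values on
the generating 1-cells. -/
def lift₁ (obj : Cat₁ A B → T)
    (l : ∀ {a a' : A}, (a ⟶ a') → ∀ b : B, (obj (tens a b) ⟶ obj (tens a' b)))
    (r : ∀ (a : A) {b b' : B}, (b ⟶ b') → (obj (tens a b) ⟶ obj (tens a b')))
    (l_id : ∀ a b, l (𝟙 a) b = 𝟙 (obj (tens a b)))
    (l_comp : ∀ {a a' a'' : A} (f : a ⟶ a') (f' : a' ⟶ a'') (b : B),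
      l (f ≫ f') b = l f b ≫ l f' b)
    (r_id : ∀ a b, r a (𝟙 b) = 𝟙 (obj (tens a b)))
    (r_comp : ∀ (a : A) {b b' b'' : B} (g : b ⟶ b') (g' : b' ⟶ b''),
      r a (g ≫ g') = r a g ≫ r a g') : Cat₁ A B ⥤ T :=
  CategoryTheory.Quotient.lift (Rel₁ A B)
    (Paths.lift { obj := fun x => obj ⟨x⟩, map := fun e => genMap obj l r e })
    (by
      rintro _ _ _ _ (⟨a, b⟩ | ⟨f, f', b⟩ | ⟨a, b⟩ | ⟨a, g, g'⟩)
      · exact (Category.id_comp _).trans (l_id a b)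
      · exact ((Category.id_comp _).trans (l_comp f f' b)).trans
          (congrArg (· ≫ l f' b) (Category.id_comp (l f b)).symm)
      · exact (Category.id_comp _).trans (r_id a b)
      · exact ((Category.id_comp _).trans (r_comp a g g')).trans
          (congrArg (· ≫ r a g') (Category.id_comp (r a g)).symm))

section

variable (obj : Cat₁ A B → T)
    (l : ∀ {a a' : A}, (a ⟶ a') → ∀ b : B, (obj (tens a b) ⟶ obj (tens a' b)))
    (r : ∀ (a : A) {b b' : B}, (b ⟶ b') → (obj (tens a b) ⟶ obj (tens a b')))
    (l_id : ∀ a b, l (𝟙 a) b = 𝟙 (obj (tens a b)))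
    (l_comp : ∀ {a a' a'' : A} (f : a ⟶ a') (f' : a' ⟶ a'') (b : B),
      l (f ≫ f') b = l f b ≫ l f' b)
    (r_id : ∀ a b, r a (𝟙 b) = 𝟙 (obj (tens a b)))
    (r_comp : ∀ (a : A) {b b' b'' : B} (g : b ⟶ b') (g' : b' ⟶ b''),
      r a (g ≫ g') = r a g ≫ r a g')

theorem lift₁_inl {a a' : A} (f : a ⟶ a') (b : B) :
    (lift₁ obj l r l_id l_comp r_id r_comp).map (inl f b) = l f b :=
  Category.id_comp _

theorem lift₁_inr (a : A) {b b' : B} (g : b ⟶ b') :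
    (lift₁ obj l r l_id l_comp r_id r_comp).map (inr a g) = r a g :=
  Category.id_comp _

end

/-- Every 1-cell of `A ⊗ B` is a composite of 1-cells of the form `f ⊗ 1` and `1 ⊗ g`. -/
theorem hom_induction {P : ∀ {x y : Cat₁ A B}, (x ⟶ y) → Prop} (h_id : ∀ x, P (𝟙 x))
    (h_inl : ∀ {x : Cat₁ A B} {a a' : A} {b : B} (p : x ⟶ tens a b) (f : a ⟶ a'),
      P p → P (p ≫ inl f b))
    (h_inr : ∀ {x : Cat₁ A B} {a : A} {b b' : B} (p : x ⟶ tens a b) (g : b ⟶ b'),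
      P p → P (p ≫ inr a g)) {x y : Cat₁ A B} (p : x ⟶ y) : P p := by
  obtain ⟨x⟩ := x
  obtain ⟨y⟩ := y
  obtain ⟨p⟩ := p
  change @Quiver.Path (Vert A B) _ x y at p
  induction p with
  | nil => exact h_id ⟨x⟩
  | cons q e ih =>
    change Gen A B _ _ at e
    cases e with
    | left f b => exact h_inl (x := ⟨x⟩) (Quot.mk _ q) f (ih (Quot.mk _ q))
    | right a g => exact h_inr (x := ⟨x⟩) (Quot.mk _ q) g (ih (Quot.mk _ q))

end OneCells

end Gray

namespace GrayTensor

open Gray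

variable {A B : Type u} [Bicategory.{w, v} A] [Bicategory.{w, v} B]

/-- Two 2-functors out of `A ⊗ B` are equal if they agree on objects and on the generating 1-cells
and 2-cells. -/
theorem hom_ext {C : Type u₁} [Bicategory.{w₁, v₁} C]
    {F G : StrictPseudofunctor (GrayTensor A B) C}
    (ho : ∀ x, F.obj x = G.obj x)
    (hl : ∀ {a a' : A} (f : a ⟶ a') (b : B), HEq (F.map (L f b)) (G.map (L f b)))
    (hr : ∀ (a : A) {b b' : B} (g : b ⟶ b'), HEq (F.map (R a g)) (G.map (R a g)))
    (hl₂ : ∀ {a a' : A} {f f' : a ⟶ a'} (α : f ⟶ f') (b : B),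
      HEq (F.map₂ (L₂ α b)) (G.map₂ (L₂ α b)))
    (hr₂ : ∀ (a : A) {b b' : B} {g g' : b ⟶ b'} (β : g ⟶ g'),
      HEq (F.map₂ (R₂ a β)) (G.map₂ (R₂ a β)))
    (hs : ∀ {a a' : A} {b b' : B} (f : a ⟶ a') (g : b ⟶ b'),
      HEq (F.map₂ (S f g).inv) (G.map₂ (S f g).inv)) : F = G := by
  apply strictPseudofunctor_ext
  have hFL : ∀ {x y z : GrayTensor A B} (p : x ⟶ y) {q q' : y ⟶ z} (η : q ⟶ q'),
    F.map₂ (p ◁ η) = eqToHom (F.map_comp p q) ≫ F.map p ◁ F.map₂ η ≫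
      eqToHom (F.map_comp p q').symm := fun p q q' η => by
    simp [F.mapComp_eq_eqToIso]
  have hFR : ∀ {x y z : GrayTensor A B} {p p' : x ⟶ y} (η : p ⟶ p') (q : y ⟶ z),
    F.map₂ (η ▷ q) = eqToHom (F.map_comp p q) ≫ F.map₂ η ▷ F.map q ≫
      eqToHom (F.map_comp p' q).symm := fun η q => by
    simp [F.mapComp_eq_eqToIso]
  have hGL : ∀ {x y z : GrayTensor A B} (p : x ⟶ y) {q q' : y ⟶ z} (η : q ⟶ q'),
    G.map₂ (p ◁ η) = eqToHom (G.map_comp p q) ≫ G.map p ◁ G.map₂ η ≫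
      eqToHom (G.map_comp p q').symm := fun p q q' η => by
    simp [G.mapComp_eq_eqToIso]
  have hGR : ∀ {x y z : GrayTensor A B} {p p' : x ⟶ y} (η : p ⟶ p') (q : y ⟶ z),
    G.map₂ (η ▷ q) = eqToHom (G.map_comp p q) ≫ G.map₂ η ▷ G.map q ≫
      eqToHom (G.map_comp p' q).symm := fun η q => by
    simp [G.mapComp_eq_eqToIso]
  obtain ⟨⟨⟨⟨⟨⟨o, m⟩, m₂⟩, f₁, f₂⟩, _, _, _, _, _, _, _⟩, f₃, _⟩, f₄, _⟩ := F
  obtain ⟨⟨⟨⟨⟨⟨o', m'⟩, m₂'⟩, f₁', f₂'⟩, _, _, _, _, _, _, _⟩, f₃', _⟩, f₄', _⟩ := G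
  dsimp only at *
  obtain rfl : o = o' := funext ho
  obtain rfl : @m = @m' := by
    funext x y p
    revert p
    have key : ∀ {x y : Cat₁ A B} (p : x ⟶ y),
        @m ⟨x.as.fst, x.as.snd⟩ ⟨y.as.fst, y.as.snd⟩ p =
          @m' ⟨x.as.fst, x.as.snd⟩ ⟨y.as.fst, y.as.snd⟩ p := by
      intro x y p
      refine hom_induction (P := fun {x y} p => @m ⟨x.as.fst, x.as.snd⟩ ⟨y.as.fst, y.as.snd⟩ p =
          @m' ⟨x.as.fst, x.as.snd⟩ ⟨y.as.fst, y.as.snd⟩ p) ?_ ?_ ?_ p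
      · intro x
        exact (f₃ ⟨x.as.fst, x.as.snd⟩).trans (f₃' _).symm
      · intro x a a' b p f ih
        refine (f₄ (a := ⟨x.as.fst, x.as.snd⟩) (b := ⟨a, b⟩) (c := ⟨a', b⟩) p (L f b)).trans
          (Eq.trans ?_ (f₄' (a := ⟨x.as.fst, x.as.snd⟩) (b := ⟨a, b⟩) (c := ⟨a', b⟩) p
            (L f b)).symm)
        exact congrArg₂ _ ih (eq_of_heq (hl f b))
      · intro x a b b' p g ih
        refine (f₄ (a := ⟨x.as.fst, x.as.snd⟩) (b := ⟨a, b⟩) (c := ⟨a, b'⟩) p (R a g)).trans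
          (Eq.trans ?_ (f₄' (a := ⟨x.as.fst, x.as.snd⟩) (b := ⟨a, b⟩) (c := ⟨a, b'⟩) p
            (R a g)).symm)
        exact congrArg₂ _ ih (eq_of_heq (hr a g))
    exact fun p => key p
  obtain rfl : @m₂ = @m₂' := by
    funext x y p q η
    obtain ⟨η⟩ := η
    have hs' : ∀ {a a' : A} {b b' : B} (f : a ⟶ a') (g : b ⟶ b'),
        m₂ (S f g).inv = m₂' (S f g).inv := fun f g => eq_of_heq (hs f g)
    have key : ∀ {x y : Cat₁ A B} {p q : x ⟶ y} (η : Pre p q),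
        @m₂ ⟨x.as.fst, x.as.snd⟩ ⟨y.as.fst, y.as.snd⟩ p q (Quot.mk _ η) =
          @m₂' ⟨x.as.fst, x.as.snd⟩ ⟨y.as.fst, y.as.snd⟩ p q (Quot.mk _ η) := by
      intro x y p q η
      induction η with
      | @id x y p =>
        exact (@f₁ ⟨x.as.fst, x.as.snd⟩ ⟨y.as.fst, y.as.snd⟩ p).trans
          (@f₁' ⟨x.as.fst, x.as.snd⟩ ⟨y.as.fst, y.as.snd⟩ p).symm
      | @comp x y p q r η θ h₁ h₂ =>
        refine (@f₂ ⟨x.as.fst, x.as.snd⟩ ⟨y.as.fst, y.as.snd⟩ p q r (Quot.mk _ η)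
          (Quot.mk _ θ)).trans (Eq.trans ?_ (@f₂' ⟨x.as.fst, x.as.snd⟩ ⟨y.as.fst, y.as.snd⟩ p q r
            (Quot.mk _ η) (Quot.mk _ θ)).symm)
        exact congrArg₂ _ h₁ h₂
      | @wL x y z p q q' η h =>
        refine (@hFL ⟨x.as.fst, x.as.snd⟩ ⟨y.as.fst, y.as.snd⟩ ⟨z.as.fst, z.as.snd⟩ p q q'
          (Quot.mk _ η)).trans (Eq.trans ?_ (@hGL ⟨x.as.fst, x.as.snd⟩ ⟨y.as.fst, y.as.snd⟩
            ⟨z.as.fst, z.as.snd⟩ p q q' (Quot.mk _ η)).symm)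
        rw [h]
      | @wR x y z p p' η q h =>
        refine (@hFR ⟨x.as.fst, x.as.snd⟩ ⟨y.as.fst, y.as.snd⟩ ⟨z.as.fst, z.as.snd⟩ p p'
          (Quot.mk _ η) q).trans (Eq.trans ?_ (@hGR ⟨x.as.fst, x.as.snd⟩ ⟨y.as.fst, y.as.snd⟩
            ⟨z.as.fst, z.as.snd⟩ p p' (Quot.mk _ η) q).symm)
        rw [h]
      | left α b => exact eq_of_heq (hl₂ α b)
      | right a β => exact eq_of_heq (hr₂ a β)
      | sigInv f g => exact hs' f g
      | @sig a a' b b' f g =>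
        -- functors that agree on the inverse of an isomorphism agree on the isomorphism
        have e : ∀ {x y : GrayTensor A B} {p q : x ⟶ y} (i : p ≅ q), m₂ i.inv = m₂' i.inv →
            m₂ i.hom = m₂' i.hom := by
          intro x y p q i h
          have h₁ : m₂ i.hom ≫ m₂ i.inv = 𝟙 _ := by rw [← f₂, i.hom_inv_id, f₁]
          have h₂ : m₂' i.inv ≫ m₂' i.hom = 𝟙 _ := by rw [← f₂', i.inv_hom_id, f₁']
          rw [← Category.comp_id (m₂ i.hom), ← h₂, ← h, reassoc_of% h₁]
        exact e (S f g) (hs' f g)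
    exact key η
  rfl

end GrayTensor

/-! ### 2-functors out of the Gray tensor product from generators -/

namespace Gray

/-- The data of a 2-functor `A ⊗ B → C` in terms of generators and relations: the images `l`, `r` of
the generating 1-cells, `l₂`, `r₂`, `s` of the generating 2-cells, and the defining relations. The
equations between 2-cells with different sources or targets are stated with `eqToHom`. -/
structure GenData (A B : Type u) [Bicategory.{w, v} A] [Bicategory.{w, v} B] (C : Type u₁)
    [Bicategory.{w₁, v₁} C] [Strict C] where
  /-- the image of `x` -/
  obj : Cat₁ A B → C
  /-- the image of `f ⊗ 1` -/
  l {a a' : A} (f : a ⟶ a') (b : B) : obj (tens a b) ⟶ obj (tens a' b)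
  /-- the image of `1 ⊗ g` -/
  r (a : A) {b b' : B} (g : b ⟶ b') : obj (tens a b) ⟶ obj (tens a b')
  l_id (a : A) (b : B) : l (𝟙 a) b = 𝟙 (obj (tens a b))
  l_comp {a a' a'' : A} (f : a ⟶ a') (f' : a' ⟶ a'') (b : B) : l (f ≫ f') b = l f b ≫ l f' b
  r_id (a : A) (b : B) : r a (𝟙 b) = 𝟙 (obj (tens a b))
  r_comp (a : A) {b b' b'' : B} (g : b ⟶ b') (g' : b' ⟶ b'') : r a (g ≫ g') = r a g ≫ r a g'
  /-- the image of `α ⊗ 1` -/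
  l₂ {a a' : A} {f f' : a ⟶ a'} (α : f ⟶ f') (b : B) : l f b ⟶ l f' b
  /-- the image of `1 ⊗ β` -/
  r₂ (a : A) {b b' : B} {g g' : b ⟶ b'} (β : g ⟶ g') : r a g ⟶ r a g'
  /-- the image of `Σ_{f,g}` -/
  s {a a' : A} {b b' : B} (f : a ⟶ a') (g : b ⟶ b') : r a g ≫ l f b' ≅ l f b ≫ r a' g
  l₂_id {a a' : A} (f : a ⟶ a') (b : B) : l₂ (𝟙 f) b = 𝟙 (l f b)
  l₂_comp {a a' : A} {f f' f'' : a ⟶ a'} (α : f ⟶ f') (α' : f' ⟶ f'') (b : B) :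
    l₂ (α ≫ α') b = l₂ α b ≫ l₂ α' b
  l₂_wL {a a' a'' : A} (f : a ⟶ a') {h h' : a' ⟶ a''} (α : h ⟶ h') (b : B) :
    l₂ (f ◁ α) b = eqToHom (l_comp f h b) ≫ l f b ◁ l₂ α b ≫ eqToHom (l_comp f h' b).symm
  l₂_wR {a a' a'' : A} {f f' : a ⟶ a'} (α : f ⟶ f') (h : a' ⟶ a'') (b : B) :
    l₂ (α ▷ h) b = eqToHom (l_comp f h b) ≫ l₂ α b ▷ l h b ≫ eqToHom (l_comp f' h b).symm
  r₂_id (a : A) {b b' : B} (g : b ⟶ b') : r₂ a (𝟙 g) = 𝟙 (r a g)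
  r₂_comp (a : A) {b b' : B} {g g' g'' : b ⟶ b'} (β : g ⟶ g') (β' : g' ⟶ g'') :
    r₂ a (β ≫ β') = r₂ a β ≫ r₂ a β'
  r₂_wL (a : A) {b b' b'' : B} (g : b ⟶ b') {h h' : b' ⟶ b''} (β : h ⟶ h') :
    r₂ a (g ◁ β) = eqToHom (r_comp a g h) ≫ r a g ◁ r₂ a β ≫ eqToHom (r_comp a g h').symm
  r₂_wR (a : A) {b b' b'' : B} {g g' : b ⟶ b'} (β : g ⟶ g') (h : b' ⟶ b'') :
    r₂ a (β ▷ h) = eqToHom (r_comp a g h) ≫ r₂ a β ▷ r a h ≫ eqToHom (r_comp a g' h).symm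
  s_left {a a' : A} {b b' : B} {f f' : a ⟶ a'} (α : f ⟶ f') (g : b ⟶ b') :
    r a g ◁ l₂ α b' ≫ (s f' g).hom = (s f g).hom ≫ l₂ α b ▷ r a' g
  s_right {a a' : A} {b b' : B} (f : a ⟶ a') {g g' : b ⟶ b'} (β : g ⟶ g') :
    r₂ a β ▷ l f b' ≫ (s f g').hom = (s f g).hom ≫ l f b ◁ r₂ a' β
  s_id_left (a : A) {b b' : B} (g : b ⟶ b') :
    (s (𝟙 a) g).hom = eqToHom (by rw [l_id, l_id, Strict.id_comp, Strict.comp_id])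
  s_id_right {a a' : A} (f : a ⟶ a') (b : B) :
    (s f (𝟙 b)).hom = eqToHom (by rw [r_id, r_id, Strict.id_comp, Strict.comp_id])
  s_comp_left {a a' a'' : A} {b b' : B} (f : a ⟶ a') (f' : a' ⟶ a'') (g : b ⟶ b') :
    (s (f ≫ f') g).hom = eqToHom (by rw [l_comp, Strict.assoc]) ≫
      (s f g).hom ▷ l f' b' ≫ eqToHom (Strict.assoc _ _ _) ≫ l f b ◁ (s f' g).hom ≫
      eqToHom (by rw [l_comp, Strict.assoc])
  s_comp_right {a a' : A} {b b' b'' : B} (f : a ⟶ a') (g : b ⟶ b') (g' : b' ⟶ b'') :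
    (s f (g ≫ g')).hom = eqToHom (by rw [r_comp, Strict.assoc]) ≫
      r a g ◁ (s f g').hom ≫ eqToHom (Strict.assoc _ _ _).symm ≫ (s f g).hom ▷ r a' g' ≫
      eqToHom (by rw [r_comp, Strict.assoc])

namespace GenData

variable {A B : Type u} [Bicategory.{w, v} A] [Bicategory.{w, v} B] {C : Type u₁}
    [Bicategory.{w₁, v₁} C] [Strict C] (D : GenData A B C)

/-- The effect on 1-cells of the 2-functor determined by its values on generators. -/
def map₁ : Cat₁ A B ⥤ C :=
  lift₁ D.obj D.l D.r D.l_id D.l_comp D.r_id D.r_comp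

/-- The value on a 1-cell of the 2-functor determined by its values on generators. -/
def map {x y : Cat₁ A B} (p : x ⟶ y) : D.obj x ⟶ D.obj y :=
  D.map₁.map p

theorem map_inl {a a' : A} (f : a ⟶ a') (b : B) : D.map (inl f b) = D.l f b :=
  lift₁_inl ..

theorem map_inr (a : A) {b b' : B} (g : b ⟶ b') : D.map (inr a g) = D.r a g :=
  lift₁_inr ..

theorem map_id (x : Cat₁ A B) : D.map (𝟙 x) = 𝟙 (D.obj x) :=
  D.map₁.map_id x

theorem map_comp {x y z : Cat₁ A B} (p : x ⟶ y) (q : y ⟶ z) :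
    D.map (p ≫ q) = D.map p ≫ D.map q :=
  D.map₁.map_comp p q

theorem map_inr_inl {a a' : A} {b b' : B} (f : a ⟶ a') (g : b ⟶ b') :
    D.map (inr a g ≫ inl f b') = D.r a g ≫ D.l f b' := by
  rw [map_comp, map_inl, map_inr]

theorem map_inl_inr {a a' : A} {b b' : B} (f : a ⟶ a') (g : b ⟶ b') :
    D.map (inl f b ≫ inr a' g) = D.l f b ≫ D.r a' g := by
  rw [map_comp, map_inl, map_inr]

/-- The interpretation in `C` of the formal expressions for 2-cells of `A ⊗ B`. -/
def pre : {x y : Cat₁ A B} → {p q : x ⟶ y} → Pre p q → (D.map p ⟶ D.map q)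
  | _, _, _, _, Pre.id p => 𝟙 (D.map p)
  | _, _, _, _, Pre.comp η θ => pre η ≫ pre θ
  | _, _, _, _, Pre.wL p η =>
      eqToHom (D.map_comp _ _) ≫ D.map p ◁ pre η ≫ eqToHom (D.map_comp _ _).symm
  | _, _, _, _, Pre.wR η q =>
      eqToHom (D.map_comp _ _) ≫ pre η ▷ D.map q ≫ eqToHom (D.map_comp _ _).symm
  | _, _, _, _, Pre.left α b =>
      eqToHom (D.map_inl _ _) ≫ D.l₂ α b ≫ eqToHom (D.map_inl _ _).symm
  | _, _, _, _, Pre.right a β =>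
      eqToHom (D.map_inr _ _) ≫ D.r₂ a β ≫ eqToHom (D.map_inr _ _).symm
  | _, _, _, _, Pre.sig f g =>
      eqToHom (D.map_inr_inl _ _) ≫ (D.s f g).hom ≫ eqToHom (D.map_inl_inr _ _).symm
  | _, _, _, _, Pre.sigInv f g =>
      eqToHom (D.map_inl_inr _ _) ≫ (D.s f g).inv ≫ eqToHom (D.map_inr_inl _ _).symm

theorem pre_ofEq {x y : Cat₁ A B} {p q : x ⟶ y} (h : p = q) :
    D.pre (Pre.ofEq h) = eqToHom (congrArg (fun r => D.map r) h) := by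
  subst h; rfl

theorem pre_sound {x y : Cat₁ A B} {p q : x ⟶ y} {η θ : Pre p q} (h : Rel₂ η θ) :
    D.pre η = D.pre θ := by
  induction h with
  | comp_left θ _ ih => simp only [pre, ih]
  | comp_right η _ ih => simp only [pre, ih]
  | wL p _ ih => simp only [pre, ih]
  | wR q _ ih => simp only [pre, ih]
  | id_comp η => exact Category.id_comp _
  | comp_id η => exact Category.comp_id _
  | assoc η θ κ => exact Category.assoc _ _ _
  | wL_id p q => simp [pre]
  | wL_comp p η θ => simp [pre]
  | id_wR p q => simp [pre]
  | comp_wR η θ q => simp [pre]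
  | id_wL η =>
    simp [pre, pre_ofEq, congr_whiskerLeft (D.map_id _), Strict.leftUnitor_eqToIso]
  | wR_id η =>
    simp [pre, pre_ofEq, whiskerRight_congr (D.map_id _), Strict.rightUnitor_eqToIso]
  | wL_wL p q η =>
    simp [pre, pre_ofEq, congr_whiskerLeft (D.map_comp p q), Strict.associator_eqToIso]
  | wR_wR η q r =>
    simp [pre, pre_ofEq, whiskerRight_congr (D.map_comp q r), Strict.associator_eqToIso]
  | wL_wR p η r =>
    simp [pre, pre_ofEq, Strict.associator_eqToIso]
  | exchange η θ => simp [pre, whisker_exchange_assoc]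
  | left_id f b => simp [pre, D.l₂_id]
  | left_comp α α' b => simp [pre, D.l₂_comp]
  | left_wL f α b =>
    simp [pre, pre_ofEq, D.l₂_wL, congr_whiskerLeft (D.map_inl f b)]
  | left_wR α h b =>
    simp [pre, pre_ofEq, D.l₂_wR, whiskerRight_congr (D.map_inl h b)]
  | right_id a g => simp [pre, D.r₂_id]
  | right_comp a β β' => simp [pre, D.r₂_comp]
  | right_wL a g β =>
    simp [pre, pre_ofEq, D.r₂_wL, congr_whiskerLeft (D.map_inr a g)]
  | right_wR a β h =>
    simp [pre, pre_ofEq, D.r₂_wR, whiskerRight_congr (D.map_inr a h)]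
  | sig_inv f g => simp [pre]
  | inv_sig f g => simp [pre]
  | sig_left α g =>
    simp [pre, congr_whiskerLeft (D.map_inr _ g), whiskerRight_congr (D.map_inr _ g),
      reassoc_of% (D.s_left α g)]
  | sig_right f β =>
    simp [pre, congr_whiskerLeft (D.map_inl f _), whiskerRight_congr (D.map_inl f _),
      reassoc_of% (D.s_right f β)]
  | sig_id_left a g => simp [pre, pre_ofEq, D.s_id_left]
  | sig_id_right f b => simp [pre, pre_ofEq, D.s_id_right]
  | sig_comp_left f f' g =>
    simp [pre, pre_ofEq, D.s_comp_left, congr_whiskerLeft (D.map_inl f _),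
      whiskerRight_congr (D.map_inl f' _)]
  | sig_comp_right f g g' =>
    simp [pre, pre_ofEq, D.s_comp_right, congr_whiskerLeft (D.map_inr _ g),
      whiskerRight_congr (D.map_inr _ g')]

/-- The 2-functor `A ⊗ B → C` determined by its values on generators. -/
def functor : StrictPseudofunctor (GrayTensor A B) C :=
  StrictPseudofunctor.mk''
    { obj := fun x => D.obj (tens x.fst x.snd)
      map := fun {x y} p => D.map (x := tens x.fst x.snd) (y := tens y.fst y.snd) p
      map₂ := fun {x y p q} => Quot.lift D.pre (fun _ _ h => D.pre_sound h)
      map₂_id := fun _ => rfl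
      map₂_comp := by rintro _ _ _ _ _ ⟨η⟩ ⟨θ⟩; rfl
      map_id := fun x => D.map_id (tens x.fst x.snd)
      map_comp := fun p q => D.map_comp p q
      map₂_whisker_left := by rintro _ _ _ p _ _ ⟨η⟩; rfl
      map₂_whisker_right := by rintro _ _ _ _ _ ⟨η⟩ q; rfl }

end GenData

end Gray

/-! ### The projection from the Gray tensor product to the product -/

section Prod

variable {A : Type u₁} [Bicategory.{w₁, v₁} A] {B : Type u₂} [Bicategory.{w₂, v₂} B]

/-- The 1-cell `(f, g)` of a product of bicategories. -/
abbrev prodHom {a a' : A} {b b' : B} (f : a ⟶ a') (g : b ⟶ b') : (a, b) ⟶ (a', b') := (f, g)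

/-- The 2-cell `(α, β)` of a product of bicategories. -/
abbrev prodHom₂ {a a' : A} {b b' : B} {f f' : a ⟶ a'} {g g' : b ⟶ b'} (α : f ⟶ f') (β : g ⟶ g') :
    prodHom f g ⟶ prodHom f' g' := (α, β)

theorem prodHom_swap [Strict A] [Strict B] {a a' : A} {b b' : B} (f : a ⟶ a') (g : b ⟶ b') :
    prodHom (𝟙 a) g ≫ prodHom f (𝟙 b') = prodHom f (𝟙 b) ≫ prodHom (𝟙 a') g :=
  Prod.ext ((Strict.id_comp f).trans (Strict.comp_id f).symm)
    ((Strict.comp_id g).trans (Strict.id_comp g).symm)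

theorem prod_eq_conj {x y : A × B} {p p' q q' : x ⟶ y} (hp : p = p') (hq : q' = q)
    {η : p ⟶ q} {θ : p' ⟶ q'} (h₁ : HEq η.1 θ.1) (h₂ : HEq η.2 θ.2) :
    η = eqToHom hp ≫ θ ≫ eqToHom hq := by
  subst hp hq
  simp only [eqToHom_refl, Category.comp_id, Category.id_comp]
  exact Prod.ext (eq_of_heq h₁) (eq_of_heq h₂)

theorem prod_comp_eqToHom {x y : A × B} {p p' q q' : x ⟶ y} (hp : p = p') (hq : q = q')
    {η : p ⟶ q} {θ : p' ⟶ q'} (h₁ : HEq η.1 θ.1) (h₂ : HEq η.2 θ.2) :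
    η ≫ eqToHom hq = eqToHom hp ≫ θ := by
  subst hp hq
  simp only [eqToHom_refl, Category.comp_id, Category.id_comp]
  exact Prod.ext (eq_of_heq h₁) (eq_of_heq h₂)

theorem id_whiskerLeft_heq [Strict A] {a b : A} {f g : a ⟶ b} (η : f ⟶ g) :
    HEq (𝟙 a ◁ η) η := by
  rw [id_whiskerLeft, Strict.leftUnitor_eqToIso, Strict.leftUnitor_eqToIso]
  exact (conj_eqToHom_iff_heq _ _ (Strict.id_comp f) (Strict.id_comp g)).mp rfl

theorem whiskerRight_id_heq [Strict A] {a b : A} {f g : a ⟶ b} (η : f ⟶ g) :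
    HEq (η ▷ 𝟙 b) η := by
  rw [whiskerRight_id, Strict.rightUnitor_eqToIso, Strict.rightUnitor_eqToIso]
  exact (conj_eqToHom_iff_heq _ _ (Strict.comp_id f) (Strict.comp_id g)).mp rfl

theorem whisker_id_heq [Strict A] {a b : A} (f : a ⟶ b) :
    HEq (f ◁ 𝟙 (𝟙 b)) (𝟙 (𝟙 a) ▷ f) := by
  rw [whiskerLeft_id, id_whiskerRight, Strict.comp_id, Strict.id_comp]

theorem eqToHom_whiskerRight_whiskerLeft {a b d e : A} {p q : a ⟶ e} {f f' : a ⟶ b} {k : b ⟶ e}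
    {g g' : d ⟶ e} {m : a ⟶ d} (h : p = q) (h₁ : p = f ≫ k) (h₂ : f = f') (h₃ : f' ≫ k = m ≫ g)
    (h₄ : g = g') (h₅ : m ≫ g' = q) :
    eqToHom h = eqToHom h₁ ≫ eqToHom h₂ ▷ k ≫ eqToHom h₃ ≫ m ◁ eqToHom h₄ ≫ eqToHom h₅ := by
  simp

theorem eqToHom_whiskerLeft_whiskerRight {a b d e : A} {p q : a ⟶ e} {f f' : a ⟶ b} {k : b ⟶ e}
    {g g' : d ⟶ e} {m : a ⟶ d} (h : p = q) (h₁ : p = m ≫ g) (h₂ : f = f') (h₃ : m ≫ g' = f ≫ k)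
    (h₄ : g = g') (h₅ : f' ≫ k = q) :
    eqToHom h = eqToHom h₁ ≫ m ◁ eqToHom h₄ ≫ eqToHom h₃ ≫ eqToHom h₂ ▷ k ≫ eqToHom h₅ := by
  simp

end Prod

namespace GrayTensor

open Gray

variable (A B : Type u) [Bicategory.{w, v} A] [Bicategory.{w, v} B] [Strict A] [Strict B]

/-- The values on generators of the projection `A ⊗ B → A × B`: the 2-cells `Σ_{f,g}` are sent to
identities. -/
def projData : GenData A B (A × B) where
  obj x := (x.as.fst, x.as.snd)
  l f b := (f, 𝟙 b)
  r a _ _ g := (𝟙 a, g)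
  l_id _ _ := rfl
  l_comp _ _ b := Prod.ext rfl (Strict.comp_id (𝟙 b)).symm
  r_id _ _ := rfl
  r_comp a _ _ _ _ _ := Prod.ext (Strict.comp_id (𝟙 a)).symm rfl
  l₂ α b := (α, 𝟙 (𝟙 b))
  r₂ a _ _ _ _ β := (𝟙 (𝟙 a), β)
  s f g := eqToIso (prodHom_swap f g)
  l₂_id _ _ := rfl
  l₂_comp _ _ _ := Prod.ext rfl (Category.comp_id _).symm
  l₂_wL _ _ _ _ b := prod_eq_conj _ _ HEq.rfl (id_whiskerLeft_heq (𝟙 (𝟙 b))).symm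
  l₂_wR _ _ b := prod_eq_conj _ _ HEq.rfl (whiskerRight_id_heq (𝟙 (𝟙 b))).symm
  r₂_id _ _ _ _ := rfl
  r₂_comp _ _ _ _ _ _ _ _ := Prod.ext (Category.comp_id _).symm rfl
  r₂_wL a _ _ _ _ _ _ _ := prod_eq_conj _ _ (id_whiskerLeft_heq (𝟙 (𝟙 a))).symm HEq.rfl
  r₂_wR a _ _ _ _ _ _ _ := prod_eq_conj _ _ (whiskerRight_id_heq (𝟙 (𝟙 a))).symm HEq.rfl
  s_left α g := prod_comp_eqToHom (prodHom_swap _ g) (prodHom_swap _ g)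
    ((id_whiskerLeft_heq α).trans (whiskerRight_id_heq α).symm) (whisker_id_heq g)
  s_right f _ _ β := prod_comp_eqToHom (prodHom_swap f _) (prodHom_swap f _)
    (whisker_id_heq f).symm ((whiskerRight_id_heq β).trans (id_whiskerLeft_heq β).symm)
  s_id_left _ _ _ _ := rfl
  s_id_right _ _ := rfl
  s_comp_left f f' g := eqToHom_whiskerRight_whiskerLeft (prodHom_swap (f ≫ f') g) _
    (prodHom_swap f g) _ (prodHom_swap f' g) _
  s_comp_right f g g' := eqToHom_whiskerLeft_whiskerRight (prodHom_swap f (g ≫ g')) _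
    (prodHom_swap f g) _ (prodHom_swap f g') _

/-- The projection 2-functor `A ⊗ B → A × B`. -/
def proj : StrictPseudofunctor (GrayTensor A B) (A × B) :=
  (projData A B).functor

variable {A B}

theorem proj_map_L {a a' : A} (f : a ⟶ a') (b : B) : (proj A B).map (L f b) = prodHom f (𝟙 b) :=
  (projData A B).map_inl f b

theorem proj_map_R (a : A) {b b' : B} (g : b ⟶ b') : (proj A B).map (R a g) = prodHom (𝟙 a) g :=
  (projData A B).map_inr a g

theorem proj_map₂_L₂ {a a' : A} {f f' : a ⟶ a'} (α : f ⟶ f') (b : B) :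
    (proj A B).map₂ (L₂ α b) = eqToHom (proj_map_L f b) ≫
      prodHom₂ α (𝟙 (𝟙 b)) ≫ eqToHom (proj_map_L f' b).symm :=
  rfl

theorem proj_map₂_R₂ (a : A) {b b' : B} {g g' : b ⟶ b'} (β : g ⟶ g') :
    (proj A B).map₂ (R₂ a β) = eqToHom (proj_map_R a g) ≫
      prodHom₂ (𝟙 (𝟙 a)) β ≫ eqToHom (proj_map_R a g').symm :=
  rfl

theorem proj_map_S {a a' : A} {b b' : B} (f : a ⟶ a') (g : b ⟶ b') :
    (proj A B).map (L f b ≫ R a' g) = (proj A B).map (R a g ≫ L f b') := by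
  rw [(proj A B).map_comp, (proj A B).map_comp]
  erw [proj_map_L, proj_map_R, proj_map_L, proj_map_R]
  exact (prodHom_swap f g).symm

theorem proj_map₂_S_inv {a a' : A} {b b' : B} (f : a ⟶ a') (g : b ⟶ b') :
    (proj A B).map₂ (S f g).inv = eqToHom (proj_map_S f g) := by
  have key : ∀ {x y : A × B} {p q r s : x ⟶ y} (h₁ : p = q) (h₂ : r = q) (h₃ : r = s)
      (h₄ : p = s), eqToHom h₁ ≫ (eqToIso h₂).inv ≫ eqToHom h₃ = eqToHom h₄ := by
    intros; simp
  exact key ((projData A B).map_inl_inr f g) (prodHom_swap f g)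
    ((projData A B).map_inr_inl f g).symm (proj_map_S f g)

end GrayTensor

/-! ### Strict models of functors out of the Gray tensor product -/

namespace GrayTensor

open Gray

variable {A B : Type u} [Bicategory.{w, v} A] [Bicategory.{w, v} B]
  {E : Type u₁} [Bicategory.{w₁, v₁} E]

/-- The category whose objects are those of `A ⊗ B`, and whose morphisms are the 1-cells `p` of
`A ⊗ B` together with a 1-cell of `E` isomorphic to the image of `p` under `G`. A functor from the
category of 1-cells of `A ⊗ B` which is a section of the projection is a coherent choice of
1-cells isomorphic to the values of `G`. -/
structure Replacement (G : GrayTensor A B ⥤ᵖ E) where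
  /-- the underlying object -/
  pt : GrayTensor A B

namespace Replacement

variable {G : GrayTensor A B ⥤ᵖ E}

/-- A 1-cell of `A ⊗ B` with a 1-cell isomorphic to its image. -/
structure Hom (x y : Replacement G) where
  /-- the 1-cell of `A ⊗ B` -/
  src : x.pt ⟶ y.pt
  /-- the 1-cell of `E` -/
  dst : G.obj x.pt ⟶ G.obj y.pt
  /-- the comparison -/
  iso : dst ≅ G.map src

/-- Equality of morphisms of `Replacement G`, with the two comparisons related by the `eqToHom` of
the equalities of their sources and targets. -/
theorem Hom.ext' {x y : Replacement G} {s t : Hom x y} (h₁ : s.src = t.src) (h₂ : s.dst = t.dst)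
    (h : s.iso.hom ≫ G.map₂ (eqToHom h₁) = eqToHom h₂ ≫ t.iso.hom) : s = t := by
  obtain ⟨p, q, i⟩ := s
  obtain ⟨p', q', i'⟩ := t
  dsimp only at h₁ h₂
  subst h₁ h₂
  obtain rfl : i = i' := by
    ext
    simpa using h
  rfl

variable [Strict E]

/-- The 1-cells compose strictly in both components, and the comparisons compose through the
constraints of `G`. The coherence axioms of `G` give the axioms of a category. -/
instance : Category (Replacement G) where
  Hom := Hom
  id x := ⟨𝟙 x.pt, 𝟙 (G.obj x.pt), (G.mapId x.pt).symm⟩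
  comp s t := ⟨s.src ≫ t.src, s.dst ≫ t.dst, whiskerRightIso s.iso t.dst ≪≫
    whiskerLeftIso (G.map s.src) t.iso ≪≫ (G.mapComp s.src t.src).symm⟩
  id_comp s := by
    refine Hom.ext' (id_comp' s.src) (Strict.id_comp s.dst) ?_
    have e : eqToHom (id_comp' s.src) = (λ_ s.src).hom := by
      rw [Strict.leftUnitor_eqToIso]; rfl
    have e' : eqToHom (Strict.id_comp s.dst) = (λ_ s.dst).hom := by
      rw [Strict.leftUnitor_eqToIso]; rfl
    rw [e, e']
    simp [← whisker_exchange_assoc]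
  comp_id s := by
    refine Hom.ext' (comp_id' s.src) (Strict.comp_id s.dst) ?_
    have e : eqToHom (comp_id' s.src) = (ρ_ s.src).hom := by
      rw [Strict.rightUnitor_eqToIso]; rfl
    have e' : eqToHom (Strict.comp_id s.dst) = (ρ_ s.dst).hom := by
      rw [Strict.rightUnitor_eqToIso]; rfl
    rw [e, e']
    simp
  assoc s t r := by
    refine Hom.ext' (assoc' s.src t.src r.src) (Strict.assoc s.dst t.dst r.dst) ?_
    have e : eqToHom (assoc' s.src t.src r.src) = (α_ s.src t.src r.src).hom := by
      rw [Strict.associator_eqToIso]; rfl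
    have e' : eqToHom (Strict.assoc s.dst t.dst r.dst) = (α_ s.dst t.dst r.dst).hom := by
      rw [Strict.associator_eqToIso]; rfl
    rw [e, e']
    simp [whisker_exchange_assoc]

theorem comp_src {x y z : Replacement G} (s : x ⟶ y) (t : y ⟶ z) :
    (s ≫ t).src = s.src ≫ t.src := rfl

/-- The comparison of a morphism with the image of a 1-cell equal to its first component. -/
def isoAt {x y : Replacement G} (s : x ⟶ y) {p : x.pt ⟶ y.pt} (h : s.src = p) :
    s.dst ≅ G.map p :=
  s.iso ≪≫ G.map₂Iso (eqToIso h)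

theorem isoAt_congr {x y : Replacement G} {s t : x ⟶ y} (e : s = t) {p : x.pt ⟶ y.pt}
    (h : s.src = p) (h' : t.src = p) :
    (isoAt s h).hom = eqToHom (congrArg Hom.dst e) ≫ (isoAt t h').hom := by
  subst e; simp

theorem isoAt_rfl {x y : Replacement G} (s : x ⟶ y) : (isoAt s rfl).hom = s.iso.hom :=
  (congrArg (s.iso.hom ≫ ·) (G.map₂_id s.src)).trans (Category.comp_id _)

theorem isoAt_id (x : Replacement G) (h : (𝟙 x : x ⟶ x).src = 𝟙 x.pt) :
    (isoAt (𝟙 x) h).hom = (G.mapId x.pt).inv :=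
  isoAt_rfl (𝟙 x)

theorem isoAt_comp {x y z : Replacement G} (s : x ⟶ y) (t : y ⟶ z) {p : x.pt ⟶ y.pt}
    {q : y.pt ⟶ z.pt} (h₁ : s.src = p) (h₂ : t.src = q) (h : (s ≫ t).src = p ≫ q) :
    (isoAt (s ≫ t) h).hom = (isoAt s h₁).hom ▷ t.dst ≫ G.map p ◁ (isoAt t h₂).hom ≫
      (G.mapComp p q).inv := by
  subst h₁ h₂
  rw [isoAt_rfl s, isoAt_rfl t]
  exact isoAt_rfl (s ≫ t)

end Replacement

/-- The values on generators of a strict model of a functor `G` out of `A ⊗ B`. -/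
structure GenModel (G : GrayTensor A B ⥤ᵖ E) where
  /-- the value on `f ⊗ 1` -/
  l {a a' : A} (f : a ⟶ a') (b : B) : G.obj ⟨a, b⟩ ⟶ G.obj ⟨a', b⟩
  /-- the value on `1 ⊗ g` -/
  r (a : A) {b b' : B} (g : b ⟶ b') : G.obj ⟨a, b⟩ ⟶ G.obj ⟨a, b'⟩
  l_id (a : A) (b : B) : l (𝟙 a) b = 𝟙 (G.obj ⟨a, b⟩)
  l_comp {a a' a'' : A} (f : a ⟶ a') (f' : a' ⟶ a'') (b : B) : l (f ≫ f') b = l f b ≫ l f' b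
  r_id (a : A) (b : B) : r a (𝟙 b) = 𝟙 (G.obj ⟨a, b⟩)
  r_comp (a : A) {b b' b'' : B} (g : b ⟶ b') (g' : b' ⟶ b'') : r a (g ≫ g') = r a g ≫ r a g'
  /-- the comparison at `f ⊗ 1` -/
  lIso {a a' : A} (f : a ⟶ a') (b : B) : l f b ≅ G.map (L f b)
  /-- the comparison at `1 ⊗ g` -/
  rIso (a : A) {b b' : B} (g : b ⟶ b') : r a g ≅ G.map (R a g)
  lIso_id (a : A) (b : B) : (lIso (𝟙 a) b).hom ≫ G.map₂ (eqToHom (L_id a b)) =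
    eqToHom (l_id a b) ≫ (G.mapId ⟨a, b⟩).inv
  lIso_comp {a a' a'' : A} (f : a ⟶ a') (f' : a' ⟶ a'') (b : B) :
    (lIso (f ≫ f') b).hom ≫ G.map₂ (eqToHom (L_comp f f' b)) = eqToHom (l_comp f f' b) ≫
      (lIso f b).hom ▷ l f' b ≫ G.map (L f b) ◁ (lIso f' b).hom ≫ (G.mapComp _ _).inv
  rIso_id (a : A) (b : B) : (rIso a (𝟙 b)).hom ≫ G.map₂ (eqToHom (R_id a b)) =
    eqToHom (r_id a b) ≫ (G.mapId ⟨a, b⟩).inv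
  rIso_comp (a : A) {b b' b'' : B} (g : b ⟶ b') (g' : b' ⟶ b'') :
    (rIso a (g ≫ g')).hom ≫ G.map₂ (eqToHom (R_comp a g g')) = eqToHom (r_comp a g g') ≫
      (rIso a g).hom ▷ r a g' ≫ G.map (R a g) ◁ (rIso a g').hom ≫ (G.mapComp _ _).inv

namespace GenModel

variable {G : GrayTensor A B ⥤ᵖ E} [Strict E] (M : GenModel G)

/-- The object of `Replacement G` at an object of the category of 1-cells of `A ⊗ B`. -/
def pt (G : GrayTensor A B ⥤ᵖ E) (x : Cat₁ A B) : Replacement G := ⟨⟨x.as.fst, x.as.snd⟩⟩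

/-- The value on `f ⊗ 1`, as a morphism of `Replacement G`. -/
def left {a a' : A} (f : a ⟶ a') (b : B) : pt G (tens a b) ⟶ pt G (tens a' b) :=
  Replacement.Hom.mk (L f b) (M.l f b) (M.lIso f b)

/-- The value on `1 ⊗ g`, as a morphism of `Replacement G`. -/
def right (a : A) {b b' : B} (g : b ⟶ b') : pt G (tens a b) ⟶ pt G (tens a b') :=
  Replacement.Hom.mk (R a g) (M.r a g) (M.rIso a g)

theorem left_id (a : A) (b : B) : M.left (𝟙 a) b = 𝟙 (pt G (tens a b)) :=
  Replacement.Hom.ext' (L_id a b) (M.l_id a b) (M.lIso_id a b)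

theorem left_comp {a a' a'' : A} (f : a ⟶ a') (f' : a' ⟶ a'') (b : B) :
    M.left (f ≫ f') b = M.left f b ≫ M.left f' b :=
  Replacement.Hom.ext' (L_comp f f' b) (M.l_comp f f' b) (M.lIso_comp f f' b)

theorem right_id (a : A) (b : B) : M.right a (𝟙 b) = 𝟙 (pt G (tens a b)) :=
  Replacement.Hom.ext' (R_id a b) (M.r_id a b) (M.rIso_id a b)

theorem right_comp (a : A) {b b' b'' : B} (g : b ⟶ b') (g' : b' ⟶ b'') :
    M.right a (g ≫ g') = M.right a g ≫ M.right a g' :=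
  Replacement.Hom.ext' (R_comp a g g') (M.r_comp a g g') (M.rIso_comp a g g')

/-- The coherent choice of 1-cells determined by the values on generators. -/
def section₁ : Cat₁ A B ⥤ Replacement G :=
  lift₁ (pt G) M.left M.right M.left_id M.left_comp M.right_id M.right_comp

/-- The value of `section₁` at a 1-cell of `A ⊗ B`. -/
def val {x y : GrayTensor A B} (p : x ⟶ y) : Replacement.mk (G := G) x ⟶ Replacement.mk y :=
  M.section₁.map (X := tens x.fst x.snd) (Y := tens y.fst y.snd) p

theorem val_id (x : GrayTensor A B) : M.val (𝟙 x) = 𝟙 _ :=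
  M.section₁.map_id (tens x.fst x.snd)

theorem val_comp {x y z : GrayTensor A B} (p : x ⟶ y) (q : y ⟶ z) :
    M.val (p ≫ q) = M.val p ≫ M.val q :=
  M.section₁.map_comp (X := tens x.fst x.snd) (Y := tens y.fst y.snd) (Z := tens z.fst z.snd) p q

theorem val_L {a a' : A} (f : a ⟶ a') (b : B) :
    M.val (L f b) = Replacement.Hom.mk (L f b) (M.l f b) (M.lIso f b) :=
  lift₁_inl (pt G) M.left M.right M.left_id M.left_comp M.right_id M.right_comp f b

theorem val_R (a : A) {b b' : B} (g : b ⟶ b') :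
    M.val (R a g) = Replacement.Hom.mk (R a g) (M.r a g) (M.rIso a g) :=
  lift₁_inr (pt G) M.left M.right M.left_id M.left_comp M.right_id M.right_comp a g

/-- The functor `section₁` is a section of the projection to 1-cells of `A ⊗ B`, since this holds on
generators. -/
theorem val_src {x y : GrayTensor A B} (p : x ⟶ y) : (M.val p).src = p := by
  have key : ∀ {x y z : GrayTensor A B} {s s' : x ⟶ y} {t t' : y ⟶ z}, s = s' → t = t' →
      s ≫ t = s' ≫ t' := by
    rintro _ _ _ _ _ _ _ rfl rfl; rfl
  refine hom_induction (P := fun {x y} p =>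
    (M.val (x := ⟨x.as.fst, x.as.snd⟩) (y := ⟨y.as.fst, y.as.snd⟩) p).src = p) ?_ ?_ ?_
    (x := tens x.fst x.snd) (y := tens y.fst y.snd) p
  · intro x
    exact congrArg Replacement.Hom.src (M.val_id ⟨x.as.fst, x.as.snd⟩)
  · intro x a a' b p f h
    refine (congrArg Replacement.Hom.src
      (M.val_comp (x := ⟨x.as.fst, x.as.snd⟩) (y := ⟨a, b⟩) (z := ⟨a', b⟩) p (L f b))).trans ?_
    exact key h (congrArg Replacement.Hom.src (M.val_L f b))
  · intro x a b b' p g h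
    refine (congrArg Replacement.Hom.src
      (M.val_comp (x := ⟨x.as.fst, x.as.snd⟩) (y := ⟨a, b⟩) (z := ⟨a, b'⟩) p (R a g))).trans ?_
    exact key h (congrArg Replacement.Hom.src (M.val_R a g))

/-- The strict model of `G` determined by its values on generators. -/
def strictModel : StrictModel G where
  map p := (M.val p).dst
  map_id x := congrArg Replacement.Hom.dst (M.val_id x)
  map_comp p q := congrArg Replacement.Hom.dst (M.val_comp p q)
  iso p := Replacement.isoAt (M.val p) (M.val_src p)
  iso_id x := by
    rw [Replacement.isoAt_congr (M.val_id x) _ rfl, Replacement.isoAt_id]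
  iso_comp p q := by
    rw [Replacement.isoAt_congr (M.val_comp p q) _ ((Replacement.comp_src _ _).trans
      (congrArg₂ _ (M.val_src p) (M.val_src q))),
      Replacement.isoAt_comp _ _ (M.val_src p) (M.val_src q)]

theorem strictModel_map_L {a a' : A} (f : a ⟶ a') (b : B) :
    M.strictModel.map (L f b) = M.l f b :=
  congrArg Replacement.Hom.dst (M.val_L f b)

theorem strictModel_map_R (a : A) {b b' : B} (g : b ⟶ b') :
    M.strictModel.map (R a g) = M.r a g :=
  congrArg Replacement.Hom.dst (M.val_R a g)

theorem strictModel_iso_L {a a' : A} (f : a ⟶ a') (b : B) :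
    (M.strictModel.iso (L f b)).hom = eqToHom (M.strictModel_map_L f b) ≫ (M.lIso f b).hom :=
  (Replacement.isoAt_congr (M.val_L f b) _ rfl).trans
    (congrArg _ (Replacement.isoAt_rfl _))

theorem strictModel_iso_R (a : A) {b b' : B} (g : b ⟶ b') :
    (M.strictModel.iso (R a g)).hom = eqToHom (M.strictModel_map_R a g) ≫ (M.rIso a g).hom :=
  (Replacement.isoAt_congr (M.val_R a g) _ rfl).trans
    (congrArg _ (Replacement.isoAt_rfl _))

end GenModel

end GrayTensor

/-! ### 2-cells that are identities between equal 1-cells -/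

/-- A morphism is an `eqToHom` if it is the identity morphism of two equal objects. -/
def IsEqToHom {C : Type u₁} [Category.{v₁} C] {X Y : C} (f : X ⟶ Y) : Prop :=
  ∃ h : X = Y, f = eqToHom h

namespace IsEqToHom

section Category

variable {C : Type u₁} [Category.{v₁} C] {X Y Z : C}

theorem eqToHom (h : X = Y) : IsEqToHom (CategoryTheory.eqToHom h) := ⟨h, rfl⟩

theorem id (X : C) : IsEqToHom (𝟙 X) := ⟨rfl, rfl⟩

theorem comp {f : X ⟶ Y} {g : Y ⟶ Z} (hf : IsEqToHom f) (hg : IsEqToHom g) :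
    IsEqToHom (f ≫ g) := by
  obtain ⟨rfl, rfl⟩ := hf
  simpa using hg

theorem eq {f g : X ⟶ Y} (hf : IsEqToHom f) (hg : IsEqToHom g) : f = g := by
  obtain ⟨_, rfl⟩ := hf
  obtain ⟨_, rfl⟩ := hg
  rfl

theorem inv {i : X ≅ Y} (h : IsEqToHom i.hom) : IsEqToHom i.inv := by
  obtain ⟨rfl, h⟩ := h
  exact ⟨rfl, by simpa [h] using i.hom_inv_id⟩

theorem comp_heq {f : X ⟶ Y} (hf : IsEqToHom f) (g : Y ⟶ Z) : HEq (f ≫ g) g := by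
  obtain ⟨rfl, rfl⟩ := hf
  simp

theorem heq_comp (f : X ⟶ Y) {g : Y ⟶ Z} (hg : IsEqToHom g) : HEq (f ≫ g) f := by
  obtain ⟨rfl, rfl⟩ := hg
  simp

end Category

variable {C : Type u₁} [Bicategory.{w₁, v₁} C] {D : Type u₂} [Bicategory.{w₂, v₂} D]

theorem whiskerLeft {a b c : C} (f : a ⟶ b) {g g' : b ⟶ c} {η : g ⟶ g'} (h : IsEqToHom η) :
    IsEqToHom (f ◁ η) := by
  obtain ⟨rfl, rfl⟩ := h
  exact ⟨rfl, by simp⟩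

theorem whiskerRight {a b c : C} {f f' : a ⟶ b} {η : f ⟶ f'} (h : IsEqToHom η) (g : b ⟶ c) :
    IsEqToHom (η ▷ g) := by
  obtain ⟨rfl, rfl⟩ := h
  exact ⟨rfl, by simp⟩

theorem map₂ (F : C ⥤ᵖ D) {a b : C} {f f' : a ⟶ b} {η : f ⟶ f'} (h : IsEqToHom η) :
    IsEqToHom (F.map₂ η) := by
  obtain ⟨rfl, rfl⟩ := h
  exact ⟨rfl, F.map₂_id f⟩

theorem associator [Strict C] {a b c d : C} (f : a ⟶ b) (g : b ⟶ c) (h : c ⟶ d) :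
    IsEqToHom (α_ f g h).hom :=
  ⟨Strict.assoc f g h, by rw [Strict.associator_eqToIso]; rfl⟩

theorem leftUnitor [Strict C] {a b : C} (f : a ⟶ b) : IsEqToHom (λ_ f).hom :=
  ⟨Strict.id_comp f, by rw [Strict.leftUnitor_eqToIso]; rfl⟩

theorem rightUnitor [Strict C] {a b : C} (f : a ⟶ b) : IsEqToHom (ρ_ f).hom :=
  ⟨Strict.comp_id f, by rw [Strict.rightUnitor_eqToIso]; rfl⟩

theorem map₂_conj_heq (F : C ⥤ᵖ D) {a b : C} {f f' g g' : a ⟶ b} (h : f = f') (η : f' ⟶ g)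
    (h' : g = g') : HEq (F.map₂ (CategoryTheory.eqToHom h ≫ η ≫ CategoryTheory.eqToHom h'))
      (F.map₂ η) := by
  subst h h'
  simp

theorem fst {X Y : C × D} {p q : X ⟶ Y} {η : p ⟶ q} (h : IsEqToHom η) : IsEqToHom η.1 := by
  obtain ⟨rfl, rfl⟩ := h
  exact ⟨rfl, rfl⟩

theorem snd {X Y : C × D} {p q : X ⟶ Y} {η : p ⟶ q} (h : IsEqToHom η) : IsEqToHom η.2 := by
  obtain ⟨rfl, rfl⟩ := h
  exact ⟨rfl, rfl⟩

theorem mapComp_congr (F : C ⥤ᵖ D) {a b c : C} {f f' : a ⟶ b} {g g' : b ⟶ c} (hf : f = f')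
    (hg : g = g') (h : IsEqToHom (F.mapComp f' g').hom) : IsEqToHom (F.mapComp f g).hom := by
  subst hf hg
  exact h

end IsEqToHom

section

variable {C : Type u₁} [Bicategory.{w₁, v₁} C] [Strict C]

theorem whiskerLeft_heq_of_eq_id {a b : C} {f : a ⟶ a} (h : f = 𝟙 a) {g g' : a ⟶ b} (η : g ⟶ g') :
    HEq (f ◁ η) η := by
  subst h
  exact id_whiskerLeft_heq η

theorem whiskerRight_heq_of_eq_id {a b : C} {g : b ⟶ b} (h : g = 𝟙 b) {f f' : a ⟶ b} (η : f ⟶ f') :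
    HEq (η ▷ g) η := by
  subst h
  exact whiskerRight_id_heq η

end

theorem CategoryTheory.Pseudofunctor.mapComp_congr_heq {C : Type u₁} [Bicategory.{w₁, v₁} C]
    {D : Type u₂} [Bicategory.{w₂, v₂} D] (F : C ⥤ᵖ D) {a b c : C} {f f' : a ⟶ b} {g g' : b ⟶ c}
    (hf : f = f') (hg : g = g') : HEq (F.mapComp f g).hom (F.mapComp f' g').hom := by
  subst hf hg
  rfl

theorem CategoryTheory.StrictPseudofunctor.isEqToHom_mapComp {C : Type u₁}
    [Bicategory.{w₁, v₁} C] {D : Type u₂} [Bicategory.{w₂, v₂} D]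
    (F : StrictPseudofunctor C D) {a b c : C} (f : a ⟶ b) (g : b ⟶ c) :
    IsEqToHom (F.mapComp f g).hom :=
  ⟨F.map_comp f g, by rw [F.mapComp_eq_eqToIso]; rfl⟩

theorem CategoryTheory.StrictPseudofunctor.isEqToHom_mapId {C : Type u₁}
    [Bicategory.{w₁, v₁} C] {D : Type u₂} [Bicategory.{w₂, v₂} D]
    (F : StrictPseudofunctor C D) (a : C) :
    IsEqToHom (F.mapId a).hom :=
  ⟨F.map_id a, by rw [F.mapId_eq_eqToIso]; rfl⟩

theorem IsEqToHom.ofHom_eq {C : Type u₁} [Bicategory.{w₁, v₁} C] {a b : C}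
    {f g : a ⟶ b} {η : f ⟶ g} (h : IsEqToHom η) (e : HEq f g) :
    HCell.ofHom η = HCell.ofHEq rfl rfl e := by
  obtain ⟨_, rfl⟩ := h
  rfl

section Strict

variable {C : Type u₁} [Bicategory.{w₁, v₁} C] {D : Type u₂} [Bicategory.{w₂, v₂} D]

theorem comp_heq_comp {x y : C} {f g h f' g' h' : x ⟶ y} (hf : f = f') (hg : g = g') (hh : h = h')
    {η : f ⟶ g} {θ : g ⟶ h} {η' : f' ⟶ g'} {θ' : g' ⟶ h'} (h₁ : HEq η η') (h₂ : HEq θ θ') :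
    HEq (η ≫ θ) (η' ≫ θ') := by
  subst hf hg hh h₁ h₂
  rfl

namespace CategoryTheory.StrictPseudofunctor

variable (F : StrictPseudofunctor C D)

theorem map₂_whiskerLeft_heq {x y z : C} (f : x ⟶ y) {g g' : y ⟶ z} (η : g ⟶ g')
    {k : F.obj x ⟶ F.obj y} (hk : F.map f = k) {m m' : F.obj y ⟶ F.obj z} (hm : F.map g = m)
    (hm' : F.map g' = m') {θ : m ⟶ m'} (h : HEq (F.map₂ η) θ) :
    HEq (F.map₂ (f ◁ η)) (k ◁ θ) := by
  subst hk hm hm' h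
  rw [F.map₂_whisker_left]
  exact (IsEqToHom.comp_heq (isEqToHom_mapComp F f g) _).trans
    (IsEqToHom.heq_comp _ (isEqToHom_mapComp F f g').inv)

theorem map₂_whiskerRight_heq {x y z : C} {f f' : x ⟶ y} (η : f ⟶ f') (g : y ⟶ z)
    {m m' : F.obj x ⟶ F.obj y} (hm : F.map f = m) (hm' : F.map f' = m') {k : F.obj y ⟶ F.obj z}
    (hk : F.map g = k) {θ : m ⟶ m'} (h : HEq (F.map₂ η) θ) :
    HEq (F.map₂ (η ▷ g)) (θ ▷ k) := by
  subst hk hm hm' h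
  rw [F.map₂_whisker_right]
  exact (IsEqToHom.comp_heq (isEqToHom_mapComp F f g) _).trans
    (IsEqToHom.heq_comp _ (isEqToHom_mapComp F f' g).inv)

theorem isEqToHom_map₂_whiskerLeft {x y z : C} (f : x ⟶ y) {g g' : y ⟶ z} {η : g ⟶ g'}
    (h : IsEqToHom (F.map₂ η)) : IsEqToHom (F.map₂ (f ◁ η)) := by
  rw [F.map₂_whisker_left]
  exact (isEqToHom_mapComp F f g).comp ((h.whiskerLeft _).comp (isEqToHom_mapComp F f g').inv)

theorem isEqToHom_map₂_whiskerRight {x y z : C} {f f' : x ⟶ y} {η : f ⟶ f'}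
    (h : IsEqToHom (F.map₂ η)) (g : y ⟶ z) : IsEqToHom (F.map₂ (η ▷ g)) := by
  rw [F.map₂_whisker_right]
  exact (isEqToHom_mapComp F f g).comp ((h.whiskerRight _).comp (isEqToHom_mapComp F f' g).inv)

theorem isEqToHom_map₂_comp {x y : C} {f g h : x ⟶ y} {η : f ⟶ g} {θ : g ⟶ h}
    (h₁ : IsEqToHom (F.map₂ η)) (h₂ : IsEqToHom (F.map₂ θ)) : IsEqToHom (F.map₂ (η ≫ θ)) := by
  rw [F.map₂_comp]
  exact h₁.comp h₂

end CategoryTheory.StrictPseudofunctor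

theorem prod_heq {x y : C × D} {p p' q q' : x ⟶ y} (hp : p = p') (hq : q = q')
    {η : p ⟶ q} {θ : p' ⟶ q'} (h₁ : HEq η.1 θ.1) (h₂ : HEq η.2 θ.2) : HEq η θ := by
  subst hp hq
  exact heq_of_eq (Prod.ext (eq_of_heq h₁) (eq_of_heq h₂))

theorem IsEqToHom.comp_eq_comp {C : Type u} [Category.{v} C] {x x' y y' : C}
    {η : x ⟶ y} {θ : x' ⟶ y'} {i : x ⟶ x'} {j : y ⟶ y'} (hi : IsEqToHom i) (hj : IsEqToHom j)
    (h : HEq η θ) :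
    η ≫ j = i ≫ θ := by
  obtain ⟨rfl, rfl⟩ := hi
  obtain ⟨rfl, rfl⟩ := hj
  obtain rfl := h
  simp

end Strict

/-! ### The universal cubical functor after the projection -/

namespace GrayTensor

open Gray

variable {A B : Type u} [Bicategory.{w, v} A] [Bicategory.{w, v} B]

theorem isEqToHom_S_id_left (a : A) {b b' : B} (g : b ⟶ b') : IsEqToHom (S (𝟙 a) g).hom :=
  ⟨_, sound₁ (p := R a g ≫ L (𝟙 a) b') (q := L (𝟙 a) b ≫ R a g) _ (Rel₂.sig_id_left a g)⟩

theorem isEqToHom_S_id_right {a a' : A} (f : a ⟶ a') (b : B) : IsEqToHom (S f (𝟙 b)).hom :=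
  ⟨_, sound₁ (p := R a (𝟙 b) ≫ L f b) (q := L f b ≫ R a' (𝟙 b)) _ (Rel₂.sig_id_right f b)⟩

/-- A 2-functor sends the comparison 2-cell of `c` at `p`, `q` to an identity if it does so for the
2-cell `Σ⁻¹` of which this comparison is a whiskering. -/
theorem isEqToHom_map₂_cComp {C : Type u₁} [Bicategory.{w₁, v₁} C]
    (F : StrictPseudofunctor (GrayTensor A B) C) {x y z : A × B}
    (p : x ⟶ y) (q : y ⟶ z) (h : IsEqToHom (F.map₂ (S q.1 p.2).inv)) :
    IsEqToHom (F.map₂ (cComp p q).hom) := by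
  have h₀ {x y : GrayTensor A B} {f g : x ⟶ y} {η : f ⟶ g} (h : IsEqToHom η) :
    IsEqToHom (F.map₂ η) := h.map₂ F.toPseudofunctor
  refine F.isEqToHom_map₂_comp (h₀ (.whiskerRight (.eqToHom (L_comp p.1 q.1 x.2)) _)) ?_
  refine F.isEqToHom_map₂_comp (h₀ (IsEqToHom.associator _ _ _)) ?_
  refine F.isEqToHom_map₂_comp (F.isEqToHom_map₂_whiskerLeft _ ?_)
    (h₀ (IsEqToHom.associator (L p.1 x.2) (R y.1 p.2) (L q.1 y.2 ≫ R z.1 q.2)).inv)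
  refine F.isEqToHom_map₂_comp (h₀ (.whiskerLeft _ (.eqToHom (R_comp z.1 p.2 q.2)))) ?_
  refine F.isEqToHom_map₂_comp
    (h₀ (IsEqToHom.associator (L q.1 x.2) (R z.1 p.2) (R z.1 q.2)).inv) ?_
  exact F.isEqToHom_map₂_comp (F.isEqToHom_map₂_whiskerRight h _)
    (h₀ (IsEqToHom.associator (R y.1 p.2) (L q.1 y.2) (R z.1 q.2)))

theorem isEqToHom_cComp {x y z : A × B} (p : x ⟶ y) (q : y ⟶ z)
    (h : IsEqToHom (S q.1 p.2).hom) : IsEqToHom (cComp p q).hom :=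
  isEqToHom_map₂_cComp (StrictPseudofunctor.id (GrayTensor A B)) p q h.inv

/-- The 2-cell `Σ_{f,g}⁻¹` is the comparison 2-cell of the universal cubical functor at the pair
`(1, g)`, `(f, 1)`: the other factors of that comparison are identities. -/
theorem cComp_swap_heq [Strict A] [Strict B] {a a' : A} {b b' : B} (f : a ⟶ a') (g : b ⟶ b') :
    HEq (cComp (prodHom (𝟙 a) g) (prodHom f (𝟙 b'))).hom (S f g).inv := by
  refine (IsEqToHom.comp_heq (.whiskerRight (.eqToHom (L_comp (𝟙 a) f b)) _) _).trans ?_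
  refine (IsEqToHom.comp_heq (.associator _ _ _) _).trans ?_
  refine (IsEqToHom.heq_comp _
    (IsEqToHom.associator (L (𝟙 a) b) (R a g) (L f b' ≫ R a' (𝟙 b'))).inv).trans ?_
  refine (whiskerLeft_heq_of_eq_id (L_id a b) _).trans ?_
  refine (IsEqToHom.comp_heq (.whiskerLeft _ (.eqToHom (R_comp a' g (𝟙 b')))) _).trans ?_
  refine (IsEqToHom.comp_heq
    (IsEqToHom.associator (L f b) (R a' g) (R a' (𝟙 b'))).inv _).trans ?_
  refine (IsEqToHom.heq_comp _ (.associator _ _ _)).trans ?_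
  exact whiskerRight_heq_of_eq_id (R_id a' b') _

variable [Strict A] [Strict B]

theorem isEqToHom_c_mapId (x : A × B) : IsEqToHom ((c A B).mapId x).hom :=
  (IsEqToHom.whiskerRight (.eqToHom (L_id x.1 x.2)) _).comp <|
    (IsEqToHom.leftUnitor _).comp (.eqToHom (R_id x.1 x.2))

variable (A B) in
/-- The endofunctor of `A ⊗ B` which is the composite of the projection to `A × B` with the
universal cubical functor. -/
abbrev projC : GrayTensor A B ⥤ᵖ GrayTensor A B :=
  (proj A B).toPseudofunctor.comp (c A B)

theorem isEqToHom_projC_mapId (x : GrayTensor A B) : IsEqToHom ((projC A B).mapId x).hom :=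
  ((StrictPseudofunctor.isEqToHom_mapId (proj A B) x).map₂ (c A B)).comp (isEqToHom_c_mapId _)

theorem isEqToHom_projC_mapComp {x y z : GrayTensor A B} (p : x ⟶ y) (q : y ⟶ z)
    (h : IsEqToHom ((c A B).mapComp ((proj A B).map p) ((proj A B).map q)).hom) :
    IsEqToHom ((projC A B).mapComp p q).hom :=
  ((StrictPseudofunctor.isEqToHom_mapComp (proj A B) p q).map₂ (c A B)).comp h

theorem c_map_left {a a' : A} (f : a ⟶ a') (b : B) :
    (c A B).map (prodHom f (𝟙 b)) = L f b :=
  (congrArg (L f b ≫ ·) (R_id a' b)).trans (comp_id' _)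

theorem c_map_right (a : A) {b b' : B} (g : b ⟶ b') :
    (c A B).map (prodHom (𝟙 a) g) = R a g :=
  (congrArg (· ≫ R a g) (L_id a b)).trans (id_comp' _)

theorem projC_map_L {a a' : A} (f : a ⟶ a') (b : B) : (projC A B).map (L f b) = L f b :=
  (congrArg (c A B).map (proj_map_L f b)).trans (c_map_left f b)

theorem projC_map_R (a : A) {b b' : B} (g : b ⟶ b') : (projC A B).map (R a g) = R a g :=
  (congrArg (c A B).map (proj_map_R a g)).trans (c_map_right a g)

theorem isEqToHom_projC_mapComp_L_L {a a' a'' : A} (f : a ⟶ a') (f' : a' ⟶ a'') (b : B) :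
    IsEqToHom ((projC A B).mapComp (L f b) (L f' b)).hom :=
  isEqToHom_projC_mapComp _ _ <|
    .mapComp_congr (c A B) (proj_map_L f b) (proj_map_L f' b) <|
      isEqToHom_cComp (prodHom f (𝟙 b)) (prodHom f' (𝟙 b)) (isEqToHom_S_id_right f' b)

theorem isEqToHom_projC_mapComp_R_R (a : A) {b b' b'' : B} (g : b ⟶ b') (g' : b' ⟶ b'') :
    IsEqToHom ((projC A B).mapComp (R a g) (R a g')).hom :=
  isEqToHom_projC_mapComp _ _ <|
    .mapComp_congr (c A B) (proj_map_R a g) (proj_map_R a g') <|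
      isEqToHom_cComp (prodHom (𝟙 a) g) (prodHom (𝟙 a) g') (isEqToHom_S_id_left a g)

theorem isEqToHom_projC_mapComp_L_R {a a' : A} {b b' : B} (f : a ⟶ a') (g : b ⟶ b') :
    IsEqToHom ((projC A B).mapComp (L f b) (R a' g)).hom :=
  isEqToHom_projC_mapComp _ _ <|
    .mapComp_congr (c A B) (proj_map_L f b) (proj_map_R a' g) <|
      isEqToHom_cComp (prodHom f (𝟙 b)) (prodHom (𝟙 a') g) (isEqToHom_S_id_left a' (𝟙 b))

theorem projC_mapComp_R_L_heq {a a' : A} {b b' : B} (f : a ⟶ a') (g : b ⟶ b') :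
    HEq ((projC A B).mapComp (R a g) (L f b')).hom (S f g).inv :=
  (IsEqToHom.comp_heq ((StrictPseudofunctor.isEqToHom_mapComp (proj A B) (R a g)
    (L f b')).map₂ (c A B)) _).trans <|
  (Pseudofunctor.mapComp_congr_heq (c A B) (proj_map_R a g) (proj_map_L f b')).trans <|
  cComp_swap_heq f g

variable (A B) in
/-- The generators of `A ⊗ B`, as the generators of a strict model of the composite of the
projection to `A × B` with the universal cubical functor. -/
def projCModel : GenModel (projC A B) where
  l f b := L f b
  r a _ _ g := R a g
  l_id := L_id
  l_comp := L_comp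
  r_id := R_id
  r_comp := R_comp
  lIso f b := eqToIso (projC_map_L f b).symm
  rIso a _ _ g := eqToIso (projC_map_R a g).symm
  lIso_id a b := IsEqToHom.eq
    ((IsEqToHom.eqToHom (projC_map_L (𝟙 a) b).symm).comp ((IsEqToHom.eqToHom (L_id a b)).map₂ _))
    ((IsEqToHom.eqToHom (L_id a b)).comp (isEqToHom_projC_mapId ⟨a, b⟩).inv)
  lIso_comp f f' b := IsEqToHom.eq
    ((IsEqToHom.eqToHom (projC_map_L (f ≫ f') b).symm).comp
      ((IsEqToHom.eqToHom (L_comp f f' b)).map₂ _))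
    ((IsEqToHom.eqToHom (L_comp f f' b)).comp
      (((IsEqToHom.eqToHom (projC_map_L f b).symm).whiskerRight _).comp
        (((IsEqToHom.eqToHom (projC_map_L f' b).symm).whiskerLeft _).comp
          (isEqToHom_projC_mapComp_L_L f f' b).inv)))
  rIso_id a b := IsEqToHom.eq
    ((IsEqToHom.eqToHom (projC_map_R a (𝟙 b)).symm).comp ((IsEqToHom.eqToHom (R_id a b)).map₂ _))
    ((IsEqToHom.eqToHom (R_id a b)).comp (isEqToHom_projC_mapId ⟨a, b⟩).inv)
  rIso_comp a _ _ _ g g' := IsEqToHom.eq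
    ((IsEqToHom.eqToHom (projC_map_R a (g ≫ g')).symm).comp
      ((IsEqToHom.eqToHom (R_comp a g g')).map₂ _))
    ((IsEqToHom.eqToHom (R_comp a g g')).comp
      (((IsEqToHom.eqToHom (projC_map_R a g).symm).whiskerRight _).comp
        (((IsEqToHom.eqToHom (projC_map_R a g').symm).whiskerLeft _).comp
          (isEqToHom_projC_mapComp_R_R a g g').inv)))

theorem isEqToHom_projCModel_iso_L {a a' : A} (f : a ⟶ a') (b : B) :
    IsEqToHom ((projCModel A B).strictModel.iso (L f b)).hom := by
  rw [GenModel.strictModel_iso_L]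
  exact (IsEqToHom.eqToHom _).comp (IsEqToHom.eqToHom (projC_map_L f b).symm)

theorem isEqToHom_projCModel_iso_R (a : A) {b b' : B} (g : b ⟶ b') :
    IsEqToHom ((projCModel A B).strictModel.iso (R a g)).hom := by
  rw [GenModel.strictModel_iso_R]
  exact (IsEqToHom.eqToHom _).comp (IsEqToHom.eqToHom (projC_map_R a g).symm)

theorem c_map₂_left_heq {a a' : A} {f f' : a ⟶ a'} (α : f ⟶ f') (b : B) :
    HEq ((c A B).map₂ (prodHom₂ α (𝟙 (𝟙 b)))) (L₂ α b) :=
  (IsEqToHom.heq_comp _ (.whiskerLeft _ ⟨rfl, R₂_id a' (𝟙 b)⟩)).trans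
    (whiskerRight_heq_of_eq_id (R_id a' b) _)

theorem c_map₂_right_heq (a : A) {b b' : B} {g g' : b ⟶ b'} (β : g ⟶ g') :
    HEq ((c A B).map₂ (prodHom₂ (𝟙 (𝟙 a)) β)) (R₂ a β) :=
  (IsEqToHom.comp_heq (.whiskerRight ⟨rfl, L₂_id (𝟙 a) b⟩ _) _).trans
    (whiskerLeft_heq_of_eq_id (L_id a b) _)

theorem projC_map₂_L₂_heq {a a' : A} {f f' : a ⟶ a'} (α : f ⟶ f') (b : B) :
    HEq ((projC A B).map₂ (L₂ α b)) (L₂ α b) := by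
  change HEq ((c A B).map₂ ((proj A B).map₂ (L₂ α b))) (L₂ α b)
  rw [proj_map₂_L₂]
  exact (IsEqToHom.map₂_conj_heq (c A B) (proj_map_L f b) _ (proj_map_L f' b).symm).trans
    (c_map₂_left_heq α b)

theorem projC_map₂_R₂_heq (a : A) {b b' : B} {g g' : b ⟶ b'} (β : g ⟶ g') :
    HEq ((projC A B).map₂ (R₂ a β)) (R₂ a β) := by
  change HEq ((c A B).map₂ ((proj A B).map₂ (R₂ a β))) (R₂ a β)
  rw [proj_map₂_R₂]
  exact (IsEqToHom.map₂_conj_heq (c A B) (proj_map_R a g) _ (proj_map_R a g').symm).trans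
    (c_map₂_right_heq a β)

theorem isEqToHom_projC_map₂_S_inv {a a' : A} {b b' : B} (f : a ⟶ a') (g : b ⟶ b') :
    IsEqToHom ((projC A B).map₂ (S f g).inv) := by
  change IsEqToHom ((c A B).map₂ ((proj A B).map₂ (S f g).inv))
  rw [proj_map₂_S_inv]
  exact (IsEqToHom.eqToHom (proj_map_S f g)).map₂ (c A B)

/-- The identity 2-functor of `A ⊗ B` comes from the strict model `projCModel`. Only generators need
to be compared. On `Σ⁻¹` the conjugation contributes `Σ⁻¹` itself, because that is the constraint of
`projC` at `1 ⊗ g`, `f ⊗ 1`, while the projection sends `Σ⁻¹` to an identity. -/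
theorem projCModel_functor :
    (projCModel A B).strictModel.functor = StrictPseudofunctor.id (GrayTensor A B) := by
  refine hom_ext (fun _ => rfl) (fun f b => heq_of_eq ((projCModel A B).strictModel_map_L f b))
    (fun a _ _ g => heq_of_eq ((projCModel A B).strictModel_map_R a g)) ?_ ?_ ?_
  · intro a a' f f' α b
    refine (IsEqToHom.comp_heq (isEqToHom_projCModel_iso_L f b) _).trans ?_
    refine (IsEqToHom.heq_comp _ (isEqToHom_projCModel_iso_L f' b).inv).trans ?_
    exact projC_map₂_L₂_heq α b
  · intro a b b' g g' β
    refine (IsEqToHom.comp_heq (isEqToHom_projCModel_iso_R a g) _).trans ?_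
    refine (IsEqToHom.heq_comp _ (isEqToHom_projCModel_iso_R a g').inv).trans ?_
    exact projC_map₂_R₂_heq a β
  · intro a a' b b' f g
    have h : IsEqToHom ((projCModel A B).strictModel.iso (L f b ≫ R a' g)).hom := by
      rw [(projCModel A B).strictModel.iso_comp]
      exact (IsEqToHom.eqToHom _).comp <| ((isEqToHom_projCModel_iso_L f b).whiskerRight _).comp <|
        ((isEqToHom_projCModel_iso_R a' g).whiskerLeft _).comp (isEqToHom_projC_mapComp_L_R f g).inv
    refine (IsEqToHom.comp_heq h _).trans ?_
    refine (IsEqToHom.comp_heq (isEqToHom_projC_map₂_S_inv f g) _).trans ?_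
    rw [(projCModel A B).strictModel.iso_comp_inv]
    refine (IsEqToHom.heq_comp _ ?_).trans (projC_mapComp_R_L_heq f g)
    exact ((isEqToHom_projCModel_iso_L f b').inv.whiskerLeft _).comp <|
      ((isEqToHom_projCModel_iso_R a g).inv.whiskerRight _).comp (.eqToHom _)

variable (A B) in
/-- Up to invertible icons, the projection `A ⊗ B → A × B` followed by the universal cubical
functor is the identity. -/
theorem iconIso_projC :
    IconIso (StrictPseudofunctor.id (GrayTensor A B)).toPseudofunctor (projC A B) := by
  rw [← projCModel_functor]
  exact ⟨(projCModel A B).strictModel.icon, (projCModel A B).strictModel.isInv_icon⟩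

end GrayTensor

/-! ### Strict models in each variable of functors out of a product -/

namespace GrayTensor

open Gray

section

variable {C : Type u₁} [Bicategory.{w₁, v₁} C] {D : Type u₂} [Bicategory.{w₂, v₂} D]
  {E : Type u₃} [Bicategory.{w₃, v₃} E]

/-- A comparison `m ≅ H q` compatible with the unit constraint of `H` remains so for `H P`, after
transport along an equality `P p = q`. -/
theorem comp_mapId_aux (P : StrictPseudofunctor C D) (H : D ⥤ᵖ E) {x : C} {p : x ⟶ x}
    (hp : p = 𝟙 x) {q : P.obj x ⟶ P.obj x} (h : P.map p = q) (hq : q = 𝟙 (P.obj x))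
    {m : H.obj (P.obj x) ⟶ H.obj (P.obj x)} (i : m ≅ H.map q) (hm : m = 𝟙 _)
    (e : i.hom ≫ H.map₂ (eqToHom hq) = eqToHom hm ≫ (H.mapId _).inv) :
    (i ≪≫ H.map₂Iso (eqToIso h.symm)).hom ≫ (P.toPseudofunctor.comp H).map₂ (eqToHom hp) =
      eqToHom hm ≫ ((P.toPseudofunctor.comp H).mapId x).inv := by
  subst h hp
  have e' := congrArg (fun t => t ≫ H.map₂ (eqToHom hq.symm)) e
  simp only [Category.assoc, ← H.map₂_comp, eqToHom_trans, eqToHom_refl, H.map₂_id,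
    Category.comp_id] at e'
  change (i.hom ≫ H.map₂ (𝟙 (P.map (𝟙 x)))) ≫ H.map₂ (P.map₂ (𝟙 (𝟙 x))) =
    eqToHom hm ≫ (H.mapId (P.obj x)).inv ≫ H.map₂ (P.mapId x).inv
  rw [P.mapId_eq_eqToIso, e']
  simp

/-- Comparisons `m ≅ H q`, `m' ≅ H q'`, `m'' ≅ H q''` compatible with the composition constraint of
`H` remain so for `H P`, after transport along equalities `P p = q`, `P p' = q'`, `P p'' = q''`. -/
theorem comp_mapComp_aux (P : StrictPseudofunctor C D) (H : D ⥤ᵖ E) {x y z : C} {p : x ⟶ y}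
    {p' : y ⟶ z} {p'' : x ⟶ z} (hp : p'' = p ≫ p') {q : P.obj x ⟶ P.obj y}
    {q' : P.obj y ⟶ P.obj z} {q'' : P.obj x ⟶ P.obj z} (h : P.map p = q) (h' : P.map p' = q')
    (h'' : P.map p'' = q'') (hq : q'' = q ≫ q') {m : H.obj (P.obj x) ⟶ H.obj (P.obj y)}
    {m' : H.obj (P.obj y) ⟶ H.obj (P.obj z)} {m'' : H.obj (P.obj x) ⟶ H.obj (P.obj z)}
    (i : m ≅ H.map q) (i' : m' ≅ H.map q') (i'' : m'' ≅ H.map q'') (hm : m'' = m ≫ m')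
    (e : i''.hom ≫ H.map₂ (eqToHom hq) = eqToHom hm ≫ i.hom ▷ m' ≫ H.map q ◁ i'.hom ≫
      (H.mapComp q q').inv) :
    (i'' ≪≫ H.map₂Iso (eqToIso h''.symm)).hom ≫ (P.toPseudofunctor.comp H).map₂ (eqToHom hp) =
      eqToHom hm ≫ (i ≪≫ H.map₂Iso (eqToIso h.symm)).hom ▷ m' ≫
        (P.toPseudofunctor.comp H).map p ◁ (i' ≪≫ H.map₂Iso (eqToIso h'.symm)).hom ≫
          ((P.toPseudofunctor.comp H).mapComp p p').inv := by
  subst h h' hp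
  subst h''
  have e' := congrArg (fun t => t ≫ H.map₂ (eqToHom hq.symm)) e
  simp only [Category.assoc, ← H.map₂_comp, eqToHom_trans, eqToHom_refl, H.map₂_id,
    Category.comp_id] at e'
  change (i''.hom ≫ H.map₂ (𝟙 (P.map (p ≫ p')))) ≫ H.map₂ (P.map₂ (𝟙 (p ≫ p'))) = eqToHom hm ≫
    (i.hom ≫ H.map₂ (𝟙 (P.map p))) ▷ m' ≫ H.map (P.map p) ◁ (i'.hom ≫ H.map₂ (𝟙 (P.map p'))) ≫
      (H.mapComp (P.map p) (P.map p')).inv ≫ H.map₂ (P.mapComp p p').inv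
  rw [P.mapComp_eq_eqToIso, e']
  simp

end

variable {A B : Type u} [Bicategory.{w, v} A] [Bicategory.{w, v} B] [Strict A] [Strict B]
  {E : Type u₁} [Bicategory.{w₁, v₁} E]

/-- Strictly functorial replacements, in each variable separately, of a functor `H` out of
`A × B`. -/
structure BiModel (H : (A × B) ⥤ᵖ E) where
  /-- the value on `(f, 1)` -/
  l {a a' : A} (f : a ⟶ a') (b : B) : H.obj (a, b) ⟶ H.obj (a', b)
  /-- the value on `(1, g)` -/
  r (a : A) {b b' : B} (g : b ⟶ b') : H.obj (a, b) ⟶ H.obj (a, b')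
  l_id (a : A) (b : B) : l (𝟙 a) b = 𝟙 (H.obj (a, b))
  l_comp {a a' a'' : A} (f : a ⟶ a') (f' : a' ⟶ a'') (b : B) : l (f ≫ f') b = l f b ≫ l f' b
  r_id (a : A) (b : B) : r a (𝟙 b) = 𝟙 (H.obj (a, b))
  r_comp (a : A) {b b' b'' : B} (g : b ⟶ b') (g' : b' ⟶ b'') : r a (g ≫ g') = r a g ≫ r a g'
  /-- the comparison at `(f, 1)` -/
  lIso {a a' : A} (f : a ⟶ a') (b : B) : l f b ≅ H.map (prodHom f (𝟙 b))
  /-- the comparison at `(1, g)` -/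
  rIso (a : A) {b b' : B} (g : b ⟶ b') : r a g ≅ H.map (prodHom (𝟙 a) g)
  lIso_id (a : A) (b : B) : (lIso (𝟙 a) b).hom = eqToHom (l_id a b) ≫ (H.mapId (a, b)).inv
  lIso_comp {a a' a'' : A} (f : a ⟶ a') (f' : a' ⟶ a'') (b : B) :
    (lIso (f ≫ f') b).hom ≫
      H.map₂ (eqToHom (Prod.ext rfl (Strict.comp_id (𝟙 b)).symm :
        prodHom (f ≫ f') (𝟙 b) = prodHom f (𝟙 b) ≫ prodHom f' (𝟙 b))) =
      eqToHom (l_comp f f' b) ≫ (lIso f b).hom ▷ l f' b ≫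
        H.map (prodHom f (𝟙 b)) ◁ (lIso f' b).hom ≫ (H.mapComp _ _).inv
  rIso_id (a : A) (b : B) : (rIso a (𝟙 b)).hom = eqToHom (r_id a b) ≫ (H.mapId (a, b)).inv
  rIso_comp (a : A) {b b' b'' : B} (g : b ⟶ b') (g' : b' ⟶ b'') :
    (rIso a (g ≫ g')).hom ≫
      H.map₂ (eqToHom (Prod.ext (Strict.comp_id (𝟙 a)).symm rfl :
        prodHom (𝟙 a) (g ≫ g') = prodHom (𝟙 a) g ≫ prodHom (𝟙 a) g')) =
      eqToHom (r_comp a g g') ≫ (rIso a g).hom ▷ r a g' ≫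
        H.map (prodHom (𝟙 a) g) ◁ (rIso a g').hom ≫ (H.mapComp _ _).inv

/-- The values on generators of a strict model of the composite of `H` with the projection
`A ⊗ B → A × B`. -/
def BiModel.genModel {H : (A × B) ⥤ᵖ E} (M : BiModel H) :
    GenModel ((proj A B).toPseudofunctor.comp H) where
  l f b := M.l f b
  r a _ _ g := M.r a g
  l_id := M.l_id
  l_comp := M.l_comp
  r_id := M.r_id
  r_comp := M.r_comp
  lIso f b := M.lIso f b ≪≫ H.map₂Iso (eqToIso (proj_map_L f b).symm)
  rIso a _ _ g := M.rIso a g ≪≫ H.map₂Iso (eqToIso (proj_map_R a g).symm)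
  lIso_id a b := comp_mapId_aux (proj A B) H (L_id a b) (proj_map_L (𝟙 a) b) rfl (M.lIso (𝟙 a) b)
    (M.l_id a b) ((congrArg ((M.lIso (𝟙 a) b).hom ≫ ·) (H.map₂_id _)).trans
      ((Category.comp_id _).trans (M.lIso_id a b)))
  lIso_comp f f' b := comp_mapComp_aux (proj A B) H (L_comp f f' b) (proj_map_L f b)
    (proj_map_L f' b) (proj_map_L (f ≫ f') b) _ (M.lIso f b) (M.lIso f' b) (M.lIso (f ≫ f') b)
    (M.l_comp f f' b) (M.lIso_comp f f' b)
  rIso_id a b := comp_mapId_aux (proj A B) H (R_id a b) (proj_map_R a (𝟙 b)) rfl (M.rIso a (𝟙 b))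
    (M.r_id a b) ((congrArg ((M.rIso a (𝟙 b)).hom ≫ ·) (H.map₂_id _)).trans
      ((Category.comp_id _).trans (M.rIso_id a b)))
  rIso_comp a _ _ _ g g' := comp_mapComp_aux (proj A B) H (R_comp a g g') (proj_map_R a g)
    (proj_map_R a g') (proj_map_R a (g ≫ g')) _ (M.rIso a g) (M.rIso a g') (M.rIso a (g ≫ g'))
    (M.r_comp a g g') (M.rIso_comp a g g')

end GrayTensor

/-! ### The strings in a product of two bicategories -/

namespace Str

theorem map_append {B : Type u₁} [Quiver.{v₁} B] {C : Type u₂} [Quiver.{v₂} C] (F : B ⥤q C) :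
    {a b c : B} → (p : Str a b) → (q : Str b c) →
      map F (p.append q) = (map F p).append (map F q)
  | _, _, _, nil _, _ => rfl
  | _, _, _, cons f p, q => congrArg (cons (F.map f)) (map_append F p q)

/-- The inductive step in the comparison of `appendIso` for two families of strings related by
invertible 2-cells. -/
theorem appendIso_cons_aux {E : Type u} [Bicategory.{w, v} E] {a b c d : E} (f : a ⟶ b)
    {P P' : b ⟶ c} {Q Q' : c ⟶ d} {T T₁ T' : b ⟶ d} {FP FP' : a ⟶ c} {FT FT₁ FT' : a ⟶ d}
    (kP : f ≫ P ≅ FP) (kT : f ≫ T ≅ FT) (kT₁ : f ≫ T₁ ≅ FT₁) (A : P ≫ Q ≅ T)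
    (i : P ≅ P') (j : Q ≅ Q') (k : T₁ ≅ T') (t : T ⟶ T₁) (t' : FT ⟶ FT₁)
    (h : kT.hom ≫ t' = f ◁ t ≫ kT₁.hom) (cP : f ≫ P' ≅ FP') (cT : f ≫ T' ≅ FT')
    (A' : P' ≫ Q' ≅ T') (A'' : FP' ≫ Q' ≅ FT')
    (hA : A''.hom = cP.inv ▷ Q' ≫ (α_ f P' Q').hom ≫ f ◁ A'.hom ≫ cT.hom)
    (ih : A.hom ≫ t ≫ k.hom = i.hom ▷ Q ≫ P' ◁ j.hom ≫ A'.hom) :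
    (whiskerRightIso kP.symm Q ≪≫ α_ f P Q ≪≫ whiskerLeftIso f A ≪≫ kT).hom ≫ t' ≫
        (kT₁.symm ≪≫ whiskerLeftIso f k ≪≫ cT).hom =
      (kP.symm ≪≫ whiskerLeftIso f i ≪≫ cP).hom ▷ Q ≫ FP' ◁ j.hom ≫ A''.hom := by
  have ih' := congrArg (fun η => f ◁ η) ih
  simp only [Bicategory.whiskerLeft_comp] at ih'
  simp only [Iso.trans_hom, whiskerRightIso_hom, whiskerLeftIso_hom, Iso.symm_hom,
    comp_whiskerRight, Category.assoc, reassoc_of% h, Iso.hom_inv_id_assoc, hA]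
  rw [reassoc_of% ih']
  simp [whisker_exchange_assoc]

end Str

namespace St

section Comparison

variable {X Y : Type u} [Bicategory.{w, v} X] [Bicategory.{w, v} Y]

/-- The case of an empty first string in `appendIso_inXIso` and `appendIso_inYIso`. -/
theorem leftUnitor_aux {E : Type u} [Bicategory.{w, v} E] {a b : E} {f g : a ⟶ b} (η : f ⟶ g) :
    (λ_ f).hom ≫ 𝟙 f ≫ η = 𝟙 (𝟙 a) ▷ f ≫ 𝟙 a ◁ η ≫ (λ_ g).hom := by
  simp

/-- The comparisons between the composite of the string `(f₁, 1), …, (fₙ, 1)` and `(f₁ ⋯ fₙ, 1)` are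
compatible with concatenation. -/
theorem appendIso_inXIso (y : Y) : {x x' x'' : X} → (p : Str x x') → (q : Str x' x'') →
    (Str.appendIso (Str.map (inX y) p) (Str.map (inX y) q)).hom ≫
        eqToHom (congrArg Str.eval (Str.map_append (inX y) p q).symm) ≫
          (inXIso y (p.append q)).hom =
      (inXIso y p).hom ▷ Str.eval (Str.map (inX y) q) ≫
        prodHom (Str.eval p) (𝟙 y) ◁ (inXIso y q).hom ≫
          (Iso.prod (Str.appendIso p q) (λ_ (𝟙 y))).hom
  | _, _, _, .nil x, q => by
      exact leftUnitor_aux (inXIso y q).hom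
  | _, _, _, .cons (c := x') f p, q => by
      refine Str.appendIso_cons_aux _ _ _ _ _ (inXIso y p) (inXIso y q) (inXIso y (p.append q))
        _ _ (Str.consIso_hom_eqToHom _ (Str.map_append (inX y) p q).symm) _ _ _ _ ?_
        (appendIso_inXIso y p q)
      refine Prod.ext rfl ?_
      change (λ_ (𝟙 y)).hom = (λ_ (𝟙 y)).inv ▷ 𝟙 y ≫ (α_ _ _ _).hom ≫
        𝟙 y ◁ (λ_ (𝟙 y)).hom ≫ (λ_ (𝟙 y)).hom
      simp

/-- The comparisons between the composite of the string `(1, g₁), …, (1, gₘ)` and `(1, g₁ ⋯ gₘ)` are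
compatible with concatenation. -/
theorem appendIso_inYIso (x : X) : {y y' y'' : Y} → (p : Str y y') → (q : Str y' y'') →
    (Str.appendIso (Str.map (inY x) p) (Str.map (inY x) q)).hom ≫
        eqToHom (congrArg Str.eval (Str.map_append (inY x) p q).symm) ≫
          (inYIso x (p.append q)).hom =
      (inYIso x p).hom ▷ Str.eval (Str.map (inY x) q) ≫
        prodHom (𝟙 x) (Str.eval p) ◁ (inYIso x q).hom ≫
          (Iso.prod (λ_ (𝟙 x)) (Str.appendIso p q)).hom
  | _, _, _, .nil y, q => by
      exact leftUnitor_aux (inYIso x q).hom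
  | _, _, _, .cons (c := y') f p, q => by
      refine Str.appendIso_cons_aux _ _ _ _ _ (inYIso x p) (inYIso x q) (inYIso x (p.append q))
        _ _ (Str.consIso_hom_eqToHom _ (Str.map_append (inY x) p q).symm) _ _ _ _ ?_
        (appendIso_inYIso x p q)
      refine Prod.ext ?_ rfl
      change (λ_ (𝟙 x)).hom = (λ_ (𝟙 x)).inv ▷ 𝟙 x ≫ (α_ _ _ _).hom ≫
        𝟙 x ◁ (λ_ (𝟙 x)).hom ≫ (λ_ (𝟙 x)).hom
      simp

theorem f_mapId_inv_val {B : Type u} [Bicategory.{w, v} B] (a : B) :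
    Cell.val ((St.f B).mapId a).inv = 𝟙 (𝟙 a) :=
  (congrArg (· ≫ 𝟙 (𝟙 a)) (Category.comp_id (𝟙 (𝟙 a)))).trans (Category.comp_id _)

/-- The coherence isomorphism `e(g) ≫ e(h) ≅ e(g, h)` at two strings of length one is an identity:
the units in it cancel by the triangle identity. -/
theorem φ_single {B : Type u} [Bicategory.{w, v} B] {a b c : B} (g : a ⟶ b) (h : b ⟶ c) :
    (φ ((St.f B).map g) ((St.f B).map h)).hom = 𝟙 (g ≫ h) := by
  change ((ρ_ g).inv ▷ h ≫ (α_ g (𝟙 b) h).hom ≫ g ◁ (λ_ h).hom ≫ 𝟙 (g ≫ h)) = 𝟙 (g ≫ h)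
  simp

theorem f_mapComp_hom_val {B : Type u} [Bicategory.{w, v} B] {a b c : B} (g : a ⟶ b)
    (h : b ⟶ c) : Cell.val ((St.f B).mapComp g h).hom = 𝟙 (g ≫ h) := by
  change 𝟙 (g ≫ h) ≫ 𝟙 (g ≫ h) ≫ 𝟙 g ▷ h ≫ g ◁ 𝟙 h ≫
    (φ ((St.f B).map g) ((St.f B).map h)).hom = 𝟙 (g ≫ h)
  rw [φ_single, id_whiskerRight, whiskerLeft_id]
  have key : ∀ {C : Type v} [Category.{w} C] (x : C), 𝟙 x ≫ 𝟙 x ≫ 𝟙 x ≫ 𝟙 x ≫ 𝟙 x = 𝟙 x := by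
    intros; simp
  exact key (g ≫ h)

theorem f_mapComp_inv_val {B : Type u} [Bicategory.{w, v} B] {a b c : B} (g : a ⟶ b)
    (h : b ⟶ c) : Cell.val ((St.f B).mapComp g h).inv = 𝟙 (g ≫ h) := by
  have e := congrArg Cell.val ((St.f B).mapComp g h).inv_hom_id
  have e' := (congrArg (Cell.val ((St.f B).mapComp g h).inv ≫ ·)
    (f_mapComp_hom_val g h)).symm.trans e
  exact (Category.comp_id _).symm.trans e'

theorem f_map₂_val {B : Type u} [Bicategory.{w, v} B] {a b : B} {g h : a ⟶ b} (η : g ⟶ h) :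
    Cell.val ((St.f B).map₂ η) = η :=
  (Category.id_comp _).trans (Category.comp_id _)

theorem comp_f_mapComp_inv_val {B : Type u} [Bicategory.{w, v} B] {C : Type u₁}
    [Bicategory.{w₁, v₁} C] (H : C ⥤ᵖ B) {a b c : C} (p : a ⟶ b) (q : b ⟶ c) :
    Cell.val ((H.comp (St.f B)).mapComp p q).inv = (H.mapComp p q).inv := by
  change Cell.val ((St.f B).mapComp (H.map p) (H.map q)).inv ≫
    Cell.val ((St.f B).map₂ (H.mapComp p q).inv) = _
  rw [f_mapComp_inv_val, f_map₂_val]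
  exact Category.id_comp _

theorem comp_f_mapId_inv_val {B : Type u} [Bicategory.{w, v} B] {C : Type u₁}
    [Bicategory.{w₁, v₁} C] (H : C ⥤ᵖ B) (a : C) :
    Cell.val ((H.comp (St.f B)).mapId a).inv = (H.mapId a).inv := by
  change Cell.val ((St.f B).mapId (H.obj a)).inv ≫ Cell.val ((St.f B).map₂ (H.mapId a).inv) = _
  rw [f_mapId_inv_val, f_map₂_val]
  exact Category.id_comp _

/-- A square of 2-cells of `B` expressing compatibility of `i`, `j`, `k` with composition gives the
corresponding square in `st B`, where horizontal composition is conjugated by the isomorphisms `φ`;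
these cancel. -/
theorem lift_comp_aux {B : Type u} [Bicategory.{w, v} B] {C : Type u₁} [Bicategory.{w₁, v₁} C]
    (H : C ⥤ᵖ B) {a b c : C} {p : a ⟶ b} {q : b ⟶ c} {pq : a ⟶ c} (hp : pq = p ≫ q)
    {m : St.mk (H.obj a) ⟶ St.mk (H.obj b)} {n : St.mk (H.obj b) ⟶ St.mk (H.obj c)}
    {mn : St.mk (H.obj a) ⟶ St.mk (H.obj c)} (hm : mn = m ≫ n) (i : ev m ≅ H.map p)
    (j : ev n ≅ H.map q) (k : ev mn ≅ H.map pq)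
    (e : (φ m n).hom ≫ eqToHom (congrArg ev hm.symm) ≫ k.hom ≫ H.map₂ (eqToHom hp) =
      i.hom ▷ ev n ≫ H.map p ◁ j.hom ≫ (H.mapComp p q).inv) :
    (isoMk (q := (H.comp (St.f B)).map pq) k).hom ≫ (H.comp (St.f B)).map₂ (eqToHom hp) =
      eqToHom hm ≫ (isoMk (q := (H.comp (St.f B)).map p) i).hom ▷ n ≫
        (H.comp (St.f B)).map p ◁ (isoMk (q := (H.comp (St.f B)).map q) j).hom ≫
          ((H.comp (St.f B)).mapComp p q).inv := by
  subst hp hm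
  apply cell_ext
  change k.hom ≫ Cell.val ((St.f B).map₂ (H.map₂ (𝟙 (p ≫ q)))) = 𝟙 (ev (m ≫ n)) ≫
    ((φ m n).inv ≫ i.hom ▷ ev n ≫ (φ ((St.f B).map (H.map p)) n).hom) ≫
      ((φ ((St.f B).map (H.map p)) n).inv ≫ H.map p ◁ j.hom ≫
        (φ ((St.f B).map (H.map p)) ((St.f B).map (H.map q))).hom) ≫
          Cell.val ((H.comp (St.f B)).mapComp p q).inv
  rw [f_map₂_val, φ_single, comp_f_mapComp_inv_val]
  have key : ∀ {D : Type v} [Category.{w} D] {x₀ x₁ x₂ x₃ x₄ x₅ : D} (u : x₀ ⟶ x₁) (f₀ : x₂ ≅ x₀)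
      (f₁ : x₂ ⟶ x₃) (f₂ : x₃ ≅ x₅) (f₃ : x₃ ⟶ x₄) (f₄ : x₄ ⟶ x₁),
      f₀.hom ≫ 𝟙 _ ≫ u = f₁ ≫ f₃ ≫ f₄ →
        u = 𝟙 _ ≫ (f₀.inv ≫ f₁ ≫ f₂.hom) ≫ (f₂.inv ≫ f₃ ≫ 𝟙 _) ≫ f₄ := by
    intro D _ x₀ x₁ x₂ x₃ x₄ x₅ u f₀ f₁ f₂ f₃ f₄ h
    simp [← h]
  exact key _ (φ m n) _ (φ ((St.f B).map (H.map p)) n) _ _ e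

theorem comp_comp_congr_right {D : Type v} [Category.{w} D] {x₀ x₁ x₂ x₃ : D} {f : x₀ ⟶ x₁}
    {g : x₁ ⟶ x₂} {h h' : x₂ ⟶ x₃} (e : h = h') : f ≫ g ≫ h = f ≫ g ≫ h' := by
  rw [e]

variable (X Y) in
/-- The strings `(f₁, 1), …, (fₙ, 1)` and `(1, g₁), …, (1, gₘ)`, as strictly functorial
replacements of `(f₁ ⋯ fₙ, 1)` and `(1, g₁ ⋯ gₘ)`. -/
def biModel : GrayTensor.BiModel ((eProd X Y).comp (St.f (X × Y))) where
  l f b := Str.map (inX b.as) f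
  r a _ _ g := Str.map (inY a.as) g
  l_id _ _ := rfl
  l_comp f f' b := Str.map_append (inX b.as) f f'
  r_id _ _ := rfl
  r_comp a _ _ _ g g' := Str.map_append (inY a.as) g g'
  lIso f b := isoMk (inXIso b.as f)
  rIso a _ _ g := isoMk (inYIso a.as g)
  lIso_id a b := cell_ext (by
    refine Eq.trans ?_ (congrArg (𝟙 (𝟙 (a.as, b.as)) ≫ ·)
      (comp_f_mapId_inv_val (eProd X Y) (a, b))).symm
    exact (Category.comp_id (𝟙 (𝟙 (a.as, b.as)))).symm)
  lIso_comp f f' b := lift_comp_aux (eProd X Y) (p := prodHom f (𝟙 b))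
    (q := prodHom f' (𝟙 b)) (pq := prodHom (f ≫ f') (𝟙 b)) rfl
    (Str.map_append (inX b.as) f f' : (_ : St.mk _ ⟶ St.mk _) = _)
    (inXIso b.as f) (inXIso b.as f') (inXIso b.as (f ≫ f'))
    ((comp_comp_congr_right (Category.comp_id _)).trans (appendIso_inXIso b.as f f'))
  rIso_id a b := cell_ext (by
    refine Eq.trans ?_ (congrArg (𝟙 (𝟙 (a.as, b.as)) ≫ ·)
      (comp_f_mapId_inv_val (eProd X Y) (a, b))).symm
    exact (Category.comp_id (𝟙 (𝟙 (a.as, b.as)))).symm)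
  rIso_comp a _ _ _ g g' := lift_comp_aux (eProd X Y) (p := prodHom (𝟙 a) g)
    (q := prodHom (𝟙 a) g') (pq := prodHom (𝟙 a) (g ≫ g')) rfl
    (Str.map_append (inY a.as) g g' : (_ : St.mk _ ⟶ St.mk _) = _)
    (inYIso a.as g) (inYIso a.as g') (inYIso a.as (g ≫ g'))
    ((comp_comp_congr_right (Category.comp_id _)).trans (appendIso_inYIso a.as g g'))

end Comparison

end St

/-! ### Extension of functors along the unit of strictification -/

section Desc

variable {B : Type u} [Bicategory.{w, v} B] {C : Type u₁} [Bicategory.{w₁, v₁} C]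
  (K : B ⥤ᵖ C)

/-- The composite of the values of `K` on a string. -/
def Str.desc : {a b : B} → Str a b → (K.obj a ⟶ K.obj b)
  | _, _, nil a => 𝟙 (K.obj a)
  | _, _, cons f p => K.map f ≫ desc p

/-- The coherence isomorphism between the composite of the values of `K` on a string and the value
of `K` on its composite. -/
def Str.descIso : {a b : B} → (p : Str a b) → (p.desc K ≅ K.map p.eval)
  | _, _, nil a => (K.mapId a).symm
  | _, _, cons f p => whiskerLeftIso (K.map f) (descIso p) ≪≫ (K.mapComp f p.eval).symm ≪≫
      K.map₂Iso (consIso f p)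

variable [Strict C]

theorem Str.desc_append : {a b c : B} → (p : Str a b) → (q : Str b c) →
    (p.append q).desc K = p.desc K ≫ q.desc K
  | _, _, _, nil _, q => (Strict.id_comp (q.desc K)).symm
  | _, _, _, cons f p, q => (congrArg (K.map f ≫ ·) (desc_append p q)).trans
      (Strict.assoc (K.map f) (p.desc K) (q.desc K)).symm

/-- The isomorphisms `descIso` are compatible with concatenation, by induction on the first string
and the coherence axioms of `K`. -/
theorem Str.descIso_append : {a b c : B} → (p : Str a b) → (q : Str b c) →
    ((p.append q).descIso K).hom = eqToHom (p.desc_append K q) ≫ (p.descIso K).hom ▷ q.desc K ≫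
      K.map p.eval ◁ (q.descIso K).hom ≫ (K.mapComp p.eval q.eval).inv ≫
        K.map₂ (appendIso p q).hom
  | _, _, _, nil a, q => by
      have e : eqToHom ((nil a).desc_append K q) = (λ_ (q.desc K)).inv := by
        rw [Strict.leftUnitor_eqToIso]; rfl
      rw [e]
      change (q.descIso K).hom = (λ_ (q.desc K)).inv ≫ (K.mapId a).inv ▷ q.desc K ≫
        K.map (𝟙 a) ◁ (q.descIso K).hom ≫ (K.mapComp (𝟙 a) q.eval).inv ≫ K.map₂ (λ_ q.eval).hom
      simp [← whisker_exchange_assoc]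
  | _, _, _, cons f p, q => by
      have e : eqToHom ((cons f p).desc_append K q) = K.map f ◁ eqToHom (p.desc_append K q) ≫
          (α_ (K.map f) (p.desc K) (q.desc K)).inv := by
        rw [Strict.associator_eqToIso]
        simp
        rfl
      rw [e]
      change K.map f ◁ ((p.append q).descIso K).hom ≫ (K.mapComp f (p.append q).eval).inv ≫
        K.map₂ (consIso f (p.append q)).hom = _ ≫
          (K.map f ◁ (p.descIso K).hom ≫ (K.mapComp f p.eval).inv ≫ K.map₂ (consIso f p).hom) ▷
            q.desc K ≫ K.map (eval (cons f p)) ◁ (q.descIso K).hom ≫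
              (K.mapComp (eval (cons f p)) q.eval).inv ≫ K.map₂ ((consIso f p).inv ▷ q.eval ≫
                (α_ f p.eval q.eval).hom ≫ f ◁ (appendIso p q).hom ≫
                  (consIso f (p.append q)).hom)
      rw [descIso_append p q]
      have h₁ : K.map₂ (consIso f p).hom ▷ K.map q.eval ≫ K.map₂ (consIso f p).inv ▷ K.map q.eval =
          𝟙 _ := by
        rw [← comp_whiskerRight, ← K.map₂_comp, Iso.hom_inv_id, K.map₂_id, id_whiskerRight]
      have h₂ := congrArg (K.map f ◁ ·) (whisker_exchange (p.descIso K).hom (q.descIso K).hom)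
      simp only [Bicategory.whiskerLeft_comp] at h₂
      simp [← whisker_exchange_assoc, reassoc_of% h₁, reassoc_of% h₂]

/-- The strict model of `K e`, for a functor `K` from `B` to a 2-category, which sends a string to
the composite of the values of `K`. -/
def St.descModel : StrictModel ((St.e B).comp K) where
  map p := Str.desc K p
  map_id _ := rfl
  map_comp p q := Str.desc_append K p q
  iso p := Str.descIso K p
  iso_id a := by
    change (K.mapId a.as).inv = 𝟙 (𝟙 (K.obj a.as)) ≫ (K.mapId a.as).inv ≫ K.map₂ (𝟙 (𝟙 a.as))
    simp
  iso_comp p q := Str.descIso_append K p q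

end Desc

/-! ### The unit and counit of strictification are mutually inverse -/

namespace St

section

variable {C : Type u₁} [Category.{v₁} C]

theorem comp_id_eq_id_comp {x y : C} (f : x ⟶ y) : f ≫ 𝟙 y = 𝟙 x ≫ f := by
  simp

theorem id_comp_id_comp_id (x : C) : (𝟙 x ≫ 𝟙 x) ≫ 𝟙 x = 𝟙 x ≫ 𝟙 x := by
  simp

end

/-- The cancellation of coherence isomorphisms used for the compatibility of `iconEF` with
composition. -/
theorem comp_id_eq_conj {D : Type u} [Bicategory.{w, v} D] {a b c : D} (p : a ⟶ b) (q : b ⟶ c)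
    {y z : a ⟶ c} {i : p ≫ q ≅ p ≫ q} (hi : i.hom = 𝟙 (p ≫ q)) (j : p ≫ q ≅ z) (k : p ≫ q ⟶ y) :
    k ≫ 𝟙 y = ((i.inv ≫ 𝟙 p ▷ q ≫ j.hom) ≫ j.inv ≫ p ◁ 𝟙 q ≫ k) ≫ 𝟙 y := by
  obtain rfl : i = Iso.refl (p ≫ q) := Iso.ext hi
  simp

variable (B : Type u) [Bicategory.{w, v} B]

/-- The identity icon between `e f` and the identity functor of `B`. -/
def iconFE : Icon ((St.f B).comp (St.e B)) (Pseudofunctor.id B) where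
  obj_eq _ := rfl
  app g := HCell.ofHom (𝟙 g)
  naturality {a b g h} η := by
    change Cell.val ((St.f B).map₂ η) ≫ 𝟙 h = 𝟙 g ≫ η
    rw [f_map₂_val]
    exact comp_id_eq_id_comp η
  app_id a := by
    change (𝟙 (𝟙 a) ≫ Cell.val ((St.f B).mapId a).inv) ≫ 𝟙 (𝟙 a) = 𝟙 (𝟙 a) ≫ 𝟙 (𝟙 a)
    rw [f_mapId_inv_val]
    exact id_comp_id_comp_id (𝟙 a)
  app_comp g h := by
    change ((φ ((St.f B).map g) ((St.f B).map h)).hom ≫ Cell.val ((St.f B).mapComp g h).inv) ≫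
      𝟙 (g ≫ h) = (𝟙 g ▷ h ≫ g ◁ 𝟙 h) ≫ 𝟙 (g ≫ h)
    rw [f_mapComp_inv_val, φ_single, id_whiskerRight, whiskerLeft_id]
    rfl

/-- The icon between `f e` and the identity functor of `st B`, whose component at a string is the
identity 2-cell of its composite. -/
def iconEF : Icon ((St.e B).comp (St.f B)) (Pseudofunctor.id (St B)) where
  obj_eq _ := rfl
  app p := HCell.ofHom (isoMk (p := (St.f B).map (ev p)) (q := p) (Iso.refl (ev p))).hom
  naturality {a b p q} η := cell_ext (by
    change Cell.val ((St.f B).map₂ (Cell.val η)) ≫ 𝟙 (ev q) = 𝟙 (ev p) ≫ Cell.val η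
    rw [f_map₂_val]
    exact comp_id_eq_id_comp (Cell.val η))
  app_id a := cell_ext (by
    change Cell.val (((St.e B).comp (St.f B)).mapId a).inv ≫ 𝟙 (𝟙 a.as) = 𝟙 (𝟙 a.as) ≫ 𝟙 (𝟙 a.as)
    rw [comp_f_mapId_inv_val]
    rfl)
  app_comp p q := cell_ext (by
    change Cell.val (((St.e B).comp (St.f B)).mapComp p q).inv ≫ 𝟙 (ev (p ≫ q)) =
      (((φ ((St.f B).map (ev p)) ((St.f B).map (ev q))).inv ≫ 𝟙 (ev p) ▷ ev q ≫
        (φ p ((St.f B).map (ev q))).hom) ≫ (φ p ((St.f B).map (ev q))).inv ≫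
          ev p ◁ 𝟙 (ev q) ≫ (φ p q).hom) ≫ 𝟙 (ev (p ≫ q))
    rw [comp_f_mapComp_inv_val]
    exact comp_id_eq_conj (ev p) (ev q) (φ_single (ev p) (ev q)) (φ p ((St.f B).map (ev q)))
      (φ p q).hom)

theorem isInv_iconFE : (iconFE B).IsInv := fun g => HCell.isInv_ofIso (Iso.refl g)

theorem isInv_iconEF : (iconEF B).IsInv := fun p =>
  HCell.isInv_ofIso (isoMk (p := (St.f B).map (ev p)) (q := p) (Iso.refl (ev p)))

variable (X Y : Type u) [Bicategory.{w, v} X] [Bicategory.{w, v} Y]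

/-- The product of the identity icons `e f ⇒ 1`. -/
def iconFEProd : Icon ((prodMap (St.f X) (St.f Y)).comp (eProd X Y))
    (Pseudofunctor.id (X × Y)) where
  obj_eq _ := rfl
  app g := HCell.ofHom (𝟙 g)
  naturality η := Prod.ext ((iconFE X).naturality η.1) ((iconFE Y).naturality η.2)
  app_id a := Prod.ext ((iconFE X).app_id a.1) ((iconFE Y).app_id a.2)
  app_comp g h := Prod.ext ((iconFE X).app_comp g.1 h.1) ((iconFE Y).app_comp g.2 h.2)

/-- The product of the icons `f e ⇒ 1`. -/
def iconEFProd : Icon ((eProd X Y).comp (prodMap (St.f X) (St.f Y)))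
    (Pseudofunctor.id (St X × St Y)) where
  obj_eq _ := rfl
  app p := HCell.ofHom (prodHom₂ ((iconEF X).app p.1) ((iconEF Y).app p.2))
  naturality η := Prod.ext ((iconEF X).naturality η.1) ((iconEF Y).naturality η.2)
  app_id a := Prod.ext ((iconEF X).app_id a.1) ((iconEF Y).app_id a.2)
  app_comp p q := Prod.ext ((iconEF X).app_comp p.1 q.1) ((iconEF Y).app_comp p.2 q.2)

theorem isInv_iconFEProd : (iconFEProd X Y).IsInv := fun g => HCell.isInv_ofIso (Iso.refl g)

theorem isInv_iconEFProd : (iconEFProd X Y).IsInv := fun {a b} p => by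
  let i : ((eProd X Y).comp (prodMap (St.f X) (St.f Y))).map p ≅ p := Iso.prod
    (isoMk (p := (St.f X).map (ev p.1)) (q := p.1) (Iso.refl (ev p.1)))
    (isoMk (p := (St.f Y).map (ev p.2)) (q := p.2) (Iso.refl (ev p.2)))
  exact HCell.isInv_ofIso i

end St

/-! ### The universal cubical functor -/

namespace GrayTensor

open Gray

variable {A B : Type u} [Bicategory.{w, v} A] [Bicategory.{w, v} B] {C : Type u₁}
  [Bicategory.{w₁, v₁} C]

variable [Strict A] [Strict B]

/-- A 2-functor out of `A ⊗ B` is determined by its composite with the universal cubical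
functor. -/
theorem eq_of_c_comp_eq {F G : StrictPseudofunctor (GrayTensor A B) C}
    (h : (c A B).comp F.toPseudofunctor = (c A B).comp G.toPseudofunctor) : F = G := by
  have hm {x y : A × B} (p : x ⟶ y) : HEq (F.map ((c A B).map p)) (G.map ((c A B).map p)) :=
    congr_arg_heq (fun K : (A × B) ⥤ᵖ C => K.map p) h
  have hm₂ {x y : A × B} {p q : x ⟶ y} (η : p ⟶ q) :
      HEq (F.map₂ ((c A B).map₂ η)) (G.map₂ ((c A B).map₂ η)) :=
    congr_arg_heq (fun K : (A × B) ⥤ᵖ C => K.map₂ η) h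
  have hc {x y z : A × B} (p : x ⟶ y) (q : y ⟶ z) :
      HEq (F.map₂ (cComp p q).hom) (G.map₂ (cComp p q).hom) :=
    ((IsEqToHom.heq_comp _ (F.isEqToHom_mapComp _ _)).symm.trans
      (congr_arg_heq (fun K : (A × B) ⥤ᵖ C => (K.mapComp p q).hom) h)).trans
        (IsEqToHom.heq_comp _ (G.isEqToHom_mapComp _ _))
  have e₂ {x y : GrayTensor A B} {p q p' q' : x ⟶ y} (hp : p = p') (hq : q = q') {η : p ⟶ q}
      {θ : p' ⟶ q'} (hη : HEq η θ) (hh : HEq (F.map₂ η) (G.map₂ η)) :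
      HEq (F.map₂ θ) (G.map₂ θ) := by
    subst hp hq hη
    exact hh
  refine hom_ext (fun x => congrArg (fun K : (A × B) ⥤ᵖ C => K.obj (x.fst, x.snd)) h) ?_ ?_ ?_ ?_ ?_
  · intro a a' f b
    rw [← c_map_left f b]
    exact hm _
  · intro a b b' g
    rw [← c_map_right a g]
    exact hm _
  · intro a a' f f' α b
    exact e₂ (c_map_left f b) (c_map_left f' b) (c_map₂_left_heq α b) (hm₂ _)
  · intro a b b' g g' β
    exact e₂ (c_map_right a g) (c_map_right a g') (c_map₂_right_heq a β) (hm₂ _)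
  · intro a a' b b' f g
    refine e₂ ?_ ?_ (cComp_swap_heq f g) (hc _ _)
    · exact congrArg₂ (fun s t => L s b ≫ R a' t) (Strict.id_comp f) (Strict.comp_id g)
    · exact congrArg₂ (fun s t => s ≫ t) (c_map_right a g) (c_map_left f b')

/-- On 1-cells `c` is a strict section of the projection, because `(f, 1) ≫ (1, g) = (f, g)` in a
2-category. -/
theorem proj_map_c {x y : A × B} (p : x ⟶ y) : (proj A B).map ((c A B).map p) = p :=
  ((proj A B).map_comp (L p.1 x.2) (R y.1 p.2)).trans <|
    (congrArg₂ (fun (s : (x.1, x.2) ⟶ (y.1, x.2)) (t : (y.1, x.2) ⟶ (y.1, y.2)) => s ≫ t)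
      (proj_map_L p.1 x.2) (proj_map_R y.1 p.2)).trans
      (Prod.ext (Strict.comp_id p.1) (Strict.id_comp p.2))

/-- On 2-cells `c` is a strict section of the projection, up to the equalities `proj_map_c`. -/
theorem proj_map₂_c_heq {x y : A × B} {p q : x ⟶ y} (η : p ⟶ q) :
    HEq ((proj A B).map₂ ((c A B).map₂ η)) η := by
  have h₁ : HEq ((proj A B).map₂ (L₂ η.1 x.2 ▷ R y.1 p.2)) (prodHom₂ η.1 (𝟙 p.2)) := by
    refine ((proj A B).map₂_whiskerRight_heq _ _ (proj_map_L p.1 x.2) (proj_map_L q.1 x.2)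
      (proj_map_R y.1 p.2) (θ := prodHom₂ η.1 (𝟙 (𝟙 x.2))) ?_).trans ?_
    · rw [proj_map₂_L₂]
      exact (conj_eqToHom_iff_heq _ _ (proj_map_L p.1 x.2) (proj_map_L q.1 x.2)).mp rfl
    · exact prod_heq (Prod.ext (Strict.comp_id p.1) (Strict.id_comp p.2))
        (Prod.ext (Strict.comp_id q.1) (Strict.id_comp p.2)) (whiskerRight_id_heq η.1)
        (heq_of_eq_of_heq (id_whiskerRight (𝟙 x.2) p.2)
          (congr_arg_heq (fun s => 𝟙 s) (Strict.id_comp p.2)))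
  have h₂ : HEq ((proj A B).map₂ (L q.1 x.2 ◁ R₂ y.1 η.2)) (prodHom₂ (𝟙 q.1) η.2) := by
    refine ((proj A B).map₂_whiskerLeft_heq _ _ (proj_map_L q.1 x.2) (proj_map_R y.1 p.2)
      (proj_map_R y.1 q.2) (θ := prodHom₂ (𝟙 (𝟙 y.1)) η.2) ?_).trans ?_
    · rw [proj_map₂_R₂]
      exact (conj_eqToHom_iff_heq _ _ (proj_map_R y.1 p.2) (proj_map_R y.1 q.2)).mp rfl
    · exact prod_heq (Prod.ext (Strict.comp_id q.1) (Strict.id_comp p.2))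
        (Prod.ext (Strict.comp_id q.1) (Strict.id_comp q.2))
        (heq_of_eq_of_heq (whiskerLeft_id q.1 (𝟙 y.1))
          (congr_arg_heq (fun s => 𝟙 s) (Strict.comp_id q.1)))
        (id_whiskerLeft_heq η.2)
  have h : HEq ((proj A B).map₂ ((c A B).map₂ η)) (prodHom₂ η.1 (𝟙 p.2) ≫ prodHom₂ (𝟙 q.1) η.2) :=
    (heq_of_eq ((proj A B).map₂_comp (L₂ η.1 x.2 ▷ R y.1 p.2) (L q.1 x.2 ◁ R₂ y.1 η.2))).trans
      (comp_heq_comp (proj_map_c p) (proj_map_c (prodHom q.1 p.2)) (proj_map_c q) h₁ h₂)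
  exact h.trans (heq_of_eq (Prod.ext (Category.comp_id η.1) (Category.id_comp η.2)))

variable (A B) in
/-- The identity icon between the composite `A × B → A ⊗ B → A × B` and the identity functor. -/
def iconCProj : Icon ((c A B).comp (proj A B).toPseudofunctor) (Pseudofunctor.id (A × B)) where
  obj_eq _ := rfl
  app p := HCell.ofHom (eqToHom (proj_map_c p))
  naturality η := IsEqToHom.comp_eq_comp (.eqToHom _) (.eqToHom _) (proj_map₂_c_heq η)
  app_id x := IsEqToHom.eq
    ((((isEqToHom_c_mapId x).map₂ (proj A B).toPseudofunctor).comp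
      ((proj A B).isEqToHom_mapId _)).inv.comp (.eqToHom _))
    ((IsEqToHom.id _).comp (.id _))
  app_comp p q := IsEqToHom.eq
    (IsEqToHom.comp (IsEqToHom.inv (IsEqToHom.comp (isEqToHom_map₂_cComp (proj A B) p q
      ⟨_, proj_map₂_S_inv q.1 p.2⟩) ((proj A B).isEqToHom_mapComp _ _))) (.eqToHom _))
    (IsEqToHom.comp (IsEqToHom.comp (.whiskerRight (.eqToHom (proj_map_c p)) _)
      (.whiskerLeft _ (.eqToHom (proj_map_c q)))) (IsEqToHom.id (p ≫ q)))

variable (A B) in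
theorem isInv_iconCProj : (iconCProj A B).IsInv := fun p =>
  HCell.isInv_ofIso (eqToIso (proj_map_c p))

end GrayTensor

/-! ### Functors isomorphic to one with values in a strictification -/

namespace St

section Lift

variable {B : Type u} [Bicategory.{w, v} B] {A : Type u₁} [Bicategory.{w₁, v₁} A]

theorem isEqToHom_val {a b : St B} {p q : a ⟶ b} {η : p ⟶ q} (h : IsEqToHom η) :
    IsEqToHom (Cell.val η) := by
  obtain ⟨rfl, rfl⟩ := h
  exact .id _

/-- The cancellation of coherence isomorphisms used for the compatibility of `liftIcon` with
composition. -/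
theorem eq_conj_comp {D : Type u} [Bicategory.{w, v} D] {a b c : D} {m m' : a ⟶ b} {n n' : b ⟶ c}
    {x y z r : a ⟶ c} (i : m ≅ m') (j : n ≅ n') {k : m' ≫ n' ≅ m' ≫ n'} (hk : k.hom = 𝟙 _)
    (k₁ : m ≫ n' ≅ x) (k₂ : m ≫ n ≅ y) (s : m' ≫ n' ⟶ z) (t : z ⟶ r) :
    s ≫ t = ((k.inv ≫ i.inv ▷ n' ≫ k₁.hom) ≫ k₁.inv ≫ m ◁ j.inv ≫ k₂.hom) ≫
      (((k₂.inv ≫ m ◁ j.hom) ≫ i.hom ▷ n') ≫ s) ≫ t := by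
  obtain rfl : k = Iso.refl _ := Iso.ext hk
  simp

/-- The inverse of the defining icon of `lift H m ζ`. -/
def liftIcon (H : A ⥤ᵖ B) (m : ∀ {a b : A}, (a ⟶ b) → (St.mk (H.obj a) ⟶ St.mk (H.obj b)))
    (ζ : ∀ {a b : A} (f : a ⟶ b), ev (m f) ≅ H.map f) :
    Icon (H.comp (St.f B)) (lift H m ζ) where
  obj_eq _ := rfl
  app f := HCell.ofHom (isoMk (p := (H.comp (St.f B)).map f) (q := m f) (ζ f).symm).hom
  naturality {a b f g} η := cell_ext (by
    change Cell.val ((St.f B).map₂ (H.map₂ η)) ≫ (ζ g).inv =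
      (ζ f).inv ≫ (ζ f).hom ≫ H.map₂ η ≫ (ζ g).inv
    rw [f_map₂_val, Iso.inv_hom_id_assoc]
    rfl)
  app_id a := cell_ext (by
    change Cell.val ((H.comp (St.f B)).mapId a).inv ≫ (ζ (𝟙 a)).inv =
      𝟙 (𝟙 (H.obj a)) ≫ (𝟙 (𝟙 (H.obj a)) ≫ (H.mapId a).inv) ≫ (ζ (𝟙 a)).inv
    rw [comp_f_mapId_inv_val, Category.id_comp, Category.id_comp]
    rfl)
  app_comp f g := cell_ext (by
    refine (congrArg (· ≫ (ζ (f ≫ g)).inv) (comp_f_mapComp_inv_val H f g)).trans ?_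
    exact eq_conj_comp (ζ f) (ζ g) (φ_single (H.map f) (H.map g))
      (φ (m f) ((St.f B).map (H.map g))) (φ (m f) (m g)) (H.mapComp f g).inv (ζ (f ≫ g)).inv)

end Lift

end St

/-! ### Composites of 2-functors with the universal cubical functor -/

namespace GrayTensor

open Gray

section

variable {C : Type u₁} [Bicategory.{w₁, v₁} C] {D : Type u₂} [Bicategory.{w₂, v₂} D]
  {E : Type u₃} [Bicategory.{w₃, v₃} E]

/-- The comparison of a strict model `N` of `H P` at a composite `p ≫ p'`, in terms of comparisons
`i`, `i'` for `H` at 1-cells `q = P p` and `q' = P p'`. -/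
theorem strictModel_iso_comp_aux (P : StrictPseudofunctor C D) (H : D ⥤ᵖ E)
    (N : StrictModel (P.toPseudofunctor.comp H)) {x y z : C} {p : x ⟶ y} {p' : y ⟶ z}
    {q : P.obj x ⟶ P.obj y} {q' : P.obj y ⟶ P.obj z} {r : P.obj x ⟶ P.obj z} (h : P.map p = q)
    (h' : P.map p' = q') (hr : P.map (p ≫ p') = r) (hq : q ≫ q' = r)
    {m : H.obj (P.obj x) ⟶ H.obj (P.obj y)} {m' : H.obj (P.obj y) ⟶ H.obj (P.obj z)}
    (hm : N.map p = m) (hm' : N.map p' = m') (hmm : N.map (p ≫ p') = m ≫ m')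
    (i : m ≅ H.map q) (i' : m' ≅ H.map q')
    (e : (N.iso p).hom = eqToHom hm ≫ (i ≪≫ H.map₂Iso (eqToIso h.symm)).hom)
    (e' : (N.iso p').hom = eqToHom hm' ≫ (i' ≪≫ H.map₂Iso (eqToIso h'.symm)).hom) :
    (N.iso (p ≫ p')).hom ≫ H.map₂ (eqToHom hr) = eqToHom hmm ≫ i.hom ▷ m' ≫ H.map q ◁ i'.hom ≫
      (H.mapComp q q').inv ≫ H.map₂ (eqToHom hq) := by
  subst h h' hm hm' hr
  have e₁ : (N.iso p).hom = i.hom := by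
    rw [e]
    change 𝟙 (N.map p) ≫ i.hom ≫ H.map₂ (𝟙 (P.map p)) = i.hom
    rw [H.map₂_id]
    exact (Category.id_comp _).trans (Category.comp_id _)
  have e₁' : (N.iso p').hom = i'.hom := by
    rw [e']
    change 𝟙 (N.map p') ≫ i'.hom ≫ H.map₂ (𝟙 (P.map p')) = i'.hom
    rw [H.map₂_id]
    exact (Category.id_comp _).trans (Category.comp_id _)
  rw [N.iso_comp, e₁, e₁']
  change (eqToHom _ ≫ i.hom ▷ N.map p' ≫ H.map (P.map p) ◁ i'.hom ≫
    (H.mapComp (P.map p) (P.map p')).inv ≫ H.map₂ (P.mapComp p p').inv) ≫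
      H.map₂ (𝟙 (P.map (p ≫ p'))) = _
  rw [P.mapComp_eq_eqToIso, H.map₂_id]
  exact Category.comp_id _

end

variable {A B : Type u} [Bicategory.{w, v} A] [Bicategory.{w, v} B] [Strict A] [Strict B]
  {E : Type u₁} [Bicategory.{w₁, v₁} E] [Strict E]

theorem BiModel.strictModel_map {H : (A × B) ⥤ᵖ E} (M : BiModel H) {a a' : A} {b b' : B}
    (f : a ⟶ a') (g : b ⟶ b') :
    M.genModel.strictModel.map (L f b ≫ R a' g) = M.l f b ≫ M.r a' g :=
  (M.genModel.strictModel.map_comp (L f b) (R a' g)).trans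
    (congrArg₂ (· ≫ ·) (M.genModel.strictModel_map_L f b) (M.genModel.strictModel_map_R a' g))

/-- The comparison at `c (f, g) = (f ⊗ 1) ≫ (1 ⊗ g)` of the strict model determined by a
`BiModel`. -/
theorem BiModel.strictModel_iso {H : (A × B) ⥤ᵖ E} (M : BiModel H) {a a' : A} {b b' : B}
    (f : a ⟶ a') (g : b ⟶ b') :
    (M.genModel.strictModel.iso (L f b ≫ R a' g)).hom ≫
        H.map₂ (eqToHom (proj_map_c (prodHom f g))) =
      eqToHom (M.strictModel_map f g) ≫ (M.lIso f b).hom ▷ M.r a' g ≫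
        H.map (prodHom f (𝟙 b)) ◁ (M.rIso a' g).hom ≫ (H.mapComp _ _).inv ≫
          H.map₂ (eqToHom (Prod.ext (Strict.comp_id f) (Strict.id_comp g) :
            prodHom f (𝟙 b) ≫ prodHom (𝟙 a') g = prodHom f g)) :=
  strictModel_iso_comp_aux (proj A B) H M.genModel.strictModel (proj_map_L f b) (proj_map_R a' g)
    (proj_map_c (prodHom f g)) _ (M.genModel.strictModel_map_L f b)
    (M.genModel.strictModel_map_R a' g) _ (M.lIso f b) (M.rIso a' g)
    (M.genModel.strictModel_iso_L f b) (M.genModel.strictModel_iso_R a' g)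

/-- The icon from the composite of the universal cubical functor and the 2-functor determined by
a `BiModel` of `H` to `H` itself. -/
def BiModel.iconC {H : (A × B) ⥤ᵖ E} (M : BiModel H) :
    Icon ((c A B).comp M.genModel.strictModel.functor.toPseudofunctor) H :=
  ((M.genModel.strictModel.icon.whiskerLeft (c A B)).comp (Icon.assocInv _ _ _)).comp
    (((iconCProj A B).whiskerRight H).comp (Icon.leftUnitor H))

theorem BiModel.iconC_app {H : (A × B) ⥤ᵖ E} (M : BiModel H) {x y : A × B} (p : x ⟶ y) :
    M.iconC.app p = HCell.ofHom (eqToHom (M.strictModel_map p.1 p.2) ≫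
      (M.lIso p.1 x.2).hom ▷ M.r y.1 p.2 ≫ H.map (prodHom p.1 (𝟙 x.2)) ◁ (M.rIso y.1 p.2).hom ≫
        (H.mapComp _ _).inv ≫ H.map₂ (eqToHom (Prod.ext (Strict.comp_id p.1) (Strict.id_comp p.2) :
          prodHom p.1 (𝟙 x.2) ≫ prodHom (𝟙 y.1) p.2 = p))) := by
  have e := M.strictModel_iso p.1 p.2
  have h : M.iconC.app p = HCell.ofHom (((M.genModel.strictModel.iso
      (L p.1 x.2 ≫ R y.1 p.2)).hom ≫ 𝟙 _) ≫ H.map₂ (eqToHom (proj_map_c p)) ≫ 𝟙 _) := rfl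
  rw [h]
  refine congrArg HCell.ofHom (Eq.trans ?_ e)
  exact congrArg₂ (· ≫ ·) (Category.comp_id _) (Category.comp_id _)

end GrayTensor

/-! ### The comparison 2-functor and its pseudo-inverse -/

namespace St

variable (X Y : Type u) [Bicategory.{w, v} X] [Bicategory.{w, v} Y]

open GrayTensor

/-- The 2-functor `st X ⊗ st Y → st (X × Y)`. -/
def chi : StrictPseudofunctor (GrayTensor (St X) (St Y)) (St (X × Y)) :=
  (biModel X Y).genModel.strictModel.functor

/-- The icon between `chi` and the composite of `st X ⊗ st Y → st X × st Y → X × Y` with `f`. -/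
def iconChi : Icon (chi X Y).toPseudofunctor
    ((proj (St X) (St Y)).toPseudofunctor.comp ((eProd X Y).comp (St.f (X × Y)))) :=
  (biModel X Y).genModel.strictModel.icon

/-- The functor `X × Y → st X ⊗ st Y` which is extended to `st (X × Y)`. -/
abbrev fProdC : (X × Y) ⥤ᵖ GrayTensor (St X) (St Y) :=
  (prodMap (St.f X) (St.f Y)).comp (c (St X) (St Y))

/-- The 2-functor `st (X × Y) → st X ⊗ st Y`. -/
def chiBar : StrictPseudofunctor (St (X × Y)) (GrayTensor (St X) (St Y)) :=
  (descModel (fProdC X Y)).functor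

/-- The icon between `chiBar` and the composite of `e` with the functor which it extends. -/
def iconChiBar : Icon (chiBar X Y).toPseudofunctor ((St.e (X × Y)).comp (fProdC X Y)) :=
  (descModel (fProdC X Y)).icon

theorem isEqToHom_descIso_single {B : Type u} [Bicategory.{w, v} B] {C : Type u₁}
    [Bicategory.{w₁, v₁} C] [Strict C] (K : B ⥤ᵖ C) {a b : B} (g : a ⟶ b) :
    IsEqToHom (Str.descIso K (.cons g (.nil b))).hom := by
  have h : (Str.descIso K (.cons g (.nil b))).hom = (ρ_ (K.map g)).hom := by
    change K.map g ◁ (K.mapId b).inv ≫ (K.mapComp g (𝟙 b)).inv ≫ K.map₂ (ρ_ g).hom =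
      (ρ_ (K.map g)).hom
    simp
  rw [h]
  exact IsEqToHom.rightUnitor _

/-- The 2-functor `st B → C` given by the strict model `descModel K` extends `K` strictly along
`f : B → st B`, since the coherence isomorphism for a string of length one is a right unitor
of `C`. -/
theorem f_comp_desc {B : Type u} [Bicategory.{w, v} B] {C : Type u₁}
    [Bicategory.{w₁, v₁} C] [Strict C] (K : B ⥤ᵖ C) :
    (St.f B).comp (descModel K).functor.toPseudofunctor = K := by
  let α : Icon ((St.f B).comp (descModel K).functor.toPseudofunctor) K :=
    (((descModel K).icon.whiskerLeft (St.f B)).comp (Icon.assocInv (St.f B) (St.e B) K)).comp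
      (((iconFE B).whiskerRight K).comp (Icon.leftUnitor K))
  have hα {a b : B} (g : a ⟶ b) : IsEqToHom (((Str.descIso K (.cons g (.nil b))).hom ≫
      𝟙 (K.map g)) ≫ K.map₂ (𝟙 g) ≫ 𝟙 (K.map g)) :=
    ((isEqToHom_descIso_single K g).comp (.id _)).comp (((IsEqToHom.id g).map₂ K).comp (.id _))
  exact α.eq_of_app (fun g => heq_of_eq (hα g).1) (fun g => (hα g).ofHom_eq _)

variable {X Y} in
/-- The constraint of `e × e` at `(p, 1)`, `(1, q)` consists of the unitors, because one of the two
concatenated strings is empty in each variable. -/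
theorem eProd_mapComp_inv {a b : St X × St Y} (p : a ⟶ b) (h : prodHom p.1 (𝟙 a.2) ≫
    prodHom (𝟙 b.1) p.2 = p) :
    ((eProd X Y).mapComp (prodHom p.1 (𝟙 a.2)) (prodHom (𝟙 b.1) p.2)).inv ≫
      (eProd X Y).map₂ (eqToHom h) = (Iso.prod (ρ_ (ev p.1)) (λ_ (ev p.2))).hom := by
  have h₀ : ∀ {C : Type v} [Category.{w} C] {x y z : C} (η : x ⟶ y) {i : y ⟶ z} {j : z ⟶ y},
      IsEqToHom i → IsEqToHom j → (η ≫ i) ≫ j = η := by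
    rintro C _ x y z η i j ⟨rfl, rfl⟩ ⟨_, rfl⟩
    simp
  refine Prod.ext ?_ ?_
  · refine (congrArg (· ≫ Cell.val (eqToHom h).1) (Str.appendIso_nil p.1)).trans ?_
    exact h₀ _ (.eqToHom _) (isEqToHom_val (IsEqToHom.fst (.eqToHom h)))
  · refine Eq.trans (congrArg (· ≫ _) (Category.comp_id _).symm) (h₀ _ (.id _)
      (isEqToHom_val (IsEqToHom.snd (.eqToHom h))))

variable {X Y} in
/-- The comparison at `c (p, q)` of the strict model defining `chi` is the isomorphism which defines
the comparison functor of strings. -/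
theorem isoMk_hatIso {a b : St X × St Y} (p : a ⟶ b) (h : prodHom p.1 (𝟙 a.2) ≫
    prodHom (𝟙 b.1) p.2 = p) :
    ((biModel X Y).lIso p.1 a.2).hom ▷ (biModel X Y).r b.1 p.2 ≫
      ((eProd X Y).comp (St.f (X × Y))).map (prodHom p.1 (𝟙 a.2)) ◁
        ((biModel X Y).rIso b.1 p.2).hom ≫
          (((eProd X Y).comp (St.f (X × Y))).mapComp _ _).inv ≫
            ((eProd X Y).comp (St.f (X × Y))).map₂ (eqToHom h) =
      (isoMk (p := hatMap p) (q := ((eProd X Y).comp (St.f (X × Y))).map p) (hatIso p)).hom := by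
  have key : ∀ {C : Type v} [Category.{w} C] {x₀ x₁ x₂ x₃ x₄ x₅ x₆ : C} (f₀ : x₀ ⟶ x₁)
      (f₁ : x₁ ⟶ x₂) (f₂ : x₂ ≅ x₃) (f₃ : x₂ ⟶ x₄) {f₄ : x₄ ⟶ x₄} (f₅ : x₄ ⟶ x₅) (f₆ : x₅ ⟶ x₆)
      {f₇ : x₄ ⟶ x₆}, f₄ = 𝟙 x₄ → f₅ ≫ f₆ = f₇ →
      (f₀ ≫ f₁ ≫ f₂.hom) ≫ (f₂.inv ≫ f₃ ≫ f₄) ≫ f₅ ≫ f₆ = f₀ ≫ f₁ ≫ f₃ ≫ f₇ := by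
    rintro C _ x₀ x₁ x₂ x₃ x₄ x₅ x₆ f₀ f₁ f₂ f₃ f₄ f₅ f₆ f₇ rfl rfl
    simp
  refine cell_ext ?_
  refine key _ _ (φ ((St.f (X × Y)).map ((eProd X Y).map (prodHom p.1 (𝟙 a.2))))
    ((biModel X Y).r b.1 p.2)) _ _ _ (φ_single _ _) ?_
  rw [comp_f_mapComp_inv_val]
  exact (congrArg (_ ≫ ·) (f_map₂_val _)).trans (eProd_mapComp_inv p h)

/-- Both functors are isomorphic to `f (e × e)` by icons. Their composite has identity components by
`isoMk_hatIso`, so the functors are equal. -/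
theorem c_comp_chi : (c (St X) (St Y)).comp (chi X Y).toPseudofunctor = St.hat X Y := by
  let α := (biModel X Y).iconC.comp (liftIcon (eProd X Y) hatMap hatIso)
  have hα {a b : St X × St Y} (p : a ⟶ b) :
      α.app p = HCell.ofHom (eqToHom ((biModel X Y).strictModel_map p.1 p.2)) := by
    have h₁ := ((biModel X Y).iconC_app p).trans
      (congrArg (fun t => HCell.ofHom (_ ≫ t)) (isoMk_hatIso p _))
    refine (congrArg (fun t => HCell.vcomp t
      ((liftIcon (eProd X Y) hatMap hatIso).app p)) h₁).trans ?_
    refine congrArg HCell.ofHom ?_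
    exact (Category.assoc _ _ _).trans ((congrArg (_ ≫ ·) (Iso.hom_inv_id _)).trans
      (Category.comp_id _))
  exact α.eq_of_app (fun p => heq_of_eq ((biModel X Y).strictModel_map p.1 p.2))
    (fun p => (hα p).trans ((IsEqToHom.eqToHom _).ofHom_eq _))

/-- Up to invertible icons the composite is `c (f × f) e f (e × e)` after the projection, which
reduces to `c` after the projection. -/
theorem iconIso_chi_chiBar : IconIso ((chi X Y).toPseudofunctor.comp (chiBar X Y).toPseudofunctor)
    (StrictPseudofunctor.id (GrayTensor (St X) (St Y))).toPseudofunctor := by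
  have h₁ : IconIso (chi X Y).toPseudofunctor _ :=
    ⟨iconChi X Y, (biModel X Y).genModel.strictModel.isInv_icon⟩
  have h₂ : IconIso (chiBar X Y).toPseudofunctor _ :=
    ⟨iconChiBar X Y, (descModel (fProdC X Y)).isInv_icon⟩
  have hf : IconIso ((St.f (X × Y)).comp (St.e (X × Y))) _ := ⟨iconFE _, isInv_iconFE _⟩
  have he : IconIso ((eProd X Y).comp (prodMap (St.f X) (St.f Y))) _ :=
    ⟨iconEFProd X Y, isInv_iconEFProd X Y⟩
  refine ((h₁.comp_right _).trans (h₂.comp_left _)).trans ((IconIso.assoc _ _ _).trans ?_)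
  have h₃ : IconIso (((eProd X Y).comp (St.f (X × Y))).comp
      ((St.e (X × Y)).comp (fProdC X Y))) (c (St X) (St Y)) := by
    refine (IconIso.assoc _ _ _).trans ?_
    refine (IconIso.comp_left _ ((IconIso.assoc _ _ _).symm.trans
      ((hf.comp_right _).trans (IconIso.id_comp _)))).trans ?_
    exact (IconIso.assoc _ _ _).symm.trans ((he.comp_right _).trans (IconIso.id_comp _))
  exact (h₃.comp_left _).trans (IconIso.symm (iconIso_projC (St X) (St Y)))

/-- Up to invertible icons the composite is `f (e × e)` after the projection after `c (f × f) e`,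
which reduces to `f e`. -/
theorem iconIso_chiBar_chi : IconIso ((chiBar X Y).toPseudofunctor.comp (chi X Y).toPseudofunctor)
    (StrictPseudofunctor.id (St (X × Y))).toPseudofunctor := by
  have h₁ : IconIso (chi X Y).toPseudofunctor _ :=
    ⟨iconChi X Y, (biModel X Y).genModel.strictModel.isInv_icon⟩
  have h₂ : IconIso (chiBar X Y).toPseudofunctor _ :=
    ⟨iconChiBar X Y, (descModel (fProdC X Y)).isInv_icon⟩
  have hf : IconIso ((prodMap (St.f X) (St.f Y)).comp (eProd X Y)) _ :=
    ⟨iconFEProd X Y, isInv_iconFEProd X Y⟩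
  have he : IconIso ((St.e (X × Y)).comp (St.f (X × Y))) _ := ⟨iconEF _, isInv_iconEF _⟩
  have hc : IconIso ((c (St X) (St Y)).comp (proj (St X) (St Y)).toPseudofunctor) _ :=
    ⟨iconCProj _ _, isInv_iconCProj _ _⟩
  refine ((h₁.comp_left _).trans (h₂.comp_right _)).trans ((IconIso.assoc _ _ _).trans ?_)
  have h₃ : IconIso ((fProdC X Y).comp ((proj (St X) (St Y)).toPseudofunctor.comp
      ((eProd X Y).comp (St.f (X × Y))))) (St.f (X × Y)) := by
    refine (IconIso.assoc _ _ _).trans ?_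
    refine (IconIso.comp_left _ ((IconIso.assoc _ _ _).symm.trans
      ((hc.comp_right _).trans (IconIso.id_comp _)))).trans ?_
    exact (IconIso.assoc _ _ _).symm.trans ((hf.comp_right _).trans (IconIso.id_comp _))
  exact (h₃.comp_left _).trans he

end St

theorem proposition5p6 (X Y : Type u) [Bicategory.{max u v w, v} X]
    [Bicategory.{max u v w, v} Y] :
    ∃ χ : GrayIcon.of (GrayTensor (St X) (St Y)) ⟶ GrayIcon.of (St (X × Y)),
      (GrayTensor.c (St X) (St Y)).comp (GrayIcon.toPseudo χ) = St.hat X Y ∧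
      (∀ χ' : GrayIcon.of (GrayTensor (St X) (St Y)) ⟶ GrayIcon.of (St (X × Y)),
        (GrayTensor.c (St X) (St Y)).comp (GrayIcon.toPseudo χ') = St.hat X Y → χ' = χ) ∧
      IsInternalEquivalence χ ∧
      ∃ χbar : GrayIcon.of (St (X × Y)) ⟶ GrayIcon.of (GrayTensor (St X) (St Y)),
        (St.f (X × Y)).comp (GrayIcon.toPseudo χbar) =
          (prodMap (St.f X) (St.f Y)).comp (GrayTensor.c (St X) (St Y)) ∧
        IsPseudoInverse χ χbar := by
  let χ : GrayIcon.of (GrayTensor (St X) (St Y)) ⟶ GrayIcon.of (St (X × Y)) := St.chi X Y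
  let χbar : GrayIcon.of (St (X × Y)) ⟶ GrayIcon.of (GrayTensor (St X) (St Y)) := St.chiBar X Y
  have h : IsPseudoInverse χ χbar :=
    ⟨GrayIcon.nonempty_iso (St.iconIso_chi_chiBar X Y),
      GrayIcon.nonempty_iso (St.iconIso_chiBar_chi X Y)⟩
  exact ⟨χ, St.c_comp_chi X Y,
    fun χ' h' => GrayTensor.eq_of_c_comp_eq (h'.trans (St.c_comp_chi X Y).symm),
    ⟨χbar, h⟩, χbar, St.f_comp_desc _, h⟩
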